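/- Let $\eta=\mathrm{diag}(-1,1,1,1,1)$ on $\mathbb R^5$, let $G=\mathrm{SO}_o(4,1)$ be the identity component of the group of matrices $A$ with $A^T\eta A=\eta$, and let $\mathfrak g$ be its Lie algebra. Put $x=(0,0,0,0,1)$, $u=(1,0,0,0,0)$. Let $K\subset G$ be the stabilizer of the pair $(x,u)$ (a copy of $\mathrm{SO}(3)$), and let $P\subset G$ be the parabolic subgroup that stabilizes the null line $[x-u]$; then $K\subset P$. A Cartan geometry on a smooth manifold $M$ modeled on $G/G'$ (with $G'\subset G$ a closed subgroup) is a smooth principal $G'$-bundle $Q\to M$ with a smooth $\mathfrak g$-valued 1-form $A$ such that every $A_q\colon T_qQ\to\mathfrak g$ is a linear isomorphism, $(R_g)^*A=\mathrm{Ad}(g^{-1})\circ A$ for all $g\in G'$, and $A$ restricts to the Maurer--Cartan form on vertical vectors. A Möbius geometry is a Cartan geometry modeled on $G/P$; an observer space geometry is a Cartan geometry modeled on $G/K$. Manifolds are Hausdorff and second countable. **Theorem.** Let $\pi\colon F\to S$, with Cartan connection $A$, be a Möbius geometry on a 3-manifold $S$. 1. The orbit space $F/K$ (with the quotient topology) is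 Hausdorff and second countable and carries a unique structure of a smooth 7-manifold for which $F\to F/K$, with the restricted action of $K$, is a smooth principal $K$-bundle. With the same form $A$, the bundle $F\to F/K$ is an observer space geometry. 2. Let $\mathfrak p=\{X\in\mathfrak g : X(x-u)\in\mathbb R(x-u)\}$ be the Lie algebra of $P$, and let $\delta$ be the inner product on $\mathfrak g/\mathfrak p$ induced by $(X,Y)\mapsto\eta(X(x-u),Y(x-u))$. For $f\in F$ let $e_f\colon T_{\pi(f)}S\to\mathfrak g/\mathfrak p$ be the coframe with $e_f(d\pi(v))=A_f(v)+\mathfrak p$ for $v\in T_fF$. The inner products $e_f^*\delta$ with $\pi(f)=s$ form, for each $s\in S$, exactly one ray $\{c\,g : c>0\}$ of inner products on $T_sS$, and these rays are a (smooth) conformal metric on $S$, the one induced by the Möbius geometry. Let $T\to S$ be its tautological $\mathbb R$-bundle, whose points are the pairs $(s,g)$ with $g$ in the ray at $s$. A transverse 3-plane in $T$ is a 3-dimensional subspace of a tangent space $T_mT$ that meets the tangent space of the fibre of $T\to S$ only in $0$. The space of all transverse 3-planes in $T$ is a smooth 7-manifold, with its standard structure as an open subset of the Grassmann bundle of 3-planes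 tangent to $T$. The map $\pi'\colon F\to T$, $\pi'(f)=(\pi(f),e_f^*\delta)$, is smooth, and $$f\cdot K\;\longmapsto\; d\pi'_f\bigl(A_f^{-1}(\mathfrak g_-)\bigr)\subset T_{\pi'(f)}T$$ is a well-defined diffeomorphism from $F/K$ onto the manifold of transverse 3-planes in $T$. Here $\mathfrak g_-\subset\mathfrak g$ is the 3-dimensional subspace of all differences (boost along $\xi$) $-$ (spatial translation along $\xi$), $\xi\in\mathbb R^3$; these elements annihilate $x+u$. -/

import Mathlib

open Bundle Topology
open scoped Manifold ContDiff Matrix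

/-! ### The de Sitter group and its subgroups -/

/-- Real `5 × 5` matrices. -/
abbrev Mat5 : Type := Matrix (Fin 5) (Fin 5) ℝ

/-- The Minkowski form of `ℝ^{4,1}`, as a matrix; the coordinate `0` is time. -/
def minkowski : Mat5 := Matrix.diagonal ![-1, 1, 1, 1, 1]

/-- The group `O(4,1)` of all matrices `A` with `Aᵀ η A = η`. -/
def O41 : Subgroup (GL (Fin 5) ℝ) where
  carrier := {A | (A : Mat5)ᵀ * minkowski * (A : Mat5) = minkowski}
  one_mem' := by simp
  mul_mem' := by
    intro A B hA hB
    simp only [Set.mem_ofPred_eq] at *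
    calc ((A * B : GL (Fin 5) ℝ) : Mat5)ᵀ * minkowski * ((A * B : GL (Fin 5) ℝ) : Mat5)
        = (B : Mat5)ᵀ * ((A : Mat5)ᵀ * minkowski * (A : Mat5)) * (B : Mat5) := by
          simp [Matrix.transpose_mul, Matrix.mul_assoc]
      _ = minkowski := by rw [hA, hB]
  inv_mem' := by
    intro A hA
    simp only [Set.mem_ofPred_eq] at *
    have h1 : (A : Mat5) * ((A⁻¹ : GL (Fin 5) ℝ) : Mat5) = 1 := by
      rw [← Units.val_mul, mul_inv_cancel, Units.val_one]
    have h2 : ((A⁻¹ : GL (Fin 5) ℝ) : Mat5)ᵀ * (A : Mat5)ᵀ = 1 := by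
      rw [← Matrix.transpose_mul, h1, Matrix.transpose_one]
    calc ((A⁻¹ : GL (Fin 5) ℝ) : Mat5)ᵀ * minkowski * ((A⁻¹ : GL (Fin 5) ℝ) : Mat5)
        = ((A⁻¹ : GL (Fin 5) ℝ) : Mat5)ᵀ * ((A : Mat5)ᵀ * minkowski * (A : Mat5))
            * ((A⁻¹ : GL (Fin 5) ℝ) : Mat5) := by rw [hA]
      _ = (((A⁻¹ : GL (Fin 5) ℝ) : Mat5)ᵀ * (A : Mat5)ᵀ) * minkowski
            * ((A : Mat5) * ((A⁻¹ : GL (Fin 5) ℝ) : Mat5)) := by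
          simp only [Matrix.mul_assoc]
      _ = minkowski := by rw [h1, h2, Matrix.one_mul, Matrix.mul_one]

/-- The connected de Sitter group `G = SO_o(4,1)`: the identity component of `O(4,1)`. -/
def deSitterGroup : Subgroup (GL (Fin 5) ℝ) :=
  (Subgroup.connectedComponentOfOne O41).map O41.subtype

/-- The Lie algebra `𝔤 = 𝔰𝔬(4,1)`, i.e. the matrices `X` with `Xᵀ η = - η X`. -/
def deSitterAlgebra : Submodule ℝ Mat5 := skewAdjointMatricesSubmodule minkowski

/-- The base event `x = (0,0,0,0,1)` of de Sitter spacetime. -/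
def baseEvent : Fin 5 → ℝ := ![0, 0, 0, 0, 1]

/-- The base velocity `u = (1,0,0,0,0)`. -/
def baseVelocity : Fin 5 → ℝ := ![1, 0, 0, 0, 0]

/-- The null vector `x - u` on the past light cone; its span is the asymptotic past of the
base observer, and it is the base point of the projective light cone. -/
def pastVector : Fin 5 → ℝ := baseEvent - baseVelocity

/-- The stabilizer `K` in `G` of the base observer `(x, u)` (a copy of `SO(3)`). -/
def rotationGroup : Subgroup (GL (Fin 5) ℝ) where
  carrier := {A | A ∈ deSitterGroup ∧ (A : Mat5) *ᵥ baseEvent = baseEvent ∧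
    (A : Mat5) *ᵥ baseVelocity = baseVelocity}
  one_mem' := ⟨one_mem _, by simp, by simp⟩
  mul_mem' := by
    rintro A B ⟨hA, hA1, hA2⟩ ⟨hB, hB1, hB2⟩
    refine ⟨mul_mem hA hB, ?_, ?_⟩
    · rw [Units.val_mul, ← Matrix.mulVec_mulVec, hB1, hA1]
    · rw [Units.val_mul, ← Matrix.mulVec_mulVec, hB2, hA2]
  inv_mem' := by
    rintro A ⟨hA, hA1, hA2⟩
    have h1 : ((A⁻¹ : GL (Fin 5) ℝ) : Mat5) * (A : Mat5) = 1 := by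
      rw [← Units.val_mul, inv_mul_cancel, Units.val_one]
    refine ⟨inv_mem hA, ?_, ?_⟩
    · nth_rewrite 1 [← hA1]
      rw [Matrix.mulVec_mulVec, h1, Matrix.one_mulVec]
    · nth_rewrite 1 [← hA2]
      rw [Matrix.mulVec_mulVec, h1, Matrix.one_mulVec]

/-- The parabolic subgroup `P` of `G`: the stabilizer of the point `[x - u]` of the projective
light cone. -/
def parabolicGroup : Subgroup (GL (Fin 5) ℝ) where
  carrier := {A | A ∈ deSitterGroup ∧ ∃ c : ℝ, c ≠ 0 ∧
    (A : Mat5) *ᵥ pastVector = c • pastVector}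
  one_mem' := ⟨one_mem _, 1, one_ne_zero, by simp⟩
  mul_mem' := by
    rintro A B ⟨hA, a, ha, hA1⟩ ⟨hB, b, hb, hB1⟩
    refine ⟨mul_mem hA hB, b * a, mul_ne_zero hb ha, ?_⟩
    rw [Units.val_mul, ← Matrix.mulVec_mulVec, hB1, Matrix.mulVec_smul, hA1, smul_smul]
  inv_mem' := by
    rintro A ⟨hA, a, ha, hA1⟩
    have h1 : ((A⁻¹ : GL (Fin 5) ℝ) : Mat5) * (A : Mat5) = 1 := by
      rw [← Units.val_mul, inv_mul_cancel, Units.val_one]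
    refine ⟨inv_mem hA, a⁻¹, inv_ne_zero ha, ?_⟩
    have h2 : pastVector = a⁻¹ • ((A : Mat5) *ᵥ pastVector) := by
      rw [hA1, smul_smul, inv_mul_cancel₀ ha, one_smul]
    nth_rewrite 1 [h2]
    rw [Matrix.mulVec_smul, Matrix.mulVec_mulVec, h1, Matrix.one_mulVec]

theorem rotationGroup_le_parabolicGroup : rotationGroup ≤ parabolicGroup := by
  rintro A ⟨hA, h1, h2⟩
  refine ⟨hA, 1, one_ne_zero, ?_⟩
  rw [pastVector, Matrix.mulVec_sub, h1, h2, one_smul]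

/-- The inner product `δ` on `𝔤/𝔭`, as a form on `𝔤`: `δ(X, Y) = η(X v, Y v)` with `v = x - u`.
Under the identification of `𝔤/𝔭` with the tangent space at `[v]` of the projective light cone,
this is the metric of the conformal class that corresponds to the point `v` of the past cone.
It vanishes if `X` or `Y` lies in `𝔭 = {X | X v ∈ ℝ v}`, and is invariant under `Ad(P)` up to a
positive factor. -/
def modelMetric (X Y : Mat5) : ℝ :=
  (X *ᵥ pastVector) ⬝ᵥ (minkowski *ᵥ (Y *ᵥ pastVector))

/-- The element of `𝔤` that moves the asymptotic past `[x - u]` in the direction `ξ` and fixes the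
asymptotic future `[x + u]`: the boost along `ξ` minus the spatial translation along `ξ`. -/
def pastTranslation (ξ : Fin 3 → ℝ) : Mat5 :=
  !![0,   ξ 0, ξ 1, ξ 2, 0;
     ξ 0, 0,   0,   0,   -ξ 0;
     ξ 1, 0,   0,   0,   -ξ 1;
     ξ 2, 0,   0,   0,   -ξ 2;
     0,   ξ 0, ξ 1, ξ 2, 0]

/-- The summand `𝔤₋` of the grading `𝔤 = 𝔤₋ ⊕ 𝔤₀ ⊕ 𝔤₊`, where `𝔭 = 𝔤₀ ⊕ 𝔤₊`. -/
def gMinus : Submodule ℝ Mat5 where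
  carrier := Set.range pastTranslation
  zero_mem' := ⟨0, by ext i j; fin_cases i <;> fin_cases j <;> simp [pastTranslation]⟩
  add_mem' := by
    rintro _ _ ⟨ξ, rfl⟩ ⟨ζ, rfl⟩
    refine ⟨ξ + ζ, ?_⟩
    ext i j
    fin_cases i <;> fin_cases j <;> simp [pastTranslation, add_comm]
  smul_mem' := by
    rintro c _ ⟨ξ, rfl⟩
    refine ⟨c • ξ, ?_⟩
    ext i j
    fin_cases i <;> fin_cases j <;> simp [pastTranslation]

/-! ### Principal bundles and Cartan geometries -/

/-- Euclidean space of dimension `n`. -/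
abbrev E (n : ℕ) : Type := EuclideanSpace ℝ (Fin n)

/-- The vector space of real `5 × 5` matrices with its standard topology and smooth structure, as
a space of functions of two indices. -/
abbrev MatSpace : Type := Fin 5 → Fin 5 → ℝ

/-- The entries of an invertible matrix. -/
def entries (A : GL (Fin 5) ℝ) : MatSpace := fun i j => (A : Mat5) i j

/-- A smooth principal `H`-bundle `Q → M`, for a closed subgroup `H` of `GL(5,ℝ)`, with its right
action of `H` on `Q`; here `dim Q = m` and `dim M = n`. A map defined on (a manifold times) the
embedded submanifold `H` of the space of matrices is smooth if locally it extends smoothly to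
a neighbourhood in (that manifold times) the space of matrices, and a map into `H` is smooth if it
is so as a map into the space of matrices. -/
structure PrincipalBundle (H : Subgroup (GL (Fin 5) ℝ)) (m n : ℕ)
    (Q : Type*) [TopologicalSpace Q] [ChartedSpace (E m) Q]
    (M : Type*) [TopologicalSpace M] [ChartedSpace (E n) M] where
  /-- the bundle projection -/
  proj : Q → M
  /-- the right action `(q, h) ↦ q · h` -/
  act : Q → H → Q
  act_one : ∀ q, act q 1 = q
  act_mul : ∀ q (a b : H), act q (a * b) = act (act q a) b
  act_free : ∀ q (h : H), act q h = q → h = 1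
  proj_act : ∀ q (h : H), proj (act q h) = proj q
  proj_smooth : ContMDiff (𝓡 m) (𝓡 n) ∞ proj
  act_smooth : ∀ (q : Q) (h : H), ∃ ψ : Q × MatSpace → Q,
    ContMDiffAt ((𝓡 m).prod 𝓘(ℝ, MatSpace)) (𝓡 m) ∞ ψ (q, entries h) ∧
    ∀ᶠ z in 𝓝 (q, entries h),
      ∀ h' : H, entries h' = z.2 → ψ z = act z.1 h'
  /-- Local triviality: over `U` there are a smooth section `s` and a smooth map
  `τ : proj⁻¹ U → H` with `q = s (proj q) · τ q`, so that `(y, h) ↦ s y · h` is a diffeomorphism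
  `U × H ≅ proj⁻¹ U`. -/
  locally_trivial : ∀ x : M, ∃ U : Set M, IsOpen U ∧ x ∈ U ∧
    (∃ s : M → Q, ContMDiffOn (𝓡 n) (𝓡 m) ∞ s U ∧ (∀ y ∈ U, proj (s y) = y) ∧
      ∃ τ : Q → H,
        ContMDiffOn (𝓡 m) 𝓘(ℝ, MatSpace) ∞
          (fun q => entries (τ q)) (proj ⁻¹' U) ∧
        ∀ q ∈ proj ⁻¹' U, act (s (proj q)) (τ q) = q)

/-- A Cartan geometry on the `n`-manifold `M`, modeled on `G/H`, where `G = SO_o(4,1)` and `H` is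
a closed subgroup of `G`: a principal `H`-bundle `Q → M` (with `dim Q = dim G = 10`) with
a Cartan connection. -/
structure CartanGeometry (H : Subgroup (GL (Fin 5) ℝ)) (n : ℕ)
    (Q : Type*) [TopologicalSpace Q] [ChartedSpace (E 10) Q] [IsManifold (𝓡 10) ∞ Q]
    (M : Type*) [TopologicalSpace M] [ChartedSpace (E n) M]
    extends PrincipalBundle H 10 n Q M where
  /-- the `𝔤`-valued 1-form `A` -/
  conn : ∀ q : Q, TangentSpace (𝓡 10) q →ₗ[ℝ] deSitterAlgebra
  /-- `A` is smooth: it is smooth as a function on the tangent bundle. -/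
  conn_smooth : ContMDiff (𝓡 10).tangent 𝓘(ℝ, MatSpace) ∞
    (fun v : TangentBundle (𝓡 10) Q => (fun i j => (conn v.proj v.2 : Mat5) i j : MatSpace))
  /-- Each `A_q` is a linear isomorphism. -/
  conn_bijective : ∀ q, Function.Bijective (conn q)
  /-- `(R_h)^* A = Ad(h⁻¹) ∘ A`. -/
  conn_equivariant : ∀ (h : H) (q : Q) (v : TangentSpace (𝓡 10) q),
    (conn (act q h) (mfderiv (𝓡 10) (𝓡 10) (fun q' => act q' h) q v) : Mat5) =
      ((h⁻¹ : GL (Fin 5) ℝ) : Mat5) * (conn q v : Mat5) * ((h : GL (Fin 5) ℝ) : Mat5)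
  /-- On each fibre `A` is the Maurer–Cartan form: along the vertical curve `t ↦ q · γ(t)` its value
  is `γ(t)⁻¹ γ'(t)`. -/
  conn_vertical : ∀ (q : Q) (γ : ℝ → H),
    ContDiff ℝ ∞ (fun t => entries (γ t)) → ∀ t : ℝ,
    (conn (act q (γ t))
        (mfderiv 𝓘(ℝ, ℝ) (𝓡 10) (fun r : ℝ => act q (γ r)) t (1 : ℝ)) : Mat5) =
      (((γ t)⁻¹ : GL (Fin 5) ℝ) : Mat5) *
        Matrix.of (deriv (fun r => entries (γ r)) t)

/-- A Möbius geometry on the 3-manifold `S`: a Cartan geometry modeled on `G/P`. -/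
abbrev MoebiusGeometry
    (F : Type*) [TopologicalSpace F] [ChartedSpace (E 10) F] [IsManifold (𝓡 10) ∞ F]
    (S : Type*) [TopologicalSpace S] [ChartedSpace (E 3) S] :=
  CartanGeometry parabolicGroup 3 F S

/-- An observer space geometry on the 7-manifold `O`: a Cartan geometry modeled on `G/K`. -/
abbrev ObserverSpaceGeometry
    (F : Type*) [TopologicalSpace F] [ChartedSpace (E 10) F] [IsManifold (𝓡 10) ∞ F]
    (O : Type*) [TopologicalSpace O] [ChartedSpace (E 7) O] :=
  CartanGeometry rotationGroup 7 F O

/-! ### Conformal metrics, tautological bundles and transverse 3-planes -/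

section Conformal

variable (S : Type*) [TopologicalSpace S] [ChartedSpace (E 3) S] [IsManifold (𝓡 3) ∞ S]

/-- Bilinear forms on the tangent space at `s`. -/
abbrev FormAt (s : S) : Type :=
  TangentSpace (𝓡 3) s →L[ℝ] TangentSpace (𝓡 3) s →L[ℝ] ℝ

/-- The total space of the vector bundle `T^*S ⊗ T^*S` of bilinear forms on tangent spaces. -/
abbrev FormBundle : Type _ := TotalSpace (E 3 →L[ℝ] E 3 →L[ℝ] ℝ) (FormAt S)

/-- The model with corners of the manifold `FormBundle S`. -/
noncomputable abbrev formModel := (𝓡 3).prod 𝓘(ℝ, E 3 →L[ℝ] E 3 →L[ℝ] ℝ)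

variable {S}

-- Mathlib's topology and smooth structure on the bundle of bilinear forms, recorded as shortcuts.
noncomputable instance : TopologicalSpace (FormBundle S) := inferInstance

noncomputable instance :
    ChartedSpace (ModelProd (E 3) (E 3 →L[ℝ] E 3 →L[ℝ] ℝ)) (FormBundle S) := inferInstance

set_option synthInstance.maxHeartbeats 400000 in
instance : IsManifold (formModel) ∞ (FormBundle S) :=
  Bundle.TotalSpace.isManifold (n := ∞) (E 3 →L[ℝ] E 3 →L[ℝ] ℝ) (FormAt S)

instance : IsManifold (formModel) 1 (FormBundle S) := IsManifold.of_le (n := ∞) (by simp)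

set_option synthInstance.maxHeartbeats 400000 in
noncomputable instance : TopologicalSpace (TangentBundle (formModel) (FormBundle S)) :=
  inferInstance

set_option synthInstance.maxHeartbeats 400000 in
noncomputable instance :
    ChartedSpace (ModelProd (ModelProd (E 3) (E 3 →L[ℝ] E 3 →L[ℝ] ℝ))
      (E 3 × (E 3 →L[ℝ] E 3 →L[ℝ] ℝ))) (TangentBundle (formModel) (FormBundle S)) :=
  inferInstance

/-- `C` assigns to each point `s` a set `C s` of bilinear forms on `T_s S`. It is a conformal metric
if each `C s` is a ray `{c g | c > 0}` of inner products, depending smoothly on `s` in the sense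
that near each point there is a smooth Riemannian metric in the class. -/
structure IsConformalMetric (C : ∀ s : S, Set (FormAt S s)) : Prop where
  symm : ∀ s, ∀ g ∈ C s, ∀ v w, g v w = g w v
  pos : ∀ s, ∀ g ∈ C s, ∀ v, v ≠ 0 → 0 < g v v
  ray : ∀ s, ∀ g ∈ C s, ∀ g' : FormAt S s, g' ∈ C s ↔ ∃ c : ℝ, 0 < c ∧ g' = c • g
  locally_smooth : ∀ s₀ : S, ∃ U : Set S, IsOpen U ∧ s₀ ∈ U ∧ ∃ g : ∀ s, FormAt S s,
    (∀ s ∈ U, g s ∈ C s) ∧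
    ContMDiffOn (𝓡 3) (formModel) ∞ (fun s => (⟨s, g s⟩ : FormBundle S)) U

/-- The tautological bundle of a conformal metric `C`, as a submanifold of the bundle of bilinear
forms: its points are the pairs `(s, g)` with `g` an inner product on `T_s S` in the class `C s`;
the real number `t` acts by `(s, g) ↦ (s, exp(2t) g)`. -/
def tautologicalBundle (C : ∀ s : S, Set (FormAt S s)) : Set (FormBundle S) :=
  {m | m.2 ∈ C m.1}

/-- The tangent vectors at `m` of the tautological bundle: velocities of smooth curves in it. -/
def tautologicalTangent (C : ∀ s : S, Set (FormAt S s)) (m : FormBundle S) :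
    Set (TangentSpace (formModel) m) :=
  {w | ∃ γ : ℝ → FormBundle S, ContMDiff 𝓘(ℝ, ℝ) (formModel) ∞ γ ∧
    (∀ t, γ t ∈ tautologicalBundle C) ∧
    tangentMap 𝓘(ℝ, ℝ) (formModel) γ ⟨0, (1 : ℝ)⟩ = ⟨m, w⟩}

/-- The observer space of a conformal 3-manifold: the space of transverse 3-planes in its
tautological bundle, i.e. of pairs `(m, W)` with `m` a point of that bundle and `W` a 3-dimensional
subspace of its tangent space at `m` that meets the fibre direction (the kernel of the derivative
of the projection to `S`) trivially. -/
def transversePlanes (C : ∀ s : S, Set (FormAt S s)) :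
    Set (Σ m : FormBundle S, Submodule ℝ (TangentSpace (formModel) m)) :=
  {W | W.1 ∈ tautologicalBundle C ∧
    (W.2 : Set (TangentSpace (formModel) W.1)) ⊆ tautologicalTangent C W.1 ∧
    Module.finrank ℝ W.2 = 3 ∧
    ∀ w ∈ W.2, mfderiv (formModel) (𝓡 3)
      (TotalSpace.proj : FormBundle S → S) W.1 w = 0 → w = 0}

/-- A family of transverse 3-planes parametrized by `ℝᵏ` is smooth if its base point depends
smoothly on the parameter and its planes are locally spanned by smooth vector fields. -/
def IsSmoothPlaneFamily (C : ∀ s : S, Set (FormAt S s)) {k : ℕ}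
    (h : E k → transversePlanes C) : Prop :=
  ContMDiff (𝓡 k) (formModel) ∞ (fun p => (h p).1.1) ∧
  ∀ p₀ : E k, ∃ U : Set (E k), IsOpen U ∧ p₀ ∈ U ∧
    ∃ w : Fin 3 → ∀ p : E k, TangentSpace (formModel) (h p).1.1,
      (∀ i, ContMDiffOn (𝓡 k) (formModel).tangent ∞
        (fun p => (⟨(h p).1.1, w i p⟩ : TangentBundle (formModel) (FormBundle S))) U) ∧
      ∀ p ∈ U, (h p).1.2 = Submodule.span ℝ (Set.range fun i => w i p)

/-- The given manifold structure on the space of transverse 3-planes is the standard one, that of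
an open subset of the Grassmann bundle of 3-planes tangent to the tautological bundle: the smooth
maps from the spaces `ℝᵏ` into it are exactly the smooth families of planes. (This determines the
manifold structure.) -/
def IsStandardPlaneManifold (C : ∀ s : S, Set (FormAt S s))
    [TopologicalSpace (transversePlanes C)] [ChartedSpace (E 7) (transversePlanes C)] : Prop :=
  IsManifold (𝓡 7) ∞ (transversePlanes C) ∧
  ∀ (k : ℕ) (h : E k → transversePlanes C),
    ContMDiff (𝓡 k) (𝓡 7) ∞ h ↔ IsSmoothPlaneFamily C h

end Conformal

/-! ### Constructions from a Möbius geometry -/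

namespace CartanGeometry

variable {F : Type*} [TopologicalSpace F] [ChartedSpace (E 10) F] [IsManifold (𝓡 10) ∞ F]
  {S : Type*} [TopologicalSpace S] [ChartedSpace (E 3) S]

/-- The restriction of the action of `P` to the subgroup `K`. -/
def actK (M : MoebiusGeometry F S) (f : F) (k : rotationGroup) : F :=
  M.act f (Subgroup.inclusion rotationGroup_le_parabolicGroup k)

/-- Two points of `F` are equivalent if they lie in the same orbit of `K`. -/
def orbitSetoid (M : MoebiusGeometry F S) : Setoid F where
  r f f' := ∃ k : rotationGroup, f' = M.actK f k
  iseqv := by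
    refine ⟨fun f => ⟨1, ?_⟩, ?_, ?_⟩
    · rw [actK, map_one, M.act_one]
    · rintro f f' ⟨k, rfl⟩
      refine ⟨k⁻¹, ?_⟩
      rw [actK, actK, ← M.act_mul, ← map_mul, mul_inv_cancel, map_one, M.act_one]
    · rintro f f' f'' ⟨k, rfl⟩ ⟨l, rfl⟩
      refine ⟨k * l, ?_⟩
      rw [actK, actK, actK, ← M.act_mul, ← map_mul]

/-- The orbit space `F/K`, with the quotient topology. -/
abbrev OrbitSpace (M : MoebiusGeometry F S) : Type _ := Quotient M.orbitSetoid

/-- The quotient map `F → F/K`. -/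
def toOrbit (M : MoebiusGeometry F S) (f : F) : M.OrbitSpace := Quotient.mk M.orbitSetoid f

/-- The point `m = (s, g)` of the bundle of bilinear forms is the pullback of `δ` along the coframe
`e_f : T_{π(f)} S ≅ 𝔤/𝔭` that the Cartan connection gives at `f`, that is, `e_f (dπ v)` is the class
of `A_f v` for `v ∈ T_f F`. -/
def IsCoframePullback (M : MoebiusGeometry F S) [IsManifold (𝓡 3) ∞ S]
    (f : F) (m : FormBundle S) : Prop :=
  ∃ g : FormAt S (M.proj f), m = ⟨M.proj f, g⟩ ∧
    ∀ v w : TangentSpace (𝓡 10) f,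
      g (mfderiv (𝓡 10) (𝓡 3) M.proj f v) (mfderiv (𝓡 10) (𝓡 3) M.proj f w) =
        modelMetric (M.conn f v) (M.conn f w)

/-- The conformal metric on `S` induced by the Möbius geometry: at `s` it consists of the pullbacks
of `δ` along the coframes `e_f`, with `f` in the fibre over `s`. -/
def inducedConformal (M : MoebiusGeometry F S) [IsManifold (𝓡 3) ∞ S]
    (s : S) : Set (FormAt S s) :=
  {g | ∃ f : F, M.IsCoframePullback f ⟨s, g⟩}

/-- The subspace `A_f⁻¹(𝔤₋)` of `T_f F`. -/
noncomputable def minusSpace (M : MoebiusGeometry F S) (f : F) : Submodule ℝ (TangentSpace (𝓡 10) f) :=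
  (gMinus.comap deSitterAlgebra.subtype).comap (M.conn f)

end CartanGeometry

/-!
Everything is read off from one function on `TF`: the value `A(V) (x - u) ∈ ℝ⁵` of the connection
on the null vector, called `nullMotion` below. Since elements of `𝔤` are skew, it is of the form
`ξ + c (x - u)` with `ξ ∈ ℝ³` spatial. The spatial part `ξ` is the class of `A(V)` in `𝔤/𝔭`, its
square is `(e_f^* δ)(dπ V, dπ V)`, and it vanishes exactly on the vertical vectors
(`mfderiv_proj_eq_zero_iff`); on a vertical vector, `2c` is the logarithmic derivative of
`e_f^* δ`, because `p ∈ P` multiplies `e_f^* δ` by the square of the factor by which `p` scales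
`x - u` (`toForm_act`). Hence the kernel of `dπ'` is the kernel of `nullMotion`
(`mfderiv_toForm_eq_zero_iff`), and `nullMotion` gives coordinates `(ξ, c)` on `T_{π' f} T`, in
which the fibre direction is `ξ = 0` and the plane `dπ'_f (A_f⁻¹(𝔤₋))` is `c = 0` (`mem_planeAt`).

The group `P` consists of the elements `n(b) a(t) k` with `n(b)` a null rotation, `a(t)` a boost
and `k ∈ K`, and `(t, b)` is a smooth function on `P` (`parabolicCoord`), so that `P → P/K` has
a global slice. Multiplied by charts of `S`, it gives local slices for `F → F/K`
(`exists_localSlice`), and these are the charts of a manifold structure on the quotient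
(`LocalSlice.exists_manifold`) for which `F → F/K` is smooth and has smooth local sections. From
this the principal bundle structure and the uniqueness of the smooth structure follow.

A plane transverse to the fibre of `T` is the graph `c = -⟨b, ξ⟩` of a linear function, and as
`n(b)⁻¹` maps `ξ + c (x - u)` to `ξ + (c + ⟨b, ξ⟩) (x - u)`, it is the plane of `f · n(b)`. The
points of `F` over a given point of `T` form an orbit of the group of the elements `n(b) k`, so each
transverse plane belongs to exactly one orbit of `K` (`exists_planeAt_eq`,
`exists_actK_of_planeAt_eq`). The resulting bijection from `F/K` to the transverse planes carries
the manifold structure over. That structure is the standard one since smoothness of families of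
planes can be tested in `F`: for a smooth family of points of `F` the planes are spanned by images
of the vector fields on which `A` is constant (`exists_smooth_frame`), and a smooth family of planes
lifts to `F`, as `b` is a smooth function of a spanning set by Cramer's rule
(`exists_lift_planeFamily`).
-/

/-! ### Lorentz matrices and the parabolic subgroup -/

/-- The Minkowski form `η(y, z)` of two vectors. -/
def lorentzForm (y z : Fin 5 → ℝ) : ℝ := y ⬝ᵥ (minkowski *ᵥ z)

theorem lorentzForm_eq (y z : Fin 5 → ℝ) :
    lorentzForm y z = -(y 0 * z 0) + y 1 * z 1 + y 2 * z 2 + y 3 * z 3 + y 4 * z 4 := by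
  simp [lorentzForm, minkowski, Matrix.mulVec_diagonal, dotProduct, Fin.sum_univ_five]

theorem lorentzForm_smul_smul (a b : ℝ) (y z : Fin 5 → ℝ) :
    lorentzForm (a • y) (b • z) = a * b * lorentzForm y z := by
  simp only [lorentzForm_eq, Pi.smul_apply, smul_eq_mul]; ring

theorem lorentzForm_mulVec {A : Mat5} (hA : Aᵀ * minkowski * A = minkowski) (y z : Fin 5 → ℝ) :
    lorentzForm (A *ᵥ y) (A *ᵥ z) = lorentzForm y z := by
  have h : A *ᵥ y = y ᵥ* Aᵀ := (Matrix.vecMul_transpose A y).symm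
  rw [lorentzForm, lorentzForm, h, ← Matrix.dotProduct_mulVec, Matrix.mulVec_mulVec,
    Matrix.mulVec_mulVec, hA]

theorem minkowski_mul_self : minkowski * minkowski = 1 := by
  ext i j
  fin_cases i <;> fin_cases j <;> simp [minkowski]

/-- A matrix of `O(4,1)`, as an invertible matrix. -/
def lorentzUnit (A : Mat5) (h : Aᵀ * minkowski * A = minkowski) : GL (Fin 5) ℝ where
  val := A
  inv := minkowski * Aᵀ * minkowski
  val_inv := by
    rw [mul_eq_one_comm, Matrix.mul_assoc, Matrix.mul_assoc, ← Matrix.mul_assoc _ minkowski A, h,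
      minkowski_mul_self]
  inv_val := by
    rw [Matrix.mul_assoc, Matrix.mul_assoc, ← Matrix.mul_assoc _ minkowski A, h,
      minkowski_mul_self]

theorem deSitterGroup_le_O41 : deSitterGroup ≤ O41 := by
  rintro _ ⟨A, -, rfl⟩
  exact A.2

theorem transpose_mul_minkowski_mul {A : GL (Fin 5) ℝ} (hA : A ∈ deSitterGroup) :
    (A : Mat5)ᵀ * minkowski * (A : Mat5) = minkowski := deSitterGroup_le_O41 hA

theorem inv_eq_of_mem_deSitterGroup {A : GL (Fin 5) ℝ} (hA : A ∈ deSitterGroup) :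
    ((A⁻¹ : GL (Fin 5) ℝ) : Mat5) = minkowski * (A : Mat5)ᵀ * minkowski := by
  have : A = lorentzUnit A (transpose_mul_minkowski_mul hA) := Units.ext rfl
  rw [this]; rfl

/-- The points of a path in `O(4,1)` that starts at the identity lie in the identity component. -/
theorem mem_deSitterGroup_of_path (γ : ℝ → GL (Fin 5) ℝ) (hc : Continuous fun t => (γ t : Mat5))
    (h : ∀ t, γ t ∈ O41) (h0 : γ 0 = 1) (t : ℝ) : γ t ∈ deSitterGroup := by
  have hinv : ∀ t, (((γ t)⁻¹ : GL (Fin 5) ℝ) : Mat5) = minkowski * (γ t : Mat5)ᵀ * minkowski := by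
    intro t
    have : γ t = lorentzUnit (γ t) (h t) := Units.ext rfl
    rw [this]; rfl
  have hcont : Continuous γ := by
    rw [Units.continuous_iff]
    refine ⟨hc, ?_⟩
    simp only [hinv]
    exact ((continuous_const.matrix_mul hc.matrix_transpose).matrix_mul continuous_const)
  have hcont' : Continuous (fun t => (⟨γ t, h t⟩ : O41)) := hcont.subtype_mk h
  have hpre : IsPreconnected (Set.range fun t => (⟨γ t, h t⟩ : O41)) :=
    isPreconnected_range hcont'
  have hsub := hpre.subset_connectedComponent (x := (1 : O41)) ⟨0, Subtype.ext h0⟩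
  exact ⟨⟨γ t, h t⟩, hsub ⟨t, rfl⟩, rfl⟩

/-- The vector `x + u` on the future light cone: the asymptotic future of the base observer. -/
def futureVector : Fin 5 → ℝ := baseEvent + baseVelocity

theorem pastVector_eq : pastVector = ![-1, 0, 0, 0, 1] := by
  ext i; fin_cases i <;> simp [pastVector, baseEvent, baseVelocity]

theorem futureVector_eq : futureVector = ![1, 0, 0, 0, 1] := by
  ext i; fin_cases i <;> simp [futureVector, baseEvent, baseVelocity]

theorem mulVec_pastVector_apply (A : Mat5) (i : Fin 5) :
    (A *ᵥ pastVector) i = A i 4 - A i 0 := by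
  simp [pastVector_eq, Matrix.mulVec, dotProduct, Fin.sum_univ_five]; ring

theorem mulVec_futureVector_apply (A : Mat5) (i : Fin 5) :
    (A *ᵥ futureVector) i = A i 0 + A i 4 := by
  simp [futureVector_eq, Matrix.mulVec, dotProduct, Fin.sum_univ_five]

/-- The elements of the identity component preserve the time orientation: the entry is never zero on
`O(4,1)`, and it is positive at the identity. -/
theorem zero_lt_apply_zero_zero {A : GL (Fin 5) ℝ} (hA : A ∈ deSitterGroup) :
    0 < (A : Mat5) 0 0 := by
  obtain ⟨B, hB, rfl⟩ := hA
  have hsq : ∀ C : O41, ((C : GL (Fin 5) ℝ) : Mat5) 0 0 ≠ 0 := by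
    intro C h0
    have h := congrFun (congrFun C.2 0) 0
    simp only [Matrix.mul_apply, minkowski, Matrix.transpose_apply, Matrix.diagonal,
      Matrix.of_apply, Fin.sum_univ_five] at h
    simp [h0] at h
    nlinarith [sq_nonneg (((C : GL (Fin 5) ℝ) : Mat5) 1 0),
      sq_nonneg (((C : GL (Fin 5) ℝ) : Mat5) 2 0), sq_nonneg (((C : GL (Fin 5) ℝ) : Mat5) 3 0),
      sq_nonneg (((C : GL (Fin 5) ℝ) : Mat5) 4 0)]
  have hcont : Continuous fun C : O41 => ((C : GL (Fin 5) ℝ) : Mat5) 0 0 :=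
    ((Units.continuous_val.comp continuous_subtype_val).matrix_elem 0 0)
  by_contra hneg
  have hpre : IsPreconnected (connectedComponent (1 : O41)) := isPreconnected_connectedComponent
  have := (hpre.image _ hcont.continuousOn).ordConnected
  have h1 : (1 : ℝ) ∈ (fun C : O41 => ((C : GL (Fin 5) ℝ) : Mat5) 0 0) ''
      connectedComponent (1 : O41) := ⟨1, mem_connectedComponent, by simp⟩
  obtain ⟨C, -, hC⟩ := this.out ⟨B, hB, rfl⟩ h1 ⟨not_lt.1 hneg, zero_le_one⟩
  exact hsq C hC

theorem mul_minkowski_mul_transpose {A : GL (Fin 5) ℝ} (hA : A ∈ deSitterGroup) :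
    (A : Mat5) * minkowski * (A : Mat5)ᵀ = minkowski := by
  have h : (A : Mat5) * ((A⁻¹ : GL (Fin 5) ℝ) : Mat5) = 1 := by
    rw [← Units.val_mul, mul_inv_cancel, Units.val_one]
  rw [inv_eq_of_mem_deSitterGroup hA] at h
  calc (A : Mat5) * minkowski * (A : Mat5)ᵀ
      = ((A : Mat5) * (minkowski * (A : Mat5)ᵀ * minkowski)) * minkowski := by
        simp only [Matrix.mul_assoc, minkowski_mul_self, Matrix.mul_one]
    _ = minkowski := by rw [h, Matrix.one_mul]

/-- The factor by which an element of `P` scales the null vector `x - u`. -/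
noncomputable def parabolicScale (p : parabolicGroup) : ℝ :=
  ((p : GL (Fin 5) ℝ) : Mat5) 4 4 - ((p : GL (Fin 5) ℝ) : Mat5) 4 0

theorem mulVec_pastVector_eq (p : parabolicGroup) :
    ((p : GL (Fin 5) ℝ) : Mat5) *ᵥ pastVector = parabolicScale p • pastVector := by
  obtain ⟨c, -, hc⟩ := p.2.2
  have h4 := congrFun hc 4
  rw [mulVec_pastVector_apply] at h4
  rw [parabolicScale, h4, hc]
  simp [pastVector_eq]

theorem parabolicScale_eq_of {p : parabolicGroup} {c : ℝ}
    (h : ((p : GL (Fin 5) ℝ) : Mat5) *ᵥ pastVector = c • pastVector) : parabolicScale p = c := by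
  have h4 := congrFun h 4
  rw [mulVec_pastVector_apply] at h4
  rw [parabolicScale, h4]; simp [pastVector_eq]

/-- Elements of `P` do not exchange the two halves of the null line, as they preserve the time
orientation. -/
theorem parabolicScale_pos (p : parabolicGroup) : 0 < parabolicScale p := by
  have h0 := congrFun (mulVec_pastVector_eq p) 0
  rw [mulVec_pastVector_apply] at h0
  have hA := zero_lt_apply_zero_zero p.2.1
  have h := congrFun (congrFun (mul_minkowski_mul_transpose p.2.1) 0) 0
  simp only [Matrix.mul_apply, minkowski, Matrix.transpose_apply, Matrix.diagonal,
    Matrix.of_apply, Fin.sum_univ_five] at h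
  simp at h
  simp [pastVector_eq] at h0
  generalize ((p : GL (Fin 5) ℝ) : Mat5) = A at *
  nlinarith [sq_nonneg (A 0 1), sq_nonneg (A 0 2), sq_nonneg (A 0 3)]

/-- The null rotation `n(b)` that fixes `x - u` and moves the asymptotic future `[x + u]` in the
direction `b`. -/
noncomputable def nullRotation (b : Fin 3 → ℝ) : Mat5 :=
  !![1 + (b 0 ^ 2 + b 1 ^ 2 + b 2 ^ 2) / 2, b 0, b 1, b 2, (b 0 ^ 2 + b 1 ^ 2 + b 2 ^ 2) / 2;
     b 0, 1, 0, 0, b 0;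
     b 1, 0, 1, 0, b 1;
     b 2, 0, 0, 1, b 2;
     -((b 0 ^ 2 + b 1 ^ 2 + b 2 ^ 2) / 2), -b 0, -b 1, -b 2,
       1 - (b 0 ^ 2 + b 1 ^ 2 + b 2 ^ 2) / 2]

/-- The boost `a(t)` along `x`, which scales `x - u` by `exp (-t)` and `x + u` by `exp t`. -/
noncomputable def dilation (t : ℝ) : Mat5 :=
  !![(Real.exp t + Real.exp (-t)) / 2, 0, 0, 0, (Real.exp t - Real.exp (-t)) / 2;
     0, 1, 0, 0, 0;
     0, 0, 1, 0, 0;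
     0, 0, 0, 1, 0;
     (Real.exp t - Real.exp (-t)) / 2, 0, 0, 0, (Real.exp t + Real.exp (-t)) / 2]

theorem nullRotation_isometry (b : Fin 3 → ℝ) :
    (nullRotation b)ᵀ * minkowski * nullRotation b = minkowski := by
  ext i j
  fin_cases i <;> fin_cases j <;>
    (simp [nullRotation, minkowski, Matrix.mul_apply, Fin.sum_univ_five, Matrix.diagonal]; try ring)

theorem dilation_isometry (t : ℝ) : (dilation t)ᵀ * minkowski * dilation t = minkowski := by
  have h : Real.exp t * Real.exp (-t) = 1 := by rw [← Real.exp_add]; simp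
  ext i j
  fin_cases i <;> fin_cases j <;>
    (simp [dilation, minkowski, Matrix.mul_apply, Fin.sum_univ_five, Matrix.diagonal]; try linarith)

theorem nullRotation_mem (b : Fin 3 → ℝ) :
    lorentzUnit (nullRotation b) (nullRotation_isometry b) ∈ deSitterGroup := by
  have := mem_deSitterGroup_of_path
    (fun t => lorentzUnit (nullRotation (t • b)) (nullRotation_isometry (t • b))) ?_
    (fun t => nullRotation_isometry (t • b)) ?_ 1
  · simpa using this
  · refine continuous_matrix fun i j => ?_
    fin_cases i <;> fin_cases j <;> simp [lorentzUnit, nullRotation] <;> fun_prop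
  · ext i j
    fin_cases i <;> fin_cases j <;> simp [lorentzUnit, nullRotation]

theorem dilation_mem (t : ℝ) : lorentzUnit (dilation t) (dilation_isometry t) ∈ deSitterGroup := by
  refine mem_deSitterGroup_of_path
    (fun t => lorentzUnit (dilation t) (dilation_isometry t)) ?_ (fun t => dilation_isometry t) ?_ t
  · refine continuous_matrix fun i j => ?_
    fin_cases i <;> fin_cases j <;> simp [lorentzUnit, dilation] <;> fun_prop
  · ext i j
    fin_cases i <;> fin_cases j <;> simp [lorentzUnit, dilation]

theorem nullRotation_mulVec_pastVector (b : Fin 3 → ℝ) :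
    nullRotation b *ᵥ pastVector = pastVector := by
  ext i
  rw [mulVec_pastVector_apply, pastVector_eq]
  fin_cases i <;> simp [nullRotation]

theorem nullRotation_mulVec_futureVector (b : Fin 3 → ℝ) :
    nullRotation b *ᵥ futureVector =
      ![1 + (b 0 ^ 2 + b 1 ^ 2 + b 2 ^ 2), 2 * b 0, 2 * b 1, 2 * b 2,
        1 - (b 0 ^ 2 + b 1 ^ 2 + b 2 ^ 2)] := by
  ext i
  rw [mulVec_futureVector_apply]
  fin_cases i <;> simp [nullRotation] <;> ring

theorem dilation_mulVec_pastVector (t : ℝ) :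
    dilation t *ᵥ pastVector = Real.exp (-t) • pastVector := by
  ext i
  rw [mulVec_pastVector_apply, pastVector_eq]
  fin_cases i <;> simp [dilation] <;> ring

theorem dilation_mulVec_futureVector (t : ℝ) :
    dilation t *ᵥ futureVector = Real.exp t • futureVector := by
  ext i
  rw [mulVec_futureVector_apply, futureVector_eq]
  fin_cases i <;> simp [dilation] <;> ring

/-- The elements `n(b) a(t)` of `P`, a set of representatives of the cosets of `K` in `P`. -/
noncomputable def parabolicSlice (c : ℝ × (Fin 3 → ℝ)) : parabolicGroup :=
  ⟨lorentzUnit (nullRotation c.2) (nullRotation_isometry c.2) *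
      lorentzUnit (dilation c.1) (dilation_isometry c.1),
    mul_mem (nullRotation_mem _) (dilation_mem _), Real.exp (-c.1), (Real.exp_pos _).ne', by
      rw [Units.val_mul, ← Matrix.mulVec_mulVec]
      simp only [lorentzUnit]
      rw [dilation_mulVec_pastVector, Matrix.mulVec_smul, nullRotation_mulVec_pastVector]⟩

theorem coe_parabolicSlice (c : ℝ × (Fin 3 → ℝ)) :
    ((parabolicSlice c : GL (Fin 5) ℝ) : Mat5) = nullRotation c.2 * dilation c.1 := rfl

theorem parabolicSlice_mulVec_pastVector (c : ℝ × (Fin 3 → ℝ)) :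
    ((parabolicSlice c : GL (Fin 5) ℝ) : Mat5) *ᵥ pastVector = Real.exp (-c.1) • pastVector := by
  rw [coe_parabolicSlice, ← Matrix.mulVec_mulVec, dilation_mulVec_pastVector, Matrix.mulVec_smul,
    nullRotation_mulVec_pastVector]

theorem parabolicSlice_mulVec_futureVector (c : ℝ × (Fin 3 → ℝ)) :
    ((parabolicSlice c : GL (Fin 5) ℝ) : Mat5) *ᵥ futureVector = Real.exp c.1 •
      ![1 + (c.2 0 ^ 2 + c.2 1 ^ 2 + c.2 2 ^ 2), 2 * c.2 0, 2 * c.2 1, 2 * c.2 2,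
        1 - (c.2 0 ^ 2 + c.2 1 ^ 2 + c.2 2 ^ 2)] := by
  rw [coe_parabolicSlice, ← Matrix.mulVec_mulVec, dilation_mulVec_futureVector, Matrix.mulVec_smul,
    nullRotation_mulVec_futureVector]

theorem parabolicScale_parabolicSlice (c : ℝ × (Fin 3 → ℝ)) :
    parabolicScale (parabolicSlice c) = Real.exp (-c.1) :=
  parabolicScale_eq_of (parabolicSlice_mulVec_pastVector c)

/-- Coordinates on `P/K`: the pair `(t, b)` with `p ∈ n(b) a(t) K`, read off from the columns
`p (x - u)` and `p (x + u)` of the matrix. -/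
noncomputable def parabolicCoord (A : MatSpace) : ℝ × (Fin 3 → ℝ) :=
  (-Real.log (A 4 4 - A 4 0),
    ((A 4 4 - A 4 0) / 2) • ![A 1 0 + A 1 4, A 2 0 + A 2 4, A 3 0 + A 3 4])

theorem parabolicCoord_entries_slice (c : ℝ × (Fin 3 → ℝ)) :
    parabolicCoord (entries (parabolicSlice c : GL (Fin 5) ℝ)) = c := by
  have h1 := parabolicScale_parabolicSlice c
  rw [parabolicScale] at h1
  have h2 := fun i => congrFun (parabolicSlice_mulVec_futureVector c) i
  simp only [mulVec_futureVector_apply] at h2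
  have h : Real.exp (-c.1) * Real.exp c.1 = 1 := by rw [← Real.exp_add]; simp
  refine Prod.ext ?_ ?_
  · simp [parabolicCoord, entries, h1]
  · ext i
    simp only [parabolicCoord, entries, h1, h2]
    fin_cases i <;> simp
    · linear_combination c.2 0 * h
    · linear_combination c.2 1 * h
    · linear_combination c.2 2 * h

theorem coe_inclusion_mulVec (k : rotationGroup) :
    ((Subgroup.inclusion rotationGroup_le_parabolicGroup k : GL (Fin 5) ℝ) : Mat5) *ᵥ pastVector =
        pastVector ∧
      ((Subgroup.inclusion rotationGroup_le_parabolicGroup k : GL (Fin 5) ℝ) : Mat5) *ᵥ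
        futureVector = futureVector := by
  obtain ⟨k, hk, h1, h2⟩ := k
  constructor
  · simp [pastVector, Matrix.mulVec_sub, h1, h2]
  · simp [futureVector, Matrix.mulVec_add, h1, h2]

/-- The coordinates depend on the coset `p K` only, as `K` fixes both null vectors. -/
theorem parabolicCoord_entries_mul_rotation (p : parabolicGroup) (k : rotationGroup) :
    parabolicCoord (entries
      (p * Subgroup.inclusion rotationGroup_le_parabolicGroup k : parabolicGroup)) =
    parabolicCoord (entries p) := by
  obtain ⟨h1, h2⟩ := coe_inclusion_mulVec k
  set k' := Subgroup.inclusion rotationGroup_le_parabolicGroup k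
  have e1 : (((p * k' : parabolicGroup) : GL (Fin 5) ℝ) : Mat5) *ᵥ pastVector =
      ((p : GL (Fin 5) ℝ) : Mat5) *ᵥ pastVector := by
    rw [Subgroup.coe_mul, Units.val_mul, ← Matrix.mulVec_mulVec, h1]
  have e2 : (((p * k' : parabolicGroup) : GL (Fin 5) ℝ) : Mat5) *ᵥ futureVector =
      ((p : GL (Fin 5) ℝ) : Mat5) *ᵥ futureVector := by
    rw [Subgroup.coe_mul, Units.val_mul, ← Matrix.mulVec_mulVec, h2]
  have f1 := fun i => congrFun e1 i
  have f2 := fun i => congrFun e2 i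
  simp only [mulVec_pastVector_apply, mulVec_futureVector_apply] at f1 f2
  simp only [parabolicCoord, entries, f1, f2]

/-- An element of `P` differs from the representative with the same coordinates by a rotation:
its value on `x + u` is determined by the spatial part, as the vector is null and its product with
`x - u` is known. -/
theorem parabolicSlice_inv_mul_mem (p : parabolicGroup) :
    ((parabolicSlice (parabolicCoord (entries p)))⁻¹ * p : GL (Fin 5) ℝ) ∈ rotationGroup := by
  set c := parabolicCoord (entries p) with hc
  have hpos := parabolicScale_pos p
  set l := parabolicScale p with hl
  have hc1 : Real.exp (-c.1) = l := by
    rw [hc, hl]; simp only [parabolicCoord, entries, neg_neg]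
    exact Real.exp_log hpos
  have hc2 : Real.exp c.1 = l⁻¹ := by rw [← hc1, ← Real.exp_neg, neg_neg]
  have e1 : ((p : GL (Fin 5) ℝ) : Mat5) *ᵥ pastVector =
      ((parabolicSlice c : GL (Fin 5) ℝ) : Mat5) *ᵥ pastVector := by
    rw [mulVec_pastVector_eq, parabolicSlice_mulVec_pastVector, hc1]
  have e2 : ((p : GL (Fin 5) ℝ) : Mat5) *ᵥ futureVector =
      ((parabolicSlice c : GL (Fin 5) ℝ) : Mat5) *ᵥ futureVector := by
    rw [parabolicSlice_mulVec_futureVector, hc2]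
    have g1 := lorentzForm_mulVec (transpose_mul_minkowski_mul p.2.1) futureVector pastVector
    have g2 := lorentzForm_mulVec (transpose_mul_minkowski_mul p.2.1) futureVector futureVector
    rw [mulVec_pastVector_eq, ← hl] at g1
    set y := ((p : GL (Fin 5) ℝ) : Mat5) *ᵥ futureVector with hy
    have hb : ∀ i : Fin 3, c.2 i = l / 2 * ![y 1, y 2, y 3] i := by
      intro i
      simp only [hy, mulVec_futureVector_apply]
      rw [hc, hl]
      fin_cases i <;> rfl
    simp only [lorentzForm_eq, Pi.smul_apply, smul_eq_mul] at g1 g2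
    simp [pastVector_eq, futureVector_eq] at g1 g2
    have b0 := hb 0
    have b1 := hb 1
    have b2 := hb 2
    simp at b0 b1 b2
    have hl0 : l ≠ 0 := hpos.ne'
    have g3 : y 0 + y 4 = 2 / l := by
      field_simp
      linarith
    have g4 : (y 4 - y 0) = -(l / 2 * (y 1 ^ 2 + y 2 ^ 2 + y 3 ^ 2)) := by
      have : (y 4 - y 0) * (2 / l) = - (y 1 ^ 2 + y 2 ^ 2 + y 3 ^ 2) := by
        rw [← g3]; linarith
      field_simp at this
      linarith
    ext i
    fin_cases i
    · simp [b0, b1, b2]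
      have : y 0 = ((2 / l) + (l / 2 * (y 1 ^ 2 + y 2 ^ 2 + y 3 ^ 2))) / 2 := by
        rw [← g3]; linarith
      rw [this]; field_simp
    · simp [b0]; field_simp
    · simp [b1]; field_simp
    · simp [b2]; field_simp
    · simp [b0, b1, b2]
      have : y 4 = ((2 / l) - (l / 2 * (y 1 ^ 2 + y 2 ^ 2 + y 3 ^ 2))) / 2 := by
        rw [← g3]; linarith
      rw [this]; field_simp
  have key : ∀ z, ((p : GL (Fin 5) ℝ) : Mat5) *ᵥ z =
      ((parabolicSlice c : GL (Fin 5) ℝ) : Mat5) *ᵥ z →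
      ((((parabolicSlice c)⁻¹ : parabolicGroup) * (p : GL (Fin 5) ℝ) : GL (Fin 5) ℝ) : Mat5) *ᵥ z =
        z := by
    intro z hz
    rw [Subgroup.coe_inv]
    rw [Units.val_mul, ← Matrix.mulVec_mulVec, hz, Matrix.mulVec_mulVec, ← Units.val_mul,
      inv_mul_cancel, Units.val_one, Matrix.one_mulVec]
  have k1 := key _ e1
  have k2 := key _ e2
  refine ⟨mul_mem (inv_mem (parabolicSlice c).2.1) p.2.1, ?_, ?_⟩
  · have : baseEvent = (1 / 2 : ℝ) • (futureVector + pastVector) := by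
      ext i; fin_cases i <;> simp [baseEvent, futureVector_eq, pastVector_eq]; norm_num
    rw [this, Matrix.mulVec_smul, Matrix.mulVec_add, k1, k2]
  · have : baseVelocity = (1 / 2 : ℝ) • (futureVector - pastVector) := by
      ext i; fin_cases i <;> simp [baseVelocity, futureVector_eq, pastVector_eq]; norm_num
    rw [this, Matrix.mulVec_smul, Matrix.mulVec_sub, k1, k2]

theorem contDiff_entries_parabolicSlice :
    ContDiff ℝ ∞ fun c : ℝ × (Fin 3 → ℝ) => entries (parabolicSlice c : GL (Fin 5) ℝ) := by
  have h1 : ∀ i j, ContDiff ℝ ∞ fun c : ℝ × (Fin 3 → ℝ) => nullRotation c.2 i j := by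
    intro i j
    fin_cases i <;> fin_cases j <;> simp [nullRotation] <;> fun_prop
  have h2 : ∀ i j, ContDiff ℝ ∞ fun c : ℝ × (Fin 3 → ℝ) => dilation c.1 i j := by
    intro i j
    fin_cases i <;> fin_cases j <;> simp [dilation] <;> fun_prop
  refine contDiff_pi.2 fun i => contDiff_pi.2 fun j => ?_
  simp only [entries, coe_parabolicSlice, Matrix.mul_apply]
  exact ContDiff.sum fun k _ => (h1 i k).mul (h2 k j)

theorem contDiffAt_parabolicCoord (p : parabolicGroup) :
    ContDiffAt ℝ ∞ parabolicCoord (entries p) := by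
  have hpos : entries p 4 4 - entries p 4 0 ≠ 0 := (parabolicScale_pos p).ne'
  have h : ∀ i j, ContDiffAt ℝ ∞ (fun A : MatSpace => A i j) (entries p) := by
    intro i j; fun_prop
  refine ContDiffAt.prodMk (((h 4 4).sub (h 4 0)).log hpos).neg ?_
  refine ContDiffAt.smul (((h 4 4).sub (h 4 0)).div_const _) ?_
  refine contDiffAt_pi.2 fun i => ?_
  fin_cases i
  · exact (h 1 0).add (h 1 4)
  · exact (h 2 0).add (h 2 4)
  · exact (h 3 0).add (h 3 4)

/-- The elements of the identity component have polynomial inverses. -/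
theorem entries_inv {A : GL (Fin 5) ℝ} (hA : A ∈ deSitterGroup) :
    entries A⁻¹ = fun i j => ∑ k, (∑ l, minkowski i l * entries A k l) * minkowski k j := by
  funext i j
  simp [entries, inv_eq_of_mem_deSitterGroup hA, Matrix.mul_apply]

/-! ### One-parameter subgroups -/

section Exponential

open scoped Matrix.Norms.Operator

theorem contDiff_matrixExp_smul_apply (X : Mat5) (i j : Fin 5) :
    ContDiff ℝ ∞ fun t : ℝ => NormedSpace.exp (t • X) i j := by
  have h1 : ContDiff ℝ ∞ fun t : ℝ => NormedSpace.exp (t • X) := by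
    refine contDiff_iff_contDiffAt.2 fun t => ?_
    have h : AnalyticAt ℝ (NormedSpace.exp : Mat5 → Mat5) (t • X) := NormedSpace.exp_analytic _
    exact h.contDiffAt.comp t (f := fun t : ℝ => t • X) (by fun_prop)
  exact ((Matrix.entryLinearMap ℝ ℝ i j).toContinuousLinearMap.contDiff).comp h1

theorem hasDerivAt_matrixExp_smul_apply (X : Mat5) (t : ℝ) (i j : Fin 5) :
    HasDerivAt (fun t : ℝ => NormedSpace.exp (t • X) i j) ((NormedSpace.exp (t • X) * X) i j) t :=
  ((Matrix.entryLinearMap ℝ ℝ i j).toContinuousLinearMap.hasFDerivAt).comp_hasDerivAt t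
    (hasDerivAt_exp_smul_const X t)

end Exponential

theorem matrixExp_smul_isometry {X : Mat5} (hX : X ∈ deSitterAlgebra) (t : ℝ) :
    (NormedSpace.exp (t • X))ᵀ * minkowski * NormedSpace.exp (t • X) = minkowski := by
  have h1 : Xᵀ * minkowski = minkowski * (-X) := by
    simpa [deSitterAlgebra, Matrix.IsSkewAdjoint, Matrix.IsAdjointPair] using hX
  have hunit : IsUnit minkowski := IsUnit.of_mul_eq_one _ minkowski_mul_self
  have hinv : minkowski⁻¹ = minkowski := Matrix.inv_eq_left_inv minkowski_mul_self
  have h2 : (t • X)ᵀ = minkowski * (-(t • X)) * minkowski⁻¹ := by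
    rw [hinv, Matrix.transpose_smul, ← smul_neg, Matrix.mul_smul, ← h1, Matrix.smul_mul,
      Matrix.mul_assoc, minkowski_mul_self, Matrix.mul_one]
  rw [← Matrix.exp_transpose, h2, Matrix.exp_conj _ _ hunit, hinv, Matrix.exp_neg,
    Matrix.mul_assoc, Matrix.mul_assoc, ← Matrix.mul_assoc minkowski minkowski,
    minkowski_mul_self, Matrix.one_mul, Matrix.mul_assoc, Matrix.nonsing_inv_mul, Matrix.mul_one]
  exact (Matrix.isUnit_iff_isUnit_det _).1 (Matrix.isUnit_exp _)

theorem matrixExp_smul_mulVec {X : Mat5} {y : Fin 5 → ℝ} {c : ℝ} (h : X *ᵥ y = c • y) (t : ℝ) :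
    NormedSpace.exp (t • X) *ᵥ y = Real.exp (t * c) • y := by
  have hd : ∀ i t, HasDerivAt (fun t : ℝ => Real.exp (-(t * c)) * (NormedSpace.exp (t • X) *ᵥ y) i)
      0 t := by
    intro i t
    have e1 : HasDerivAt (fun t : ℝ => (NormedSpace.exp (t • X) *ᵥ y) i)
        (((NormedSpace.exp (t • X) * X) *ᵥ y) i) t := by
      simp only [Matrix.mulVec, dotProduct]
      exact HasDerivAt.fun_sum fun j _ => (hasDerivAt_matrixExp_smul_apply X t i j).mul_const _
    have e2 : HasDerivAt (fun t : ℝ => Real.exp (-(t * c))) (Real.exp (-(t * c)) * (-(1 * c))) t :=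
      (((hasDerivAt_id t).mul_const c).neg).exp
    convert! e2.mul e1 using 1
    rw [← Matrix.mulVec_mulVec, h, Matrix.mulVec_smul, Pi.smul_apply, smul_eq_mul]
    ring
  ext i
  have h0 := is_const_of_deriv_eq_zero (fun t => (hd i t).differentiableAt)
    (fun t => (hd i t).deriv) t 0
  simp only [zero_smul, NormedSpace.exp_zero, Matrix.one_mulVec, zero_mul, neg_zero, Real.exp_zero,
    one_mul] at h0
  rw [Pi.smul_apply, smul_eq_mul, ← h0, ← mul_assoc, ← Real.exp_add, add_neg_cancel, Real.exp_zero,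
    one_mul]

/-- The one-parameter subgroup `exp (t X)` of `P`, for `X` in the Lie algebra `𝔭`. -/
noncomputable def parabolicExp {X : Mat5} (hX : X ∈ deSitterAlgebra) {c : ℝ}
    (h : X *ᵥ pastVector = c • pastVector) (t : ℝ) : parabolicGroup :=
  ⟨lorentzUnit (NormedSpace.exp (t • X)) (matrixExp_smul_isometry hX t), by
    refine mem_deSitterGroup_of_path
      (fun t => lorentzUnit (NormedSpace.exp (t • X)) (matrixExp_smul_isometry hX t)) ?_
      (fun t => matrixExp_smul_isometry hX t) ?_ t
    · exact continuous_matrix fun i j => (contDiff_matrixExp_smul_apply X i j).continuous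
    · exact Units.ext (by simp [lorentzUnit]),
    Real.exp (t * c), (Real.exp_pos _).ne', matrixExp_smul_mulVec h t⟩

section

variable {X : Mat5} (hX : X ∈ deSitterAlgebra) {c : ℝ} (h : X *ᵥ pastVector = c • pastVector)

theorem parabolicExp_zero : parabolicExp hX h 0 = 1 :=
  Subtype.ext (Units.ext (by simp [parabolicExp, lorentzUnit]))

theorem parabolicScale_parabolicExp (t : ℝ) :
    parabolicScale (parabolicExp hX h t) = Real.exp (t * c) :=
  parabolicScale_eq_of (matrixExp_smul_mulVec h t)

theorem contDiff_entries_parabolicExp :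
    ContDiff ℝ ∞ fun t => entries (parabolicExp hX h t : GL (Fin 5) ℝ) :=
  contDiff_pi.2 fun i => contDiff_pi.2 fun j => contDiff_matrixExp_smul_apply X i j

theorem deriv_entries_parabolicExp_zero :
    Matrix.of (deriv (fun t => entries (parabolicExp hX h t : GL (Fin 5) ℝ)) 0) = X := by
  have : HasDerivAt (fun t => entries (parabolicExp hX h t : GL (Fin 5) ℝ)) (fun i j => X i j) 0 :=
    hasDerivAt_pi.2 fun i => hasDerivAt_pi.2 fun j => by
      have h1 := hasDerivAt_matrixExp_smul_apply X 0 i j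
      rw [zero_smul, NormedSpace.exp_zero, Matrix.one_mul] at h1
      exact h1
  rw [this.deriv]; rfl

end

/-! ### Action of the Lie algebra on the null vector -/

/-- The vector of `ℝ^{4,1}` orthogonal to `x` and `u` with spatial part `ξ`. -/
def spatialVector (ξ : Fin 3 → ℝ) : Fin 5 → ℝ := ![0, ξ 0, ξ 1, ξ 2, 0]

/-- The spatial part of a vector of `ℝ^{4,1}`. -/
def spatialPart (y : Fin 5 → ℝ) : Fin 3 → ℝ := ![y 1, y 2, y 3]

theorem spatialPart_add (y z : Fin 5 → ℝ) :
    spatialPart (y + z) = spatialPart y + spatialPart z := by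
  ext i; fin_cases i <;> simp [spatialPart]

theorem spatialPart_smul (c : ℝ) (y : Fin 5 → ℝ) : spatialPart (c • y) = c • spatialPart y := by
  ext i; fin_cases i <;> simp [spatialPart]

theorem spatialPart_spatialVector (ξ : Fin 3 → ℝ) : spatialPart (spatialVector ξ) = ξ := by
  ext i; fin_cases i <;> simp [spatialPart, spatialVector]

theorem spatialPart_pastVector : spatialPart pastVector = 0 := by
  ext i; fin_cases i <;> simp [spatialPart, pastVector_eq]

theorem mem_deSitterAlgebra_iff {X : Mat5} :
    X ∈ deSitterAlgebra ↔ Xᵀ * minkowski = -(minkowski * X) := by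
  simp [deSitterAlgebra, Matrix.IsSkewAdjoint, Matrix.IsAdjointPair]

theorem lorentzForm_mulVec_left {X : Mat5} (hX : X ∈ deSitterAlgebra) (y z : Fin 5 → ℝ) :
    lorentzForm (X *ᵥ y) z = -lorentzForm y (X *ᵥ z) := by
  have h : X *ᵥ y = y ᵥ* Xᵀ := (Matrix.vecMul_transpose X y).symm
  rw [lorentzForm, lorentzForm, h, ← Matrix.dotProduct_mulVec, Matrix.mulVec_mulVec,
    mem_deSitterAlgebra_iff.1 hX, Matrix.neg_mulVec, Matrix.mulVec_mulVec, dotProduct_neg]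

theorem lorentzForm_comm (y z : Fin 5 → ℝ) : lorentzForm y z = lorentzForm z y := by
  simp only [lorentzForm_eq]; ring

/-- As `X` is skew, `X (x - u)` is orthogonal to `x - u`, so it is the sum of a spatial vector and
a multiple of `x - u`. -/
theorem mulVec_pastVector_eq_add {X : Mat5} (hX : X ∈ deSitterAlgebra) :
    X *ᵥ pastVector =
      spatialVector (spatialPart (X *ᵥ pastVector)) + (X *ᵥ pastVector) 4 • pastVector := by
  have h := lorentzForm_mulVec_left hX pastVector pastVector
  rw [lorentzForm_comm pastVector] at h
  have h' : lorentzForm (X *ᵥ pastVector) pastVector = 0 := by linarith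
  generalize X *ᵥ pastVector = y at *
  simp only [lorentzForm_eq] at h'
  simp [pastVector_eq] at h'
  ext i
  fin_cases i <;> simp [spatialVector, spatialPart, pastVector_eq]
  linarith

/-- In the coordinates `𝔤/𝔭 ≅ ℝ³` given by the spatial part of `X (x - u)`, the inner product `δ` is
the Euclidean one. -/
theorem modelMetric_eq {X Y : Mat5} (hX : X ∈ deSitterAlgebra) (hY : Y ∈ deSitterAlgebra) :
    modelMetric X Y = spatialPart (X *ᵥ pastVector) ⬝ᵥ spatialPart (Y *ᵥ pastVector) := by
  change lorentzForm (X *ᵥ pastVector) (Y *ᵥ pastVector) = _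
  rw [mulVec_pastVector_eq_add hX, mulVec_pastVector_eq_add hY]
  simp only [spatialPart_add, spatialPart_smul, spatialPart_pastVector, spatialPart_spatialVector]
  generalize spatialPart (X *ᵥ pastVector) = a
  generalize spatialPart (Y *ᵥ pastVector) = b
  simp [lorentzForm_eq, spatialVector, pastVector_eq, dotProduct, Fin.sum_univ_three]
  ring

theorem pastTranslation_mem (ξ : Fin 3 → ℝ) : pastTranslation ξ ∈ deSitterAlgebra := by
  rw [mem_deSitterAlgebra_iff]
  ext i j
  fin_cases i <;> fin_cases j <;> simp [pastTranslation, minkowski]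

theorem pastTranslation_mulVec (ξ : Fin 3 → ℝ) :
    pastTranslation ξ *ᵥ pastVector = spatialVector ((-2 : ℝ) • ξ) := by
  ext i
  rw [mulVec_pastVector_apply]
  fin_cases i <;> (simp [pastTranslation, spatialVector]; try ring)

/-- A rotation preserves the orthogonal complement of the base observer. -/
theorem rotation_mulVec_spatialVector (k : rotationGroup) (ξ : Fin 3 → ℝ) :
    ((k : GL (Fin 5) ℝ) : Mat5) *ᵥ spatialVector ξ =
      spatialVector (spatialPart (((k : GL (Fin 5) ℝ) : Mat5) *ᵥ spatialVector ξ)) := by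
  have h := fun y => lorentzForm_mulVec (transpose_mul_minkowski_mul k.2.1) (spatialVector ξ) y
  have h1 := h baseEvent
  have h2 := h baseVelocity
  rw [k.2.2.1] at h1
  rw [k.2.2.2] at h2
  generalize ((k : GL (Fin 5) ℝ) : Mat5) *ᵥ spatialVector ξ = y at *
  simp only [lorentzForm_eq] at h1 h2
  simp [baseEvent, baseVelocity, spatialVector] at h1 h2
  ext i
  fin_cases i <;> simp [spatialVector, spatialPart, h1, h2]

theorem nullRotation_mulVec_spatialVector (b ξ : Fin 3 → ℝ) :
    nullRotation b *ᵥ spatialVector ξ = spatialVector ξ - (b ⬝ᵥ ξ) • pastVector := by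
  ext i
  simp only [Matrix.mulVec, dotProduct, Fin.sum_univ_five, spatialVector, pastVector_eq]
  fin_cases i <;> (simp [nullRotation, Fin.sum_univ_three]; try ring)

theorem spatialVector_add_smul_four (ξ : Fin 3 → ℝ) (c : ℝ) :
    (spatialVector ξ + c • pastVector) 4 = c := by
  simp [spatialVector, pastVector_eq]

theorem pastTranslation_add (ξ ζ : Fin 3 → ℝ) :
    pastTranslation (ξ + ζ) = pastTranslation ξ + pastTranslation ζ := by
  ext i j
  fin_cases i <;> fin_cases j <;> simp [pastTranslation, add_comm]

theorem pastTranslation_smul (c : ℝ) (ξ : Fin 3 → ℝ) :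
    pastTranslation (c • ξ) = c • pastTranslation ξ := by
  ext i j
  fin_cases i <;> fin_cases j <;> simp [pastTranslation]

theorem nullRotation_neg_mul (b : Fin 3 → ℝ) : nullRotation (-b) * nullRotation b = 1 := by
  ext i j
  fin_cases i <;> fin_cases j <;>
    (simp [nullRotation, Matrix.mul_apply, Fin.sum_univ_five]; try ring)

theorem dilation_zero : dilation 0 = 1 := by
  ext i j
  fin_cases i <;> fin_cases j <;> simp [dilation]

theorem coe_parabolicSlice_zero_inv (b : Fin 3 → ℝ) :
    (((parabolicSlice (0, b))⁻¹ : GL (Fin 5) ℝ) : Mat5) = nullRotation (-b) := by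
  have h : nullRotation (-b) * ((parabolicSlice (0, b) : GL (Fin 5) ℝ) : Mat5) = 1 := by
    rw [coe_parabolicSlice, dilation_zero, Matrix.mul_one, nullRotation_neg_mul]
  have h' : ((parabolicSlice (0, b) : GL (Fin 5) ℝ) : Mat5) *
      (((parabolicSlice (0, b) : GL (Fin 5) ℝ)⁻¹ : GL (Fin 5) ℝ) : Mat5) = 1 := by
    rw [← Units.val_mul, mul_inv_cancel, Units.val_one]
  exact (left_inv_eq_right_inv h h').symm

/-! ### Quotient manifolds from local slices -/

section Slices

variable {m n : ℕ} {F : Type*} [TopologicalSpace F] [ChartedSpace (E m) F]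
  {X : Type*} [TopologicalSpace X]

/-- A local slice of a map `q` from a manifold `F` to a set `X`: on an open set
`V`, saturated for `q`, the fibres of `q` are the level sets of a smooth map `coord` onto an open
subset `target` of `ℝⁿ`, and `coord` has a smooth right inverse `slice`. -/
structure LocalSlice (m n : ℕ) {F : Type*} [TopologicalSpace F] [ChartedSpace (E m) F]
    {X : Type*} (q : F → X) where
  /-- the saturated open set -/
  V : Set F
  /-- the coordinates on the quotient of `V` -/
  coord : F → E n
  /-- the range of the coordinates -/
  target : Set (E n)
  /-- the right inverse of `coord` -/
  slice : E n → F
  isOpen_V : IsOpen V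
  isOpen_target : IsOpen target
  coord_smooth : ContMDiffOn (𝓡 m) (𝓡 n) ∞ coord V
  slice_smooth : ContMDiffOn (𝓡 n) (𝓡 m) ∞ slice target
  saturated : ∀ f ∈ V, ∀ f', q f = q f' → f' ∈ V
  coord_eq : ∀ f ∈ V, ∀ f', q f = q f' → coord f = coord f'
  coord_mem : ∀ f ∈ V, coord f ∈ target
  slice_mem : ∀ w ∈ target, slice w ∈ V
  coord_slice : ∀ w ∈ target, coord (slice w) = w
  apply_slice_coord : ∀ f ∈ V, q (slice (coord f)) = q f

/-- A map `q : F → X` of manifolds has smooth sections through the points of `X`, locally. -/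
def HasLocalSections (m n : ℕ) {F : Type*} [TopologicalSpace F] [ChartedSpace (E m) F]
    {X : Type*} [TopologicalSpace X] [ChartedSpace (E n) X] (q : F → X) : Prop :=
  ∀ x : X, ∃ U : Set X, IsOpen U ∧ x ∈ U ∧ ∃ s : X → F,
    ContMDiffOn (𝓡 n) (𝓡 m) ∞ s U ∧ ∀ y ∈ U, q (s y) = y

namespace LocalSlice

variable {q : F → X}

/-- A slice of `q` is a slice of every composition of `q` with a bijection. -/
def compEquiv {Y : Type*} (s : LocalSlice m n q) (e : X ≃ Y) : LocalSlice m n (e ∘ q) where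
  V := s.V
  coord := s.coord
  target := s.target
  slice := s.slice
  isOpen_V := s.isOpen_V
  isOpen_target := s.isOpen_target
  coord_smooth := s.coord_smooth
  slice_smooth := s.slice_smooth
  saturated f hf f' h := s.saturated f hf f' (e.injective h)
  coord_eq f hf f' h := s.coord_eq f hf f' (e.injective h)
  coord_mem := s.coord_mem
  slice_mem := s.slice_mem
  coord_slice := s.coord_slice
  apply_slice_coord f hf := congrArg e (s.apply_slice_coord f hf)

variable (hq : IsOpenQuotientMap q)
include hq

theorem coord_surjInv (s : LocalSlice m n q) {f : F} (hf : f ∈ s.V) :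
    s.coord (Function.surjInv hq.surjective (q f)) = s.coord f :=
  (s.coord_eq f hf _ (Function.surjInv_eq hq.surjective (q f)).symm).symm

omit hq in
/-- The chart of the quotient that a slice defines. -/
noncomputable def chart (hq : IsOpenQuotientMap q) (s : LocalSlice m n q) :
    OpenPartialHomeomorph X (E n) where
  toFun x := s.coord (Function.surjInv hq.surjective x)
  invFun w := q (s.slice w)
  source := q '' s.V
  target := s.target
  map_source' := by
    rintro _ ⟨f, hf, rfl⟩
    rw [s.coord_surjInv hq hf]
    exact s.coord_mem f hf
  map_target' w hw := ⟨_, s.slice_mem w hw, rfl⟩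
  left_inv' := by
    rintro _ ⟨f, hf, rfl⟩
    rw [s.coord_surjInv hq hf, s.apply_slice_coord f hf]
  right_inv' w hw := by
    rw [s.coord_surjInv hq (s.slice_mem w hw), s.coord_slice w hw]
  open_source := hq.isOpenMap _ s.isOpen_V
  open_target := s.isOpen_target
  continuousOn_toFun := by
    rintro _ ⟨f, hf, rfl⟩
    refine ContinuousAt.continuousWithinAt ?_
    rw [← hq.continuousAt_comp_iff]
    have h1 : ContinuousAt s.coord f :=
      (s.coord_smooth.continuousOn).continuousAt (s.isOpen_V.mem_nhds hf)
    refine h1.congr ?_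
    filter_upwards [s.isOpen_V.mem_nhds hf] with f' hf'
    exact (s.coord_surjInv hq hf').symm
  continuousOn_invFun := hq.continuous.comp_continuousOn s.slice_smooth.continuousOn

/-- A quotient that is covered by local slices is a manifold; the quotient map is smooth and has
smooth local sections. -/
theorem exists_manifold (hs : ∀ f, ∃ s : LocalSlice m n q, f ∈ s.V) :
    ∃ _ : ChartedSpace (E n) X, IsManifold (𝓡 n) ∞ X ∧ ContMDiff (𝓡 m) (𝓡 n) ∞ q ∧
      HasLocalSections m n q := by
  have hs' : ∀ x : X, ∃ s : LocalSlice m n q, x ∈ (s.chart hq).source := by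
    intro x
    obtain ⟨f, rfl⟩ := hq.surjective x
    obtain ⟨s, hf⟩ := hs f
    exact ⟨s, f, hf, rfl⟩
  choose S hS using hs'
  let cs : ChartedSpace (E n) X :=
    { atlas := Set.range fun s : LocalSlice m n q => s.chart hq
      chartAt := fun x => (S x).chart hq
      mem_chart_source := hS
      chart_mem_atlas := fun x => ⟨S x, rfl⟩ }
  have hM : IsManifold (𝓡 n) ∞ X := by
    refine isManifold_of_contDiffOn (𝓡 n) ∞ X ?_
    rintro _ _ ⟨s, rfl⟩ ⟨s', rfl⟩
    simp only [modelWithCornersSelf_coe, modelWithCornersSelf_coe_symm, Function.comp_id,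
      Function.id_comp, Set.range_id, Set.inter_univ, Set.preimage_id]
    rw [← contMDiffOn_iff_contDiffOn]
    have hsub : ∀ w ∈ ((s.chart hq).symm ≫ₕ s'.chart hq).source,
        w ∈ s.target ∧ s.slice w ∈ s'.V := by
      intro w hw
      rw [OpenPartialHomeomorph.trans_source] at hw
      refine ⟨hw.1, ?_⟩
      obtain ⟨f, hf, hfe⟩ := hw.2
      exact s'.saturated f hf _ hfe
    have h1 : ContMDiffOn (𝓡 n) (𝓡 n) ∞ (s'.coord ∘ s.slice)
        ((s.chart hq).symm ≫ₕ s'.chart hq).source :=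
      s'.coord_smooth.comp (s.slice_smooth.mono fun w hw => (hsub w hw).1)
        fun w hw => (hsub w hw).2
    refine h1.congr fun w hw => ?_
    exact s'.coord_surjInv hq (hsub w hw).2
  have hmem : ∀ s : LocalSlice m n q, s.chart hq ∈ IsManifold.maximalAtlas (𝓡 n) ∞ X := fun s =>
    IsManifold.subset_maximalAtlas ⟨s, rfl⟩
  refine ⟨cs, hM, ?_, ?_⟩
  · intro f
    obtain ⟨s, hf⟩ := hs f
    have h1 := contMDiffOn_symm_of_mem_maximalAtlas (hmem s)
    have h2 : ContMDiffOn (𝓡 m) (𝓡 n) ∞ ((s.chart hq).symm ∘ s.coord) s.V :=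
      h1.comp s.coord_smooth fun f hf => s.coord_mem f hf
    refine (h2.congr fun f hf => ?_).contMDiffAt (s.isOpen_V.mem_nhds hf)
    exact (s.apply_slice_coord f hf).symm
  · intro x
    refine ⟨_, ((S x).chart hq).open_source, hS x, (S x).slice ∘ (S x).chart hq, ?_, ?_⟩
    · exact (S x).slice_smooth.comp (contMDiffOn_of_mem_maximalAtlas (hmem (S x)))
        fun y hy => ((S x).chart hq).map_source hy
    · intro y hy
      exact ((S x).chart hq).left_inv hy

/-- Two points of the quotient in the chart of a common slice have disjoint neighbourhoods. -/
theorem separated (s : LocalSlice m n q) {f f' : F} (hf : f ∈ s.V) (hf' : f' ∈ s.V)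
    (hne : q f ≠ q f') :
    ∃ U U' : Set X, IsOpen U ∧ IsOpen U' ∧ q f ∈ U ∧ q f' ∈ U' ∧ Disjoint U U' := by
  set e := s.chart hq
  have h1 : q f ∈ e.source := ⟨f, hf, rfl⟩
  have h2 : q f' ∈ e.source := ⟨f', hf', rfl⟩
  have h3 : e (q f) ≠ e (q f') := fun h => hne (e.injOn h1 h2 h)
  obtain ⟨O, O', hO, hO', hm, hm', hd⟩ := t2_separation h3
  refine ⟨e.source ∩ e ⁻¹' O, e.source ∩ e ⁻¹' O', e.isOpen_inter_preimage hO,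
    e.isOpen_inter_preimage hO', ⟨h1, hm⟩, ⟨h2, hm'⟩, ?_⟩
  exact (hd.preimage e).mono Set.inter_subset_right Set.inter_subset_right

end LocalSlice

/-- A map out of the base of a map with smooth local sections is smooth if it is so upstairs. -/
theorem HasLocalSections.contMDiff_of_comp [ChartedSpace (E n) X] {q : F → X}
    (hq : HasLocalSections m n q)
    {E' : Type*} [NormedAddCommGroup E'] [NormedSpace ℝ E'] {H' : Type*} [TopologicalSpace H']
    {I' : ModelWithCorners ℝ E' H'} {N : Type*} [TopologicalSpace N] [ChartedSpace H' N]
    {g : X → N} (hg : ContMDiff (𝓡 m) I' ∞ (g ∘ q)) : ContMDiff (𝓡 n) I' ∞ g := by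
  intro x
  obtain ⟨U, hU, hx, s, hs, hqs⟩ := hq x
  have h : ContMDiffOn (𝓡 n) I' ∞ ((g ∘ q) ∘ s) U := hg.comp_contMDiffOn hs
  refine (h.congr fun y hy => ?_).contMDiffAt (hU.mem_nhds hx)
  simp [hqs y hy]

theorem PrincipalBundle.hasLocalSections [ChartedSpace (E n) X] {H : Subgroup (GL (Fin 5) ℝ)}
    (B : PrincipalBundle H m n F X) : HasLocalSections m n B.proj := by
  intro x
  obtain ⟨U, hU, hx, s, hs, hps, -⟩ := B.locally_trivial x
  exact ⟨U, hU, hx, s, hs, hps⟩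

end Slices

/-! ### Principal bundles -/

namespace PrincipalBundle

variable {H : Subgroup (GL (Fin 5) ℝ)} {m n : ℕ}
  {Q : Type*} [TopologicalSpace Q] [ChartedSpace (E m) Q]
  {M : Type*} [TopologicalSpace M] [ChartedSpace (E n) M]
  {E' : Type*} [NormedAddCommGroup E'] [NormedSpace ℝ E'] {H' : Type*} [TopologicalSpace H']
  {I' : ModelWithCorners ℝ E' H'} {N : Type*} [TopologicalSpace N] [ChartedSpace H' N]

theorem contMDiffAt_act (B : PrincipalBundle H m n Q M) {f : N → Q} {g : N → H} {x : N}
    (hf : ContMDiffAt I' (𝓡 m) ∞ f x)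
    (hg : ContMDiffAt I' 𝓘(ℝ, MatSpace) ∞ (fun y => entries (g y)) x) :
    ContMDiffAt I' (𝓡 m) ∞ (fun y => B.act (f y) (g y)) x := by
  obtain ⟨ψ, hψ, he⟩ := B.act_smooth (f x) (g x)
  have hpair : ContMDiffAt I' ((𝓡 m).prod 𝓘(ℝ, MatSpace)) ∞ (fun y => (f y, entries (g y))) x :=
    hf.prodMk hg
  refine (ContMDiffAt.comp x (f := fun y => (f y, entries (g y))) hψ hpair).congr_of_eventuallyEq ?_
  filter_upwards [hpair.continuousAt.eventually he] with y hy
  exact (hy (g y) rfl).symm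

theorem contMDiff_act_right (B : PrincipalBundle H m n Q M) (h : H) :
    ContMDiff (𝓡 m) (𝓡 m) ∞ (fun q => B.act q h) := fun _ =>
  B.contMDiffAt_act contMDiffAt_id contMDiffAt_const

theorem act_injective (B : PrincipalBundle H m n Q M) {q : Q} {a b : H}
    (h : B.act q a = B.act q b) : a = b := by
  have h1 : B.act q (a * b⁻¹) = q := by
    rw [B.act_mul, h, ← B.act_mul, mul_inv_cancel, B.act_one]
  exact mul_inv_eq_one.1 (B.act_free q _ h1)

/-- The group acts transitively on the fibres. -/
theorem exists_act_eq (B : PrincipalBundle H m n Q M) {q q' : Q} (h : B.proj q = B.proj q') :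
    ∃ a : H, B.act q a = q' := by
  obtain ⟨U, -, hU, s, -, -, τ, -, hτ⟩ := B.locally_trivial (B.proj q)
  have h1 := hτ q hU
  have h2 := hτ q' (show B.proj q' ∈ U from h ▸ hU)
  rw [← h] at h2
  refine ⟨(τ q)⁻¹ * τ q', ?_⟩
  nth_rewrite 1 [← h1]
  rw [← B.act_mul, mul_inv_cancel_left, h2]

/-- There is a local section through every point of the total space. -/
theorem exists_section_through (B : PrincipalBundle H m n Q M) (q : Q) :
    ∃ U : Set M, IsOpen U ∧ B.proj q ∈ U ∧ ∃ s : M → Q, ContMDiffOn (𝓡 n) (𝓡 m) ∞ s U ∧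
      (∀ y ∈ U, B.proj (s y) = y) ∧ s (B.proj q) = q := by
  obtain ⟨U, hU, hq, s, hs, hps, τ, -, hτ⟩ := B.locally_trivial (B.proj q)
  refine ⟨U, hU, hq, fun y => B.act (s y) (τ q), ?_, ?_, hτ q hq⟩
  · exact fun y hy => (B.contMDiffAt_act (hs.contMDiffAt (hU.mem_nhds hy))
      contMDiffAt_const).contMDiffWithinAt
  · intro y hy
    rw [B.proj_act, hps y hy]

theorem mfderiv_proj_surjective (B : PrincipalBundle H m n Q M) (q : Q) :
    Function.Surjective (mfderiv (𝓡 m) (𝓡 n) B.proj q) := by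
  obtain ⟨U, hU, hq, s, hs, hps, hsq⟩ := B.exists_section_through q
  have hs' : MDifferentiableAt (𝓡 n) (𝓡 m) s (B.proj q) :=
    (hs.contMDiffAt (hU.mem_nhds hq)).mdifferentiableAt (by simp)
  have hp : MDifferentiableAt (𝓡 m) (𝓡 n) B.proj (s (B.proj q)) :=
    B.proj_smooth.mdifferentiable (by simp) _
  have h1 : HasMFDerivAt (𝓡 n) (𝓡 n) (B.proj ∘ s) (B.proj q)
      ((mfderiv (𝓡 m) (𝓡 n) B.proj (s (B.proj q))).comp
        (mfderiv (𝓡 n) (𝓡 m) s (B.proj q))) := hp.hasMFDerivAt.comp _ hs'.hasMFDerivAt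
  have h2 : HasMFDerivAt (𝓡 n) (𝓡 n) (B.proj ∘ s) (B.proj q)
      (ContinuousLinearMap.id ℝ (TangentSpace (𝓡 n) (B.proj q))) := by
    refine (hasMFDerivAt_id (B.proj q)).congr_of_eventuallyEq ?_
    filter_upwards [hU.mem_nhds hq] with y hy
    exact hps y hy
  have h3 := hasMFDerivAt_unique h1 h2
  rw [hsq] at h3
  intro a
  exact ⟨mfderiv (𝓡 n) (𝓡 m) s (B.proj q) a, DFunLike.congr_fun h3 a⟩

end PrincipalBundle

/-! ### The Cartan connection of a Möbius geometry -/

namespace CartanGeometry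

variable {F : Type*} [TopologicalSpace F] [ChartedSpace (E 10) F] [IsManifold (𝓡 10) ∞ F]
  {S : Type*} [TopologicalSpace S] [ChartedSpace (E 3) S]

/-- The connection is injective, so it detects equality of tangent vectors. Stated on the tangent
bundle, for vectors whose base points agree only propositionally. -/
theorem tangent_ext {H : Subgroup (GL (Fin 5) ℝ)} {n : ℕ} {M : Type*} [TopologicalSpace M]
    [ChartedSpace (E n) M] (C : CartanGeometry H n F M)
    {V V' : TangentBundle (𝓡 10) F} (h : V.proj = V'.proj)
    (hA : (C.conn V.proj V.2 : Mat5) = C.conn V'.proj V'.2) : V = V' := by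
  obtain ⟨f, z⟩ := V
  obtain ⟨f', z'⟩ := V'
  obtain rfl : f = f' := h
  have := (C.conn_bijective f).1 (Subtype.ext hA)
  exact congrArg _ this

theorem exists_conn_eq (M : MoebiusGeometry F S) (f : F) {X : Mat5} (hX : X ∈ deSitterAlgebra) :
    ∃ z : TangentSpace (𝓡 10) f, (M.conn f z : Mat5) = X := by
  obtain ⟨z, hz⟩ := (M.conn_bijective f).2 ⟨X, hX⟩
  exact ⟨z, congrArg Subtype.val hz⟩

/-- The vectors on which the connection takes its values in `𝔭` are vertical: they are the
velocities of the curves `t ↦ f · exp (t X)`. -/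
theorem exists_vertical_curve (M : MoebiusGeometry F S) {f : F} {z : TangentSpace (𝓡 10) f} {c : ℝ}
    (h : (M.conn f z : Mat5) *ᵥ pastVector = c • pastVector) :
    ∃ p : ℝ → parabolicGroup, (∀ t, parabolicScale (p t) = Real.exp (t * c)) ∧
      ContMDiff 𝓘(ℝ, ℝ) (𝓡 10) ∞ (fun t => M.act f (p t)) ∧
      tangentMap 𝓘(ℝ, ℝ) (𝓡 10) (fun t => M.act f (p t)) ⟨0, (1 : ℝ)⟩ = ⟨f, z⟩ := by
  refine ⟨parabolicExp (M.conn f z).2 h, parabolicScale_parabolicExp _ h, ?_, ?_⟩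
  · exact fun t => M.contMDiffAt_act contMDiffAt_const
      (contDiff_entries_parabolicExp _ h).contMDiff.contMDiffAt
  · refine M.tangent_ext ?_ ?_
    · change M.act f (parabolicExp _ h 0) = f
      rw [parabolicExp_zero, M.act_one]
    · have h1 := M.conn_vertical f (parabolicExp (M.conn f z).2 h)
        (contDiff_entries_parabolicExp _ h) 0
      rw [deriv_entries_parabolicExp_zero] at h1
      refine h1.trans ?_
      rw [parabolicExp_zero]
      simp

/-- The solder form in coordinates: the class of `A_f z` in `𝔤/𝔭 ≅ ℝ³`, given by the spatial part
of `A_f(z) (x - u)`. -/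
noncomputable def solder (M : MoebiusGeometry F S) (f : F) :
    TangentSpace (𝓡 10) f →ₗ[ℝ] (Fin 3 → ℝ) where
  toFun z := spatialPart ((M.conn f z : Mat5) *ᵥ pastVector)
  map_add' z z' := by
    rw [map_add, Submodule.coe_add, Matrix.add_mulVec, spatialPart_add]
  map_smul' c z := by
    rw [map_smul, Submodule.coe_smul, Matrix.smul_mulVec, spatialPart_smul, RingHom.id_apply]

theorem solder_apply (M : MoebiusGeometry F S) (f : F) (z : TangentSpace (𝓡 10) f) :
    M.solder f z = spatialPart ((M.conn f z : Mat5) *ᵥ pastVector) := rfl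

theorem modelMetric_conn (M : MoebiusGeometry F S) (f : F) (z z' : TangentSpace (𝓡 10) f) :
    modelMetric (M.conn f z) (M.conn f z') = M.solder f z ⬝ᵥ M.solder f z' :=
  modelMetric_eq (M.conn f z).2 (M.conn f z').2

theorem solder_surjective (M : MoebiusGeometry F S) (f : F) :
    Function.Surjective (M.solder f) := by
  intro ξ
  obtain ⟨z, hz⟩ := M.exists_conn_eq f (pastTranslation_mem ((-2 : ℝ)⁻¹ • ξ))
  refine ⟨z, ?_⟩
  rw [solder_apply, hz, pastTranslation_mulVec, spatialPart_spatialVector, smul_smul,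
    mul_inv_cancel₀ (by norm_num), one_smul]

theorem conn_mulVec_pastVector (M : MoebiusGeometry F S) {f : F} (z : TangentSpace (𝓡 10) f) :
    (M.conn f z : Mat5) *ᵥ pastVector = spatialVector (M.solder f z) +
      ((M.conn f z : Mat5) *ᵥ pastVector) 4 • pastVector :=
  mulVec_pastVector_eq_add (M.conn f z).2

theorem mfderiv_proj_eq_zero_of_solder (M : MoebiusGeometry F S) {f : F}
    {z : TangentSpace (𝓡 10) f} (h : M.solder f z = 0) :
    mfderiv (𝓡 10) (𝓡 3) M.proj f z = 0 := by
  have h0 := M.conn_mulVec_pastVector z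
  rw [h, show spatialVector 0 = 0 by ext i; fin_cases i <;> simp [spatialVector], zero_add] at h0
  obtain ⟨p, -, hp, hpz⟩ := M.exists_vertical_curve h0
  have hproj : MDifferentiable (𝓡 10) (𝓡 3) M.proj := M.proj_smooth.mdifferentiable (by simp)
  have h1 := tangentMap_comp_at (I := 𝓘(ℝ, ℝ)) (I' := 𝓡 10) (I'' := 𝓡 3)
    (⟨0, (1 : ℝ)⟩ : TangentBundle 𝓘(ℝ, ℝ) ℝ)
    (hproj (M.act f (p 0))) (hp.mdifferentiable (by simp) (0 : ℝ))
  rw [hpz] at h1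
  have h2 : M.proj ∘ (fun t => M.act f (p t)) = fun _ => M.proj f := by
    funext t; exact M.proj_act f (p t)
  rw [h2] at h1
  simp only [tangentMap, mfderiv_const] at h1
  exact (TotalSpace.mk_inj.1 h1).symm

theorem finrank_tangentSpace {n : ℕ} {N : Type*} [TopologicalSpace N] [ChartedSpace (E n) N]
    (y : N) : Module.finrank ℝ (TangentSpace (𝓡 n) y) = n :=
  finrank_euclideanSpace_fin (𝕜 := ℝ) (n := n)

instance {n : ℕ} {N : Type*} [TopologicalSpace N] [ChartedSpace (E n) N] (y : N) :
    FiniteDimensional ℝ (TangentSpace (𝓡 n) y) :=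
  inferInstanceAs (FiniteDimensional ℝ (E n))

instance {n : ℕ} {N : Type*} [TopologicalSpace N] [ChartedSpace (E n) N] (y : N) :
    T2Space (TangentSpace (𝓡 n) y) :=
  inferInstanceAs (T2Space (E n))

/-- The solder form vanishes exactly on the vertical vectors, by a count of dimensions. -/
theorem mfderiv_proj_eq_zero_iff (M : MoebiusGeometry F S) {f : F} {z : TangentSpace (𝓡 10) f} :
    mfderiv (𝓡 10) (𝓡 3) M.proj f z = 0 ↔ M.solder f z = 0 := by
  set D : TangentSpace (𝓡 10) f →ₗ[ℝ] TangentSpace (𝓡 3) (M.proj f) :=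
    (mfderiv (𝓡 10) (𝓡 3) M.proj f).toLinearMap with hD
  -- One inclusion of kernels; both maps are surjective onto spaces of dimension 3.
  have hle : LinearMap.ker (M.solder f) ≤ LinearMap.ker D := fun w hw =>
    M.mfderiv_proj_eq_zero_of_solder hw
  have h1 := (M.solder f).finrank_range_add_finrank_ker
  have h2 := D.finrank_range_add_finrank_ker
  rw [LinearMap.range_eq_top.2 (M.solder_surjective f), finrank_top, Module.finrank_fin_fun] at h1
  rw [LinearMap.range_eq_top.2 (M.mfderiv_proj_surjective f), finrank_top,
    finrank_tangentSpace] at h2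
  have h3 : LinearMap.ker (M.solder f) = LinearMap.ker D :=
    Submodule.eq_of_le_of_finrank_eq hle (by omega)
  have : z ∈ LinearMap.ker D ↔ z ∈ LinearMap.ker (M.solder f) := by rw [h3]
  exact this

/-- The coframe `e_f : T_{π f} S ≅ 𝔤/𝔭`, in the coordinates of `solder`. -/
theorem exists_coframe (M : MoebiusGeometry F S) (f : F) :
    ∃ e : TangentSpace (𝓡 3) (M.proj f) →ₗ[ℝ] (Fin 3 → ℝ), Function.Injective e ∧
      ∀ z, e (mfderiv (𝓡 10) (𝓡 3) M.proj f z) = M.solder f z := by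
  set D : TangentSpace (𝓡 10) f →ₗ[ℝ] TangentSpace (𝓡 3) (M.proj f) :=
    (mfderiv (𝓡 10) (𝓡 3) M.proj f).toLinearMap with hD
  obtain ⟨R, hR⟩ := D.exists_rightInverse_of_surjective
    (LinearMap.range_eq_top.2 (M.mfderiv_proj_surjective f))
  have hDR : ∀ a, D (R a) = a := fun a => LinearMap.congr_fun hR a
  have key : ∀ z, M.solder f (R (D z)) = M.solder f z := by
    intro z
    rw [← sub_eq_zero, ← map_sub, ← M.mfderiv_proj_eq_zero_iff]
    change D (R (D z) - z) = 0
    rw [map_sub, hDR, sub_self]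
  refine ⟨M.solder f ∘ₗ R, ?_, key⟩
  rw [← LinearMap.ker_eq_bot, LinearMap.ker_eq_bot']
  intro a ha
  have := (M.mfderiv_proj_eq_zero_iff (f := f) (z := R a)).2 ha
  rw [← hDR a]
  exact this

end CartanGeometry

/-! ### Smooth maps into bundles -/

section Smoothness

variable {E' : Type*} [NormedAddCommGroup E'] [NormedSpace ℝ E'] {H' : Type*} [TopologicalSpace H']
  {I' : ModelWithCorners ℝ E' H'} {N : Type*} [TopologicalSpace N] [ChartedSpace H' N]

/-- A map into a finite-dimensional space is smooth if a separating family of linear functionals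
is smooth on it. -/
theorem contMDiffAt_of_injective {W : Type*} [NormedAddCommGroup W] [NormedSpace ℝ W]
    [FiniteDimensional ℝ W] {ι : Type*} [Fintype ι] (L : W →ₗ[ℝ] (ι → ℝ))
    (hL : Function.Injective L) {f : N → W} {x : N}
    (hf : ∀ i, ContMDiffAt I' 𝓘(ℝ, ℝ) ∞ (fun y => L (f y) i) x) :
    ContMDiffAt I' 𝓘(ℝ, W) ∞ f x := by
  obtain ⟨R, hR⟩ := L.exists_leftInverse_of_injective (LinearMap.ker_eq_bot.2 hL)
  have h1 : ContMDiffAt I' 𝓘(ℝ, ι → ℝ) ∞ (fun y => L (f y)) x := contMDiffAt_pi_space.2 hf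
  have h2 : ContMDiffAt I' 𝓘(ℝ, W) ∞ (fun y => R.toContinuousLinearMap (L (f y))) x :=
    (R.toContinuousLinearMap.contMDiff).contMDiffAt.comp x h1
  refine h2.congr_of_eventuallyEq (Filter.Eventually.of_forall fun y => ?_)
  exact (LinearMap.congr_fun hR (f y)).symm

/-- A map into a space of linear maps of finite-dimensional spaces is smooth if its values on fixed
vectors are so. -/
theorem contMDiffAt_clm {W W' : Type*} [NormedAddCommGroup W] [NormedSpace ℝ W]
    [FiniteDimensional ℝ W] [NormedAddCommGroup W'] [NormedSpace ℝ W'] [FiniteDimensional ℝ W']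
    {f : N → W →L[ℝ] W'} {x : N}
    (hf : ∀ w, ContMDiffAt I' 𝓘(ℝ, W') ∞ (fun y => f y w) x) :
    ContMDiffAt I' 𝓘(ℝ, W →L[ℝ] W') ∞ f x := by
  let b := Module.finBasis ℝ W
  let b' := Module.finBasis ℝ W'
  let L : (W →L[ℝ] W') →ₗ[ℝ] (Fin (Module.finrank ℝ W) × Fin (Module.finrank ℝ W') → ℝ) :=
    { toFun := fun φ i => b'.repr (φ (b i.1)) i.2
      map_add' := fun φ ψ => by ext i; simp
      map_smul' := fun c φ => by ext i; simp }
  refine contMDiffAt_of_injective L ?_ fun i => ?_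
  · intro φ ψ h
    have : (φ : W →ₗ[ℝ] W') = ψ := b.ext fun i => b'.repr.injective <| by
      ext j
      exact congrFun h (i, j)
    ext w
    exact LinearMap.congr_fun this w
  · exact (((b'.coord i.2).toContinuousLinearMap.contMDiff).contMDiffAt).comp x (hf (b i.1))

/-- The tangent map of a map that is smooth on an open set. -/
theorem ContMDiffOn.contMDiffAt_tangentMap {E₁ E₂ H₁ H₂ : Type*}
    [NormedAddCommGroup E₁] [NormedSpace ℝ E₁] [NormedAddCommGroup E₂] [NormedSpace ℝ E₂]
    [TopologicalSpace H₁] [TopologicalSpace H₂]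
    {I₁ : ModelWithCorners ℝ E₁ H₁} {I₂ : ModelWithCorners ℝ E₂ H₂} {N₁ N₂ : Type*}
    [TopologicalSpace N₁] [ChartedSpace H₁ N₁] [IsManifold I₁ ∞ N₁] [IsManifold I₁ 1 N₁]
    [TopologicalSpace N₂] [ChartedSpace H₂ N₂] [IsManifold I₂ ∞ N₂] [IsManifold I₂ 1 N₂]
    {s : N₁ → N₂} {U : Set N₁} (hs : ContMDiffOn I₁ I₂ ∞ s U) (hU : IsOpen U)
    {V : TangentBundle I₁ N₁} (hV : V.proj ∈ U) :
    ContMDiffAt I₁.tangent I₂.tangent ∞ (tangentMap I₁ I₂ s) V := by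
  have hopen : IsOpen ((TotalSpace.proj : TangentBundle I₁ N₁ → N₁) ⁻¹' U) :=
    hU.preimage (FiberBundle.continuous_proj E₁ (TangentSpace I₁))
  refine ((hs.contMDiffOn_tangentMapWithin (m := ∞) (by simp) hU.uniqueMDiffOn).congr
    fun V' hV' => ?_).contMDiffAt (hopen.mem_nhds hV)
  exact (tangentMapWithin_eq_tangentMap (hU.uniqueMDiffOn _ hV')
    ((hs.contMDiffAt (hU.mem_nhds hV')).mdifferentiableAt (by simp))).symm

variable {S : Type*} [TopologicalSpace S] [ChartedSpace (E 3) S] [IsManifold (𝓡 3) ∞ S]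

/-- A map into the bundle of bilinear forms is smooth if its base point is so and the forms take
smooth values on the vector fields that are constant in a trivialization. -/
theorem contMDiffAt_formBundle {h : N → FormBundle S} {x : N}
    (h1 : ContMDiffAt I' (𝓡 3) ∞ (fun y => (h y).1) x)
    (h2 : ∀ v w : E 3, ContMDiffAt I' 𝓘(ℝ, ℝ) ∞ (fun y => (h y).2
      ((trivializationAt (E 3) (TangentSpace (𝓡 3)) (h x).1).symm (h y).1 v)
      ((trivializationAt (E 3) (TangentSpace (𝓡 3)) (h x).1).symm (h y).1 w)) x) :
    ContMDiffAt I' formModel ∞ h x := by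
  rw [contMDiffAt_hom_bundle]
  refine ⟨h1, contMDiffAt_clm fun v => contMDiffAt_clm fun w => ?_⟩
  refine (h2 v w).congr_of_eventuallyEq ?_
  have hmem : ∀ᶠ y in 𝓝 x,
      (h y).1 ∈ (trivializationAt (E 3) (TangentSpace (𝓡 3)) (h x).1).baseSet :=
    h1.continuousAt.eventually ((trivializationAt (E 3) (TangentSpace (𝓡 3))
      (h x).1).open_baseSet.mem_nhds (FiberBundle.mem_baseSet_trivializationAt' _))
  filter_upwards [hmem] with y hy
  rw [inCoordinates_apply_eq₂ hy hy (by simp)]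
  simp

/-- The vector fields that are constant in a trivialization of the tangent bundle are smooth. -/
theorem contMDiffAt_trivialization_symm {n : ℕ} {M : Type*} [TopologicalSpace M]
    [ChartedSpace (E n) M] [IsManifold (𝓡 n) ∞ M] (y₀ : M) {w : N → E n} {b : N → M} {x : N}
    (hb : ContMDiffAt I' (𝓡 n) ∞ b x) (hw : ContMDiffAt I' 𝓘(ℝ, E n) ∞ w x)
    (hx : b x ∈ (trivializationAt (E n) (TangentSpace (𝓡 n)) y₀).baseSet) :
    ContMDiffAt I' (𝓡 n).tangent ∞ (fun y => (⟨b y,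
      (trivializationAt (E n) (TangentSpace (𝓡 n)) y₀).symm (b y) (w y)⟩ : TangentBundle (𝓡 n) M))
      x := by
  set e := trivializationAt (E n) (TangentSpace (𝓡 n)) y₀ with he
  have h1 : ∀ᶠ y in 𝓝 x, b y ∈ e.baseSet :=
    hb.continuousAt.eventually (e.open_baseSet.mem_nhds hx)
  have h2 := e.contMDiffOn_symm (IB := 𝓡 n) (n := ∞)
  have h3 : ContMDiffAt ((𝓡 n).prod 𝓘(ℝ, E n)) (𝓡 n).tangent ∞ e.toOpenPartialHomeomorph.symm
      (b x, w x) :=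
    h2.contMDiffAt (e.open_target.mem_nhds (by rw [e.target_eq]; exact ⟨hx, trivial⟩))
  have h4 := ContMDiffAt.comp x (f := fun y => (b y, w y)) h3 (hb.prodMk hw)
  refine h4.congr_of_eventuallyEq ?_
  filter_upwards [h1] with y hy
  exact (e.mk_symm hy (w y))

end Smoothness

/-! ### The conformal metric of a Möbius geometry -/

/-- The multiple `(s, c g)` of a point `(s, g)` of the bundle of bilinear forms. -/
noncomputable def scaleForm {S : Type*} [TopologicalSpace S] [ChartedSpace (E 3) S]
    [IsManifold (𝓡 3) ∞ S] (c : ℝ) (m : FormBundle S) : FormBundle S := ⟨m.1, c • m.2⟩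

theorem scaleForm_one {S : Type*} [TopologicalSpace S] [ChartedSpace (E 3) S]
    [IsManifold (𝓡 3) ∞ S] (m : FormBundle S) : scaleForm 1 m = m := by
  obtain ⟨s, g⟩ := m
  exact congrArg (TotalSpace.mk s) (one_smul ℝ g)

namespace CartanGeometry

variable {F : Type*} [TopologicalSpace F] [ChartedSpace (E 10) F] [IsManifold (𝓡 10) ∞ F]
  {S : Type*} [TopologicalSpace S] [ChartedSpace (E 3) S] (M : MoebiusGeometry F S)

theorem mdifferentiable_proj : MDifferentiable (𝓡 10) (𝓡 3) M.proj :=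
  M.proj_smooth.mdifferentiable (by simp)

/-- The value `A(V) (x - u)`, as a function on the tangent bundle of `F`. -/
noncomputable def nullMotion (V : TangentBundle (𝓡 10) F) : Fin 5 → ℝ :=
  (M.conn V.proj V.2 : Mat5) *ᵥ pastVector

theorem contMDiff_nullMotion : ContMDiff (𝓡 10).tangent 𝓘(ℝ, Fin 5 → ℝ) ∞ M.nullMotion := by
  have h1 : ContDiff ℝ ∞ fun A : MatSpace => (fun i => A i 4 - A i 0 : Fin 5 → ℝ) := by fun_prop
  have h2 := h1.contMDiff.comp M.conn_smooth
  convert! h2 using 1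
  funext V i
  exact mulVec_pastVector_apply _ i

theorem contDiff_lorentzForm :
    ContDiff ℝ ∞ fun y : (Fin 5 → ℝ) × (Fin 5 → ℝ) => lorentzForm y.1 y.2 := by
  simp only [lorentzForm_eq]
  fun_prop

/-- Right translation by `p` identifies the tangent spaces along a fibre, and changes the
connection by `Ad (p⁻¹)`. -/
theorem exists_translate (f : F) (p : parabolicGroup) (V : TangentBundle (𝓡 10) F)
    (hV : V.proj = M.act f p) :
    ∃ z : TangentSpace (𝓡 10) f,
      tangentMap (𝓡 10) (𝓡 10) (fun q => M.act q p) ⟨f, z⟩ = V ∧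
      (M.conn f z : Mat5) = ((p : GL (Fin 5) ℝ) : Mat5) * (M.conn V.proj V.2 : Mat5) *
        ((p⁻¹ : GL (Fin 5) ℝ) : Mat5) := by
  have h1 : ((p⁻¹ : GL (Fin 5) ℝ) : Mat5) * ((p : GL (Fin 5) ℝ) : Mat5) = 1 := by
    rw [← Units.val_mul, inv_mul_cancel, Units.val_one]
  have h2 : ((p : GL (Fin 5) ℝ) : Mat5) * ((p⁻¹ : GL (Fin 5) ℝ) : Mat5) = 1 := by
    rw [← Units.val_mul, mul_inv_cancel, Units.val_one]
  obtain ⟨f', z'⟩ := V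
  obtain rfl : f' = M.act f p := hV
  have hY : ((p : GL (Fin 5) ℝ) : Mat5) * (M.conn _ z' : Mat5) * ((p⁻¹ : GL (Fin 5) ℝ) : Mat5) ∈
      deSitterAlgebra := by
    rw [mem_deSitterAlgebra_iff]
    have hz := mem_deSitterAlgebra_iff.1 (M.conn _ z').2
    have hi := inv_eq_of_mem_deSitterGroup p.2.1
    have ht : ((p : GL (Fin 5) ℝ) : Mat5)ᵀ * minkowski =
        minkowski * ((p⁻¹ : GL (Fin 5) ℝ) : Mat5) := by
      rw [hi, ← Matrix.mul_assoc, ← Matrix.mul_assoc, minkowski_mul_self, Matrix.one_mul]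
    have ht' : ((p⁻¹ : GL (Fin 5) ℝ) : Mat5)ᵀ * minkowski =
        minkowski * ((p : GL (Fin 5) ℝ) : Mat5) := by
      rw [hi, Matrix.transpose_mul, Matrix.transpose_mul, Matrix.transpose_transpose]
      have hη : minkowskiᵀ = minkowski := Matrix.diagonal_transpose _
      rw [hη, Matrix.mul_assoc, Matrix.mul_assoc, minkowski_mul_self, Matrix.mul_one]
    rw [Matrix.transpose_mul, Matrix.transpose_mul, Matrix.mul_assoc, Matrix.mul_assoc, ht,
      ← Matrix.mul_assoc _ minkowski, hz, Matrix.neg_mul, Matrix.mul_neg, ← Matrix.mul_assoc,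
      ← Matrix.mul_assoc, ht']
    simp only [Matrix.mul_assoc]
  obtain ⟨z, hz⟩ := M.exists_conn_eq f hY
  refine ⟨z, M.tangent_ext rfl ?_, hz⟩
  refine (M.conn_equivariant p f z).trans ?_
  rw [hz]
  simp only [Matrix.mul_assoc, h1, Matrix.mul_one]
  rw [← Matrix.mul_assoc, h1, Matrix.one_mul]

theorem nullMotion_translate (f : F) (p : parabolicGroup) (z : TangentSpace (𝓡 10) f) :
    M.nullMotion (tangentMap (𝓡 10) (𝓡 10) (fun q => M.act q p) ⟨f, z⟩) =
      ((p⁻¹ : GL (Fin 5) ℝ) : Mat5) *ᵥ (parabolicScale p • M.nullMotion ⟨f, z⟩) := by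
  have h := M.conn_equivariant p f z
  refine (congrArg (fun X : Mat5 => X *ᵥ pastVector) h).trans ?_
  rw [nullMotion, ← Matrix.mulVec_mulVec, mulVec_pastVector_eq, ← Matrix.mulVec_mulVec,
    Matrix.mulVec_smul]

theorem tangentMap_proj_translate (p : parabolicGroup) (V : TangentBundle (𝓡 10) F) :
    tangentMap (𝓡 10) (𝓡 3) M.proj (tangentMap (𝓡 10) (𝓡 10) (fun q => M.act q p) V) =
      tangentMap (𝓡 10) (𝓡 3) M.proj V := by
  have h1 := tangentMap_comp_at (I := 𝓡 10) (I' := 𝓡 10) (I'' := 𝓡 3) V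
    (M.mdifferentiable_proj (M.act V.proj p))
    ((M.contMDiff_act_right p).mdifferentiable (by simp) V.proj)
  rw [← h1]
  congr 1
  funext q
  exact M.proj_act q p

variable [IsManifold (𝓡 3) ∞ S]

/-- The defining property of `e_f^* δ`, stated on the tangent bundles. -/
theorem isCoframePullback_iff {f : F} {m : FormBundle S} : M.IsCoframePullback f m ↔
    m.1 = M.proj f ∧ ∀ V V' : TangentBundle (𝓡 10) F, V.proj = f → V'.proj = f →
      ∀ a a' : TangentSpace (𝓡 3) m.1, tangentMap (𝓡 10) (𝓡 3) M.proj V = ⟨m.1, a⟩ →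
        tangentMap (𝓡 10) (𝓡 3) M.proj V' = ⟨m.1, a'⟩ →
        m.2 a a' = lorentzForm (M.nullMotion V) (M.nullMotion V') := by
  constructor
  · rintro ⟨g, rfl, hg⟩
    refine ⟨rfl, ?_⟩
    rintro ⟨f, z⟩ ⟨f', z'⟩ rfl h a a' ha ha'
    obtain rfl : f' = f := h
    rw [← TotalSpace.mk_inj.1 ha, ← TotalSpace.mk_inj.1 ha']
    exact hg z z'
  · obtain ⟨s, g⟩ := m
    rintro ⟨h, hg⟩
    obtain rfl : s = M.proj f := h
    exact ⟨g, rfl, fun v w => hg ⟨f, v⟩ ⟨f, w⟩ rfl rfl _ _ rfl rfl⟩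

/-- The form `e_f^* δ` exists: it is `∑ i, e_i ⊗ e_i` for the components `e_i` of the coframe. -/
theorem exists_isCoframePullback (f : F) : ∃ m, M.IsCoframePullback f m := by
  obtain ⟨e, -, he⟩ := M.exists_coframe f
  let ei : Fin 3 → TangentSpace (𝓡 3) (M.proj f) →L[ℝ] ℝ := fun i =>
    (LinearMap.proj i ∘ₗ e).toContinuousLinearMap
  refine ⟨⟨M.proj f, ∑ i, (ei i).smulRight (ei i)⟩, _, rfl, fun v w => ?_⟩
  have hei : ∀ i z, ei i (mfderiv (𝓡 10) (𝓡 3) M.proj f z) = M.solder f z i := fun i z =>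
    congrFun (he z) i
  rw [M.modelMetric_conn, dotProduct]
  simp [hei]

/-- The map `π' : F → T`, `f ↦ (π f, e_f^* δ)`. -/
noncomputable def toForm (f : F) : FormBundle S := (M.exists_isCoframePullback f).choose

theorem isCoframePullback_toForm (f : F) : M.IsCoframePullback f (M.toForm f) :=
  (M.exists_isCoframePullback f).choose_spec

theorem toForm_fst (f : F) : (M.toForm f).1 = M.proj f :=
  (M.isCoframePullback_iff.1 (M.isCoframePullback_toForm f)).1

theorem eq_toForm {f : F} {m : FormBundle S} (h : M.IsCoframePullback f m) : m = M.toForm f := by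
  obtain ⟨g, rfl, hg⟩ := h
  obtain ⟨g', hm, hg'⟩ := M.isCoframePullback_toForm f
  rw [hm]
  congr 1
  ext a b
  obtain ⟨v, rfl⟩ := M.mfderiv_proj_surjective f a
  obtain ⟨w, rfl⟩ := M.mfderiv_proj_surjective f b
  rw [hg, hg']

theorem toForm_apply {f : F} {V V' : TangentBundle (𝓡 10) F} (hV : V.proj = f) (hV' : V'.proj = f)
    {a a' : TangentSpace (𝓡 3) (M.toForm f).1}
    (ha : tangentMap (𝓡 10) (𝓡 3) M.proj V = ⟨(M.toForm f).1, a⟩)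
    (ha' : tangentMap (𝓡 10) (𝓡 3) M.proj V' = ⟨(M.toForm f).1, a'⟩) :
    (M.toForm f).2 a a' = lorentzForm (M.nullMotion V) (M.nullMotion V') :=
  (M.isCoframePullback_iff.1 (M.isCoframePullback_toForm f)).2 V V' hV hV' a a' ha ha'

theorem mem_inducedConformal {s : S} {g : FormAt S s} :
    g ∈ M.inducedConformal s ↔ ∃ f, M.toForm f = ⟨s, g⟩ := by
  constructor
  · rintro ⟨f, hf⟩
    exact ⟨f, (M.eq_toForm hf).symm⟩
  · rintro ⟨f, hf⟩
    exact ⟨f, hf ▸ M.isCoframePullback_toForm f⟩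

theorem mem_tautologicalBundle {m : FormBundle S} :
    m ∈ tautologicalBundle M.inducedConformal ↔ ∃ f, M.toForm f = m :=
  M.mem_inducedConformal

/-- Along the fibres the pullback of `δ` changes by the square of the scale factor. -/
theorem toForm_act (f : F) (p : parabolicGroup) :
    M.toForm (M.act f p) = scaleForm (parabolicScale p ^ 2) (M.toForm f) := by
  symm
  apply M.eq_toForm
  rw [isCoframePullback_iff]
  refine ⟨(M.toForm_fst f).trans (M.proj_act f p).symm, ?_⟩
  intro V V' hV hV' a a' ha ha'
  obtain ⟨z, rfl, -⟩ := M.exists_translate f p V hV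
  obtain ⟨z', rfl, -⟩ := M.exists_translate f p V' hV'
  rw [tangentMap_proj_translate] at ha ha'
  change parabolicScale p ^ 2 * (M.toForm f).2 a a' = _
  rw [M.toForm_apply (f := f) rfl rfl ha ha', nullMotion_translate, nullMotion_translate,
    lorentzForm_mulVec (transpose_mul_minkowski_mul (inv_mem p.2.1)), lorentzForm_smul_smul]
  ring

/-- The form `e_f^* δ` at `f = s(y) · p`, computed with a local section `s`. -/
theorem toForm_apply_section {U : Set S} (hU : IsOpen U) {s : S → F}
    (hs : ContMDiffOn (𝓡 3) (𝓡 10) ∞ s U) (hps : ∀ y ∈ U, M.proj (s y) = y)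
    {f : F} {p : parabolicGroup} (hf : M.proj f ∈ U) (hfp : M.act (s (M.proj f)) p = f)
    (a a' : TangentSpace (𝓡 3) (M.toForm f).1) :
    (M.toForm f).2 a a' = parabolicScale p ^ 2 * lorentzForm
      (M.nullMotion (tangentMap (𝓡 3) (𝓡 10) s ⟨(M.toForm f).1, a⟩))
      (M.nullMotion (tangentMap (𝓡 3) (𝓡 10) s ⟨(M.toForm f).1, a'⟩)) := by
  have hm : (M.toForm f).1 ∈ U := by rwa [M.toForm_fst]
  have key : ∀ a : TangentSpace (𝓡 3) (M.toForm f).1, tangentMap (𝓡 10) (𝓡 3) M.proj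
      (tangentMap (𝓡 3) (𝓡 10) s ⟨(M.toForm f).1, a⟩) = ⟨(M.toForm f).1, a⟩ := by
    intro a
    have h1 := tangentMap_comp_at (I := 𝓡 3) (I' := 𝓡 10) (I'' := 𝓡 3)
      (⟨(M.toForm f).1, a⟩ : TangentBundle (𝓡 3) S) (M.mdifferentiable_proj (s (M.toForm f).1))
      ((hs.contMDiffAt (hU.mem_nhds hm)).mdifferentiableAt (by simp))
    rw [← h1]
    have h2 : HasMFDerivAt (𝓡 3) (𝓡 3) (M.proj ∘ s) (M.toForm f).1
        (ContinuousLinearMap.id ℝ (TangentSpace (𝓡 3) (M.toForm f).1)) := by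
      refine (hasMFDerivAt_id (M.toForm f).1).congr_of_eventuallyEq ?_
      filter_upwards [hU.mem_nhds hm] with y hy
      exact hps y hy
    simp only [tangentMap]
    rw [h2.mfderiv]
    exact TotalSpace.ext (hps _ hm) (by rfl)
  have hproj : ∀ a : TangentSpace (𝓡 3) (M.toForm f).1, (tangentMap (𝓡 10) (𝓡 10)
      (fun q => M.act q p) (tangentMap (𝓡 3) (𝓡 10) s ⟨(M.toForm f).1, a⟩)).proj = f := by
    intro a
    simp only [tangentMap]
    rw [M.toForm_fst, hfp]
  rw [M.toForm_apply (hproj a) (hproj a')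
    ((M.tangentMap_proj_translate p _).trans (key a))
    ((M.tangentMap_proj_translate p _).trans (key a')),
    nullMotion_translate, nullMotion_translate,
    lorentzForm_mulVec (transpose_mul_minkowski_mul (inv_mem p.2.1)), lorentzForm_smul_smul]
  rw [← pow_two]

theorem contMDiff_toForm : ContMDiff (𝓡 10) formModel ∞ M.toForm := by
  intro f₀
  obtain ⟨U, hU, hf₀, s, hs, hps, τ, hτ, hsτ⟩ := M.locally_trivial (M.proj f₀)
  have hfst : (fun f => (M.toForm f).1) = M.proj := funext M.toForm_fst
  have h1 : ContMDiffAt (𝓡 10) (𝓡 3) ∞ (fun f => (M.toForm f).1) f₀ :=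
    hfst ▸ M.proj_smooth f₀
  have hpre : M.proj ⁻¹' U ∈ 𝓝 f₀ := (hU.preimage M.proj_smooth.continuous).mem_nhds hf₀
  refine contMDiffAt_formBundle h1 fun v w => ?_
  have hscale : ContMDiffAt (𝓡 10) 𝓘(ℝ, ℝ) ∞ (fun f => parabolicScale (τ f) ^ 2) f₀ := by
    have hc : ContDiff ℝ ∞ fun A : MatSpace => (A 4 4 - A 4 0) ^ 2 := by fun_prop
    exact (hc.contMDiff.contMDiffAt).comp f₀ (hτ.contMDiffAt hpre)
  have hvec : ∀ v : E 3, ContMDiffAt (𝓡 10) 𝓘(ℝ, Fin 5 → ℝ) ∞ (fun f =>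
      M.nullMotion (tangentMap (𝓡 3) (𝓡 10) s ⟨(M.toForm f).1,
        (trivializationAt (E 3) (TangentSpace (𝓡 3)) (M.toForm f₀).1).symm (M.toForm f).1 v⟩))
      f₀ := by
    intro v
    have e1 := contMDiffAt_trivialization_symm (M.toForm f₀).1 (w := fun _ : F => v) h1
      contMDiffAt_const (FiberBundle.mem_baseSet_trivializationAt' _)
    have hmem : (M.toForm f₀).1 ∈ U := by rwa [M.toForm_fst]
    have e2 := hs.contMDiffAt_tangentMap hU (V := ⟨(M.toForm f₀).1,
      (trivializationAt (E 3) (TangentSpace (𝓡 3)) (M.toForm f₀).1).symm (M.toForm f₀).1 v⟩) hmem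
    exact M.contMDiff_nullMotion.contMDiffAt.comp f₀ (e2.comp f₀ e1)
  have hform : ContMDiffAt (𝓡 10) 𝓘(ℝ, ℝ) ∞ (fun f => parabolicScale (τ f) ^ 2 * lorentzForm
      (M.nullMotion (tangentMap (𝓡 3) (𝓡 10) s ⟨(M.toForm f).1,
        (trivializationAt (E 3) (TangentSpace (𝓡 3)) (M.toForm f₀).1).symm (M.toForm f).1 v⟩))
      (M.nullMotion (tangentMap (𝓡 3) (𝓡 10) s ⟨(M.toForm f).1,
        (trivializationAt (E 3) (TangentSpace (𝓡 3)) (M.toForm f₀).1).symm (M.toForm f).1 w⟩)))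
      f₀ :=
    hscale.mul (contDiff_lorentzForm.contMDiff.contMDiffAt.comp f₀
      ((hvec v).prodMk_space (hvec w)))
  refine hform.congr_of_eventuallyEq ?_
  filter_upwards [hpre] with f hf
  exact M.toForm_apply_section hU hs hps hf (hsτ f hf) _ _

end CartanGeometry

namespace CartanGeometry

variable {F : Type*} [TopologicalSpace F] [ChartedSpace (E 10) F] [IsManifold (𝓡 10) ∞ F]
  {S : Type*} [TopologicalSpace S] [ChartedSpace (E 3) S] [IsManifold (𝓡 3) ∞ S]
  (M : MoebiusGeometry F S)

theorem coframePullback_apply_self_pos {f : F} {m : FormBundle S} (h : M.IsCoframePullback f m)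
    {a : TangentSpace (𝓡 3) m.1} (ha : a ≠ 0) : 0 < m.2 a a := by
  obtain ⟨g, rfl, hg⟩ := h
  obtain ⟨z, rfl⟩ := M.mfderiv_proj_surjective f a
  change 0 < g _ _
  rw [hg, M.modelMetric_conn]
  have h0 : M.solder f z ≠ 0 := fun h => ha (M.mfderiv_proj_eq_zero_iff.2 h)
  have h1 : M.solder f z ⬝ᵥ M.solder f z ≠ 0 := fun h => h0 (dotProduct_self_eq_zero.1 h)
  refine lt_of_le_of_ne ?_ h1.symm
  exact Finset.sum_nonneg fun i _ => mul_self_nonneg _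

theorem toForm_apply_self_pos (f : F) {a : TangentSpace (𝓡 3) (M.toForm f).1} (ha : a ≠ 0) :
    0 < (M.toForm f).2 a a :=
  M.coframePullback_apply_self_pos (M.isCoframePullback_toForm f) ha

theorem coframePullback_symm {f : F} {m : FormBundle S} (h : M.IsCoframePullback f m)
    (a b : TangentSpace (𝓡 3) m.1) : m.2 a b = m.2 b a := by
  obtain ⟨g, rfl, hg⟩ := h
  obtain ⟨z, rfl⟩ := M.mfderiv_proj_surjective f a
  obtain ⟨w, rfl⟩ := M.mfderiv_proj_surjective f b
  change g _ _ = g _ _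
  rw [hg, hg, M.modelMetric_conn, M.modelMetric_conn, dotProduct_comm]

theorem exists_scale (c : ℝ) (hc : 0 < c) : ∃ p : parabolicGroup, parabolicScale p ^ 2 = c := by
  refine ⟨parabolicSlice (-(Real.log c / 2), 0), ?_⟩
  rw [parabolicScale_parabolicSlice, ← Real.exp_nat_mul]
  simp only [neg_neg]
  rw [show ((2 : ℕ) : ℝ) * (Real.log c / 2) = Real.log c by push_cast; ring, Real.exp_log hc]

theorem isConformalMetric_inducedConformal : IsConformalMetric M.inducedConformal where
  symm := by
    rintro s g ⟨f, hf⟩ v w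
    exact M.coframePullback_symm hf v w
  pos := by
    rintro s g ⟨f, hf⟩ v hv
    exact M.coframePullback_apply_self_pos hf hv
  ray := by
    intro s g hg g'
    obtain ⟨f, hf⟩ := M.mem_inducedConformal.1 hg
    rw [M.mem_inducedConformal]
    constructor
    · rintro ⟨f', hf'⟩
      have h1 : M.proj f = M.proj f' := by
        rw [← M.toForm_fst, ← M.toForm_fst, hf, hf']
      obtain ⟨p, rfl⟩ := M.exists_act_eq h1
      rw [M.toForm_act, hf] at hf'
      exact ⟨_, pow_pos (parabolicScale_pos p) 2, (TotalSpace.mk_inj.1 hf').symm⟩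
    · rintro ⟨c, hc, rfl⟩
      obtain ⟨p, rfl⟩ := exists_scale c hc
      exact ⟨M.act f p, by rw [M.toForm_act, hf]; rfl⟩
  locally_smooth := by
    intro s₀
    obtain ⟨U, hU, hs₀, s, hs, hps, -⟩ := M.locally_trivial s₀
    have hex : ∀ y : S, ∃ g : FormAt S y, y ∈ U → M.toForm (s y) = ⟨y, g⟩ := by
      intro y
      by_cases hy : y ∈ U
      · have h1 : (M.toForm (s y)).1 = y := by rw [M.toForm_fst, hps y hy]
        generalize M.toForm (s y) = m at *
        obtain ⟨y', g⟩ := m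
        obtain rfl : y' = y := h1
        exact ⟨g, fun _ => rfl⟩
      · exact ⟨0, fun h => (hy h).elim⟩
    choose g hg using hex
    refine ⟨U, hU, hs₀, g, fun y hy => M.mem_inducedConformal.2 ⟨s y, hg y hy⟩, ?_⟩
    have h2 : ContMDiffOn (𝓡 3) formModel ∞ (M.toForm ∘ s) U :=
      M.contMDiff_toForm.comp_contMDiffOn hs
    exact h2.congr fun y hy => (hg y hy).symm

/-! ### The differential of the map to the tautological bundle -/

theorem mdifferentiable_toForm : MDifferentiable (𝓡 10) formModel M.toForm :=
  M.contMDiff_toForm.mdifferentiable (by simp)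

theorem mdifferentiable_formBundle_proj :
    MDifferentiable formModel (𝓡 3) (TotalSpace.proj : FormBundle S → S) :=
  (contMDiff_proj (n := ∞) (FormAt S)).mdifferentiable (by simp)

theorem tangentMap_formBundle_proj_toForm (V : TangentBundle (𝓡 10) F) :
    tangentMap formModel (𝓡 3) (TotalSpace.proj : FormBundle S → S)
      (tangentMap (𝓡 10) formModel M.toForm V) = tangentMap (𝓡 10) (𝓡 3) M.proj V := by
  have h1 := tangentMap_comp_at (I := 𝓡 10) (I' := formModel) (I'' := 𝓡 3) V
    (mdifferentiable_formBundle_proj (M.toForm V.proj)) (M.mdifferentiable_toForm V.proj)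
  rw [← h1]
  congr 1
  exact funext M.toForm_fst

theorem toForm_act_of_scale {p : parabolicGroup} (hp : parabolicScale p = 1) (f : F) :
    M.toForm (M.act f p) = M.toForm f := by
  rw [M.toForm_act, hp, one_pow, scaleForm_one]

theorem tangentMap_toForm_translate {p : parabolicGroup} (hp : parabolicScale p = 1)
    (V : TangentBundle (𝓡 10) F) :
    tangentMap (𝓡 10) formModel M.toForm (tangentMap (𝓡 10) (𝓡 10) (fun q => M.act q p) V) =
      tangentMap (𝓡 10) formModel M.toForm V := by
  have h1 := tangentMap_comp_at (I := 𝓡 10) (I' := 𝓡 10) (I'' := formModel) V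
    (M.mdifferentiable_toForm (M.act V.proj p))
    ((M.contMDiff_act_right p).mdifferentiable (by simp) V.proj)
  rw [← h1]
  congr 1
  funext q
  exact M.toForm_act_of_scale hp q

/-- A vector that the connection maps to an element annihilating `x - u` is tangent to an orbit of
the stabilizer of `x - u`, on which `π'` is constant. -/
theorem mfderiv_toForm_eq_zero_of_nullMotion {f : F} {z : TangentSpace (𝓡 10) f}
    (h : M.nullMotion ⟨f, z⟩ = 0) : mfderiv (𝓡 10) formModel M.toForm f z = 0 := by
  obtain ⟨p, hp1, hp, hpz⟩ := M.exists_vertical_curve (z := z) (c := 0) (by rw [zero_smul]; exact h)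
  have h1 := tangentMap_comp_at (I := 𝓘(ℝ, ℝ)) (I' := 𝓡 10) (I'' := formModel)
    (⟨0, (1 : ℝ)⟩ : TangentBundle 𝓘(ℝ, ℝ) ℝ)
    (M.mdifferentiable_toForm (M.act f (p 0))) (hp.mdifferentiable (by simp) (0 : ℝ))
  rw [hpz] at h1
  have h2 : M.toForm ∘ (fun t => M.act f (p t)) = fun _ => M.toForm f := by
    funext t; exact M.toForm_act_of_scale (by rw [hp1]; simp) f
  rw [h2] at h1
  simp only [tangentMap, mfderiv_const] at h1
  exact (TotalSpace.mk_inj.1 h1).symm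

theorem mfderiv_proj_eq_zero_of_mfderiv_toForm {f : F} {z : TangentSpace (𝓡 10) f}
    (h : mfderiv (𝓡 10) formModel M.toForm f z = 0) : mfderiv (𝓡 10) (𝓡 3) M.proj f z = 0 := by
  have h2 : mfderiv formModel (𝓡 3) (TotalSpace.proj : FormBundle S → S) (M.toForm f)
      (mfderiv (𝓡 10) formModel M.toForm f z) = 0 := by
    rw [h]; exact ContinuousLinearMap.map_zero _
  have h1 : (⟨(M.toForm f).1, mfderiv formModel (𝓡 3) (TotalSpace.proj : FormBundle S → S)
      (M.toForm f) (mfderiv (𝓡 10) formModel M.toForm f z)⟩ : TangentBundle (𝓡 3) S) =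
      ⟨M.proj f, mfderiv (𝓡 10) (𝓡 3) M.proj f z⟩ := M.tangentMap_formBundle_proj_toForm ⟨f, z⟩
  rw [h2, M.toForm_fst] at h1
  exact (TotalSpace.mk_inj.1 h1).symm

/-- Near a point there is a smooth function on the bundle of bilinear forms that is homogeneous of
degree one on the fibres and positive on inner products: the value on a smooth vector field. -/
theorem exists_homogeneous_function (s₀ : S) : ∃ (U : Set S) (μ : FormBundle S → ℝ), IsOpen U ∧
    s₀ ∈ U ∧ ContMDiffOn formModel 𝓘(ℝ, ℝ) ∞ μ (TotalSpace.proj ⁻¹' U) ∧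
    (∀ c m, μ (scaleForm c m) = c * μ m) ∧ ∀ f, M.proj f ∈ U → 0 < μ (M.toForm f) := by
  set e := trivializationAt (E 3) (TangentSpace (𝓡 3)) s₀ with he
  obtain ⟨v, hv⟩ := exists_ne (0 : E 3)
  refine ⟨e.baseSet, fun m => m.2 (e.symm m.1 v) (e.symm m.1 v), e.open_baseSet,
    FiberBundle.mem_baseSet_trivializationAt' _, ?_, fun c m => rfl, ?_⟩
  · intro m hm
    have h1 : ContMDiffAt formModel (𝓡 3) ∞ (fun m : FormBundle S => m.1) m :=
      (contMDiff_proj (FormAt S)).contMDiffAt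
    have h2 := contMDiffAt_trivialization_symm s₀ (w := fun _ : FormBundle S => v) h1
      contMDiffAt_const hm
    have h3 : ContMDiffAt formModel formModel ∞ (fun m : FormBundle S =>
      TotalSpace.mk' (E 3 →L[ℝ] E 3 →L[ℝ] ℝ) m.1 m.2) m := contMDiffAt_id
    have h4 := ContMDiffAt.clm_bundle_apply₂ (E₃ := Bundle.Trivial S ℝ) h3 h2 h2
    exact ((contMDiffAt_totalSpace.1 h4).2).contMDiffWithinAt
  · intro f hf
    refine M.toForm_apply_self_pos f fun h0 => hv ?_
    have hf' : (M.toForm f).1 ∈ e.baseSet := by rwa [M.toForm_fst]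
    have h1 := (e.continuousLinearEquivAt ℝ (M.toForm f).1 hf').symm.injective
    apply h1
    rw [map_zero]
    exact h0

/-- The differential of `π'` vanishes exactly on the vectors on which the connection annihilates
`x - u`. For a vertical vector with `A(z) (x - u) = c (x - u)` it contains the derivative `2 c` of
the logarithm of the scale of the metric. -/
theorem mfderiv_toForm_eq_zero_iff {f : F} {z : TangentSpace (𝓡 10) f} :
    mfderiv (𝓡 10) formModel M.toForm f z = 0 ↔ M.nullMotion ⟨f, z⟩ = 0 := by
  refine ⟨fun h => ?_, M.mfderiv_toForm_eq_zero_of_nullMotion⟩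
  have hs : M.solder f z = 0 :=
    M.mfderiv_proj_eq_zero_iff.1 (M.mfderiv_proj_eq_zero_of_mfderiv_toForm h)
  have h0 := M.conn_mulVec_pastVector z
  rw [hs, show spatialVector 0 = 0 by ext i; fin_cases i <;> simp [spatialVector], zero_add] at h0
  set c := ((M.conn f z : Mat5) *ᵥ pastVector) 4 with hc
  suffices c = 0 by
    rw [this, zero_smul] at h0
    exact h0
  obtain ⟨p, hp1, hp, hpz⟩ := M.exists_vertical_curve h0
  obtain ⟨U, μ, hU, hfU, hμ, hμc, hμpos⟩ := M.exists_homogeneous_function (M.proj f)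
  have hm : (M.toForm f).1 ∈ U := by rwa [M.toForm_fst]
  have hμd : MDifferentiableAt formModel 𝓘(ℝ, ℝ) μ (M.toForm f) :=
    ((hμ.contMDiffAt ((hU.preimage (FiberBundle.continuous_proj _ (FormAt S))).mem_nhds
      hm)).mdifferentiableAt (by simp))
  have hcomp : MDifferentiableAt (𝓡 10) 𝓘(ℝ, ℝ) (μ ∘ M.toForm) f :=
    hμd.comp f (M.mdifferentiable_toForm f)
  have hz : mfderiv (𝓡 10) 𝓘(ℝ, ℝ) (μ ∘ M.toForm) f z = 0 := by
    rw [mfderiv_comp_apply f hμd (M.mdifferentiable_toForm f), h]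
    exact ContinuousLinearMap.map_zero _
  have h00 : M.act f (p 0) = f := congrArg TotalSpace.proj hpz
  have h1 := tangentMap_comp_at (I := 𝓘(ℝ, ℝ)) (I' := 𝓡 10) (I'' := 𝓘(ℝ, ℝ))
    (⟨0, (1 : ℝ)⟩ : TangentBundle 𝓘(ℝ, ℝ) ℝ) (g := μ ∘ M.toForm)
    (by simpa [h00] using hcomp) (hp.mdifferentiable (by simp) (0 : ℝ))
  rw [hpz] at h1
  have h2 : (μ ∘ M.toForm) ∘ (fun t => M.act f (p t)) =
      fun t => Real.exp (t * c) ^ 2 * μ (M.toForm f) := by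
    funext t
    simp only [Function.comp_apply]
    rw [M.toForm_act, hμc, hp1]
  have h3 : HasDerivAt (fun t : ℝ => Real.exp (t * c) ^ 2 * μ (M.toForm f))
      (2 * c * μ (M.toForm f)) 0 := by
    have := (((((hasDerivAt_id (0 : ℝ)).mul_const c).exp).pow 2).mul_const (μ (M.toForm f)))
    simpa using this
  have h4 := h1
  rw [h2] at h4
  have h5 : mfderiv 𝓘(ℝ, ℝ) 𝓘(ℝ, ℝ) (fun t : ℝ => Real.exp (t * c) ^ 2 * μ (M.toForm f)) (0 : ℝ)
      (1 : ℝ) = (0 : ℝ) := by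
    have h6 := congrArg (fun V : TangentBundle 𝓘(ℝ, ℝ) ℝ => (V.2 : ℝ)) h4
    exact h6.trans hz
  rw [mfderiv_eq_fderiv] at h5
  have h7 : fderiv ℝ (fun t : ℝ => Real.exp (t * c) ^ 2 * μ (M.toForm f)) 0 1 =
      2 * c * μ (M.toForm f) := by
    rw [← h3.deriv]; rfl
  have h8 : 2 * c * μ (M.toForm f) = 0 := h7.symm.trans h5
  have h9 := hμpos f hfU
  rcases mul_eq_zero.1 h8 with h | h
  · linarith
  · exact absurd h h9.ne'

end CartanGeometry

/-! ### The 3-planes of a Möbius geometry -/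

/-- Equality of two 3-planes from an inclusion, for planes whose base points agree only
propositionally; their vectors are compared in the tangent bundle. -/
theorem plane_eq_of_forall_mem {S : Type*} [TopologicalSpace S] [ChartedSpace (E 3) S]
    [IsManifold (𝓡 3) ∞ S]
    {a b : Σ m : FormBundle S, Submodule ℝ (TangentSpace (formModel) m)} (h : a.1 = b.1)
    (ha : Module.finrank ℝ a.2 = 3) (hb : Module.finrank ℝ b.2 = 3)
    (hab : ∀ w ∈ a.2, ∃ w' ∈ b.2,
      (⟨a.1, w⟩ : TangentBundle formModel (FormBundle S)) = ⟨b.1, w'⟩) : a = b := by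
  obtain ⟨m, A⟩ := a
  obtain ⟨m', B⟩ := b
  obtain rfl : m = m' := h
  congr 1
  have : Module.Finite ℝ B := Module.finite_of_finrank_pos (by simp only at hb; omega)
  refine Submodule.eq_of_le_of_finrank_eq (fun w hw => ?_) (ha.trans hb.symm)
  obtain ⟨w', hw', he⟩ := hab w hw
  rw [TotalSpace.mk_inj.1 he]
  exact hw'

/-- Every tangent vector is the velocity of a smooth curve defined on the whole line: the curve
`t ↦ ε sin (t / ε) z` in a chart, which stays in a small ball. -/
theorem exists_curve {n : ℕ} {N : Type*} [TopologicalSpace N] [ChartedSpace (E n) N]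
    [IsManifold (𝓡 n) ∞ N] (y : N) (z : TangentSpace (𝓡 n) y) :
    ∃ γ : ℝ → N, ContMDiff 𝓘(ℝ, ℝ) (𝓡 n) ∞ γ ∧
      tangentMap 𝓘(ℝ, ℝ) (𝓡 n) γ ⟨0, (1 : ℝ)⟩ = ⟨y, z⟩ := by
  set φ := extChartAt (𝓡 n) y with hφ
  have htarget : IsOpen φ.target := isOpen_extChartAt_target y
  obtain ⟨r, hr, hball⟩ := Metric.isOpen_iff.1 htarget _ (mem_extChartAt_target (I := 𝓡 n) y)
  let z' : E n := mfderiv (𝓡 n) 𝓘(ℝ, E n) φ y z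
  obtain ⟨ε, hε, hεr⟩ : ∃ ε : ℝ, 0 < ε ∧ ε * ‖z'‖ < r := by
    refine ⟨r / (‖z'‖ + 1), by positivity, ?_⟩
    rw [div_mul_eq_mul_div, div_lt_iff₀ (by positivity)]
    nlinarith [norm_nonneg z']
  let c : ℝ → E n := fun t => φ y + (ε * Real.sin (t / ε)) • z'
  have hc : ContDiff ℝ ∞ c := by
    have : ContDiff ℝ ∞ fun t : ℝ => ε * Real.sin (t / ε) := by fun_prop
    exact contDiff_const.add (this.smul contDiff_const)
  have hmem : ∀ t, c t ∈ φ.target := by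
    intro t
    apply hball
    have hd : c t - φ y = (ε * Real.sin (t / ε)) • z' := add_sub_cancel_left _ _
    change dist (c t) (φ y) < r
    rw [dist_eq_norm, hd, norm_smul, Real.norm_eq_abs, abs_mul, abs_of_pos hε]
    have h1 := Real.abs_sin_le_one (t / ε)
    calc ε * |Real.sin (t / ε)| * ‖z'‖ ≤ ε * 1 * ‖z'‖ := by gcongr
      _ < r := by rwa [mul_one]
  have hsymm : ContMDiffOn 𝓘(ℝ, E n) (𝓡 n) ∞ φ.symm φ.target := contMDiffOn_extChartAt_symm y
  have hγ : ContMDiff 𝓘(ℝ, ℝ) (𝓡 n) ∞ (φ.symm ∘ c) := fun t =>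
    (hsymm.contMDiffAt (htarget.mem_nhds (hmem t))).comp t hc.contMDiff.contMDiffAt
  refine ⟨φ.symm ∘ c, hγ, ?_⟩
  have hc0 : c 0 = φ y := by simp [c]
  have hy : φ.symm (c 0) = y := by rw [hc0]; exact extChartAt_to_inv y
  have hd : HasDerivAt c z' 0 := by
    have h1 : HasDerivAt (fun t : ℝ => ε * Real.sin (t / ε)) 1 0 := by
      have := (((hasDerivAt_id (0 : ℝ)).div_const ε).sin).const_mul ε
      simpa [hε.ne'] using this
    have h2 := (h1.smul_const z').const_add (φ y)
    rw [one_smul] at h2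
    exact h2
  have h1 := tangentMap_comp_at (I := 𝓘(ℝ, ℝ)) (I' := 𝓘(ℝ, E n)) (I'' := 𝓡 n)
    (⟨0, (1 : ℝ)⟩ : TangentBundle 𝓘(ℝ, ℝ) ℝ)
    ((hsymm.contMDiffAt (htarget.mem_nhds (hmem 0))).mdifferentiableAt (by simp))
    (hc.contMDiff.mdifferentiable (by simp) (0 : ℝ))
  have h2 : tangentMap 𝓘(ℝ, ℝ) 𝓘(ℝ, E n) c ⟨0, (1 : ℝ)⟩ =
      tangentMap (𝓡 n) 𝓘(ℝ, E n) φ ⟨y, z⟩ := by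
    simp only [tangentMap]
    refine TotalSpace.ext hc0 ?_
    rw [mfderiv_eq_fderiv]
    apply heq_of_eq
    change fderiv ℝ c 0 1 = z'
    rw [← hd.deriv]; rfl
  have hφd : MDifferentiableAt (𝓡 n) 𝓘(ℝ, E n) φ y :=
    (contMDiffAt_extChartAt (n := ∞)).mdifferentiableAt (by simp)
  have hsd : MDifferentiableAt 𝓘(ℝ, E n) (𝓡 n) φ.symm (φ y) :=
    (hsymm.contMDiffAt (htarget.mem_nhds (mem_extChartAt_target y))).mdifferentiableAt (by simp)
  have h3 := tangentMap_comp_at (I := 𝓡 n) (I' := 𝓘(ℝ, E n)) (I'' := 𝓡 n)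
    (⟨y, z⟩ : TangentBundle (𝓡 n) N) hsd hφd
  rw [h1, h2, ← h3]
  have h4 : HasMFDerivAt (𝓡 n) (𝓡 n) (φ.symm ∘ φ) y
      (ContinuousLinearMap.id ℝ (TangentSpace (𝓡 n) y)) := by
    refine (hasMFDerivAt_id y).congr_of_eventuallyEq ?_
    filter_upwards [extChartAt_source_mem_nhds (I := 𝓡 n) y] with q hq
    exact φ.left_inv hq
  simp only [tangentMap]
  rw [h4.mfderiv]
  exact TotalSpace.ext (extChartAt_to_inv y) (by rfl)

namespace CartanGeometry

variable {F : Type*} [TopologicalSpace F] [ChartedSpace (E 10) F] [IsManifold (𝓡 10) ∞ F]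
  {S : Type*} [TopologicalSpace S] [ChartedSpace (E 3) S]
  (M : MoebiusGeometry F S)

theorem nullMotion_eq (V : TangentBundle (𝓡 10) F) :
    M.nullMotion V = spatialVector (spatialPart (M.nullMotion V)) + M.nullMotion V 4 • pastVector :=
  mulVec_pastVector_eq_add (M.conn V.proj V.2).2

/-- The frame of `A_f⁻¹(𝔤₋)` that corresponds to the translations. -/
theorem exists_minusFrame (f : F) : ∃ L : (Fin 3 → ℝ) →ₗ[ℝ] TangentSpace (𝓡 10) f,
    (∀ ξ, (M.conn f (L ξ) : Mat5) = pastTranslation ξ) ∧ LinearMap.range L = M.minusSpace f := by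
  let T : (Fin 3 → ℝ) →ₗ[ℝ] deSitterAlgebra :=
    { toFun := fun ξ => ⟨pastTranslation ξ, pastTranslation_mem ξ⟩
      map_add' := fun ξ ζ => Subtype.ext (pastTranslation_add ξ ζ)
      map_smul' := fun c ξ => Subtype.ext (pastTranslation_smul c ξ) }
  let e := LinearEquiv.ofBijective (M.conn f) (M.conn_bijective f)
  have h1 : ∀ ξ, M.conn f ((e.symm.toLinearMap ∘ₗ T) ξ) = T ξ := fun ξ => e.apply_symm_apply (T ξ)
  refine ⟨e.symm.toLinearMap ∘ₗ T, fun ξ => congrArg Subtype.val (h1 ξ), ?_⟩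
  ext z
  constructor
  · rintro ⟨ξ, rfl⟩
    change ((M.conn f _ : deSitterAlgebra) : Mat5) ∈ gMinus
    rw [h1]
    exact ⟨ξ, rfl⟩
  · rintro ⟨ξ, hξ⟩
    refine ⟨ξ, (M.conn_bijective f).1 ?_⟩
    rw [h1]
    exact Subtype.ext hξ

theorem nullMotion_of_conn_eq {f : F} {z : TangentSpace (𝓡 10) f} {ξ : Fin 3 → ℝ}
    (h : (M.conn f z : Mat5) = pastTranslation ξ) :
    M.nullMotion ⟨f, z⟩ = spatialVector ((-2 : ℝ) • ξ) := by
  rw [nullMotion, h, pastTranslation_mulVec]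

/-- The effect of a null rotation on `A(V) (x - u) = ξ + c (x - u)`. -/
theorem slice_inv_mulVec_nullMotion (b : Fin 3 → ℝ) (V : TangentBundle (𝓡 10) F) :
    ((((parabolicSlice (0, b))⁻¹ : GL (Fin 5) ℝ) : Mat5) *ᵥ M.nullMotion V) 4 =
      b ⬝ᵥ spatialPart (M.nullMotion V) + M.nullMotion V 4 := by
  rw [coe_parabolicSlice_zero_inv, M.nullMotion_eq, Matrix.mulVec_add, Matrix.mulVec_smul,
    nullRotation_mulVec_pastVector, nullRotation_mulVec_spatialVector]
  generalize M.nullMotion V 4 = c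
  generalize spatialPart (M.nullMotion V) = ξ
  simp [spatialVector, spatialPart, pastVector_eq, dotProduct, Fin.sum_univ_three]

variable [IsManifold (𝓡 3) ∞ S]

/-- The plane `dπ'_f (A_f⁻¹(𝔤₋))`, with its base point `π' f`. -/
noncomputable def planeAt (f : F) : Σ m : FormBundle S, Submodule ℝ (TangentSpace (formModel) m) :=
  ⟨M.toForm f, (M.minusSpace f).map (mfderiv (𝓡 10) formModel M.toForm f).toLinearMap⟩

theorem mfderiv_toForm_eq_of_nullMotion {f : F} {z z' : TangentSpace (𝓡 10) f} :
    mfderiv (𝓡 10) formModel M.toForm f z = mfderiv (𝓡 10) formModel M.toForm f z' ↔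
      M.nullMotion ⟨f, z⟩ = M.nullMotion ⟨f, z'⟩ := by
  rw [← sub_eq_zero, ← sub_eq_zero (a := M.nullMotion ⟨f, z⟩)]
  have h1 : mfderiv (𝓡 10) formModel M.toForm f z - mfderiv (𝓡 10) formModel M.toForm f z' =
      mfderiv (𝓡 10) formModel M.toForm f (z - z') := (ContinuousLinearMap.map_sub _ _ _).symm
  have h2 : M.nullMotion ⟨f, z⟩ - M.nullMotion ⟨f, z'⟩ = M.nullMotion ⟨f, z - z'⟩ := by
    simp only [nullMotion]
    rw [map_sub, Submodule.coe_sub, Matrix.sub_mulVec]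
  rw [h1, h2, M.mfderiv_toForm_eq_zero_iff]

/-- Modulo the kernel of `dπ'_f`, the space `A_f⁻¹(𝔤₋)` consists of the vectors for which
`A_f(z) (x - u)` is spatial. -/
theorem mem_planeAt {f : F} {w : TangentSpace formModel (M.toForm f)} :
    w ∈ (M.planeAt f).2 ↔ ∃ z : TangentSpace (𝓡 10) f, M.nullMotion ⟨f, z⟩ 4 = 0 ∧
      mfderiv (𝓡 10) formModel M.toForm f z = w := by
  obtain ⟨L, hL, hrange⟩ := M.exists_minusFrame f
  constructor
  · rintro ⟨z, hz, rfl⟩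
    rw [← hrange] at hz
    obtain ⟨ξ, rfl⟩ := hz
    refine ⟨L ξ, ?_, rfl⟩
    rw [M.nullMotion_of_conn_eq (hL ξ)]
    rfl
  · rintro ⟨z, hz, rfl⟩
    refine ⟨L ((-2 : ℝ)⁻¹ • spatialPart (M.nullMotion ⟨f, z⟩)), hrange ▸ ⟨_, rfl⟩, ?_⟩
    refine M.mfderiv_toForm_eq_of_nullMotion.2 ?_
    rw [M.nullMotion_of_conn_eq (hL _), smul_smul, mul_inv_cancel₀ (by norm_num), one_smul]
    conv_rhs => rw [M.nullMotion_eq, hz, zero_smul, add_zero]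

/-- The plane at `f` is spanned by the images of the vectors on which the connection takes the
standard basis of `𝔤₋` as its values. -/
theorem exists_planeAt_frame (f : F) : ∃ z : Fin 3 → TangentSpace (𝓡 10) f,
    (∀ i, (M.conn f (z i) : Mat5) = pastTranslation (Pi.single i 1)) ∧
    (M.planeAt f).2 = Submodule.span ℝ
      (Set.range fun i => mfderiv (𝓡 10) formModel M.toForm f (z i)) ∧
    LinearIndependent ℝ fun i => mfderiv (𝓡 10) formModel M.toForm f (z i) := by
  obtain ⟨L, hL, hrange⟩ := M.exists_minusFrame f
  let D : TangentSpace (𝓡 10) f →ₗ[ℝ] TangentSpace formModel (M.toForm f) :=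
    (mfderiv (𝓡 10) formModel M.toForm f).toLinearMap
  refine ⟨fun i => L (Pi.single i 1), fun i => hL _, ?_, ?_⟩
  · change (M.minusSpace f).map D = _
    rw [← hrange, ← LinearMap.range_comp, LinearMap.range_eq_map,
      ← (Pi.basisFun ℝ (Fin 3)).span_eq, Submodule.map_span, ← Set.range_comp]
    congr 2
    funext i
    simp [D]
  · have hinj : LinearMap.ker (D ∘ₗ L) = ⊥ := by
      rw [LinearMap.ker_eq_bot']
      intro ξ hξ
      have h1 := M.mfderiv_toForm_eq_zero_iff.1 hξ
      rw [M.nullMotion_of_conn_eq (hL ξ)] at h1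
      have h2 := congrArg spatialPart h1
      rw [spatialPart_spatialVector] at h2
      have h3 : spatialPart 0 = 0 := by ext i; fin_cases i <;> simp [spatialPart]
      rw [h3] at h2
      exact (smul_eq_zero.1 h2).resolve_left (by norm_num)
    have h2 := (Pi.basisFun ℝ (Fin 3)).linearIndependent.map' (D ∘ₗ L) hinj
    convert! h2 using 1
    funext i
    simp [D]

theorem finrank_planeAt (f : F) : Module.finrank ℝ (M.planeAt f).2 = 3 := by
  obtain ⟨z, -, hspan, hli⟩ := M.exists_planeAt_frame f
  rw [hspan]
  exact (finrank_span_eq_card hli).trans (Fintype.card_fin 3)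

theorem planeAt_mem (f : F) : M.planeAt f ∈ transversePlanes M.inducedConformal := by
  refine ⟨M.mem_tautologicalBundle.2 ⟨f, rfl⟩, ?_, M.finrank_planeAt f, ?_⟩
  · intro w hw
    obtain ⟨z, -, rfl⟩ := M.mem_planeAt.1 hw
    obtain ⟨γ, hγ, hγz⟩ := exists_curve f z
    refine ⟨M.toForm ∘ γ, M.contMDiff_toForm.comp hγ,
      fun t => M.mem_tautologicalBundle.2 ⟨γ t, rfl⟩, ?_⟩
    have h1 := tangentMap_comp_at (I := 𝓘(ℝ, ℝ)) (I' := 𝓡 10) (I'' := formModel)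
      (⟨0, (1 : ℝ)⟩ : TangentBundle 𝓘(ℝ, ℝ) ℝ)
      (M.mdifferentiable_toForm (γ 0)) (hγ.mdifferentiable (by simp) (0 : ℝ))
    rw [h1, hγz]
    rfl
  · intro w hw h0
    obtain ⟨z, hz, rfl⟩ := M.mem_planeAt.1 hw
    have h1 : (⟨(M.toForm f).1, mfderiv formModel (𝓡 3) (TotalSpace.proj : FormBundle S → S)
        (M.toForm f) (mfderiv (𝓡 10) formModel M.toForm f z)⟩ : TangentBundle (𝓡 3) S) =
        ⟨M.proj f, mfderiv (𝓡 10) (𝓡 3) M.proj f z⟩ := M.tangentMap_formBundle_proj_toForm ⟨f, z⟩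
    have h0' : mfderiv formModel (𝓡 3) (TotalSpace.proj : FormBundle S → S)
        (M.toForm f) (mfderiv (𝓡 10) formModel M.toForm f z) = 0 := h0
    rw [h0', M.toForm_fst] at h1
    have h2 := M.mfderiv_proj_eq_zero_iff.1 (TotalSpace.mk_inj.1 h1).symm
    refine M.mfderiv_toForm_eq_zero_iff.2 ?_
    have h3 := M.nullMotion_eq ⟨f, z⟩
    have h4 : spatialPart (M.nullMotion ⟨f, z⟩) = 0 := h2
    rw [hz, h4, zero_smul, add_zero] at h3
    rw [h3]
    ext i; fin_cases i <;> simp [spatialVector]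

/-- The plane at `f · p`, for `p` of scale one, in terms of tangent vectors at `f`. -/
theorem mem_planeAt_act {f : F} {p : parabolicGroup} (hp : parabolicScale p = 1)
    {V : TangentBundle formModel (FormBundle S)} :
    (∃ w ∈ (M.planeAt (M.act f p)).2, V = ⟨(M.planeAt (M.act f p)).1, w⟩) ↔
      ∃ z : TangentSpace (𝓡 10) f,
        (((p⁻¹ : GL (Fin 5) ℝ) : Mat5) *ᵥ M.nullMotion ⟨f, z⟩) 4 = 0 ∧
        tangentMap (𝓡 10) formModel M.toForm ⟨f, z⟩ = V := by
  constructor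
  · rintro ⟨w, hw, rfl⟩
    obtain ⟨z', hz', rfl⟩ := M.mem_planeAt.1 hw
    obtain ⟨z, hz, -⟩ := M.exists_translate f p ⟨M.act f p, z'⟩ rfl
    refine ⟨z, ?_, ?_⟩
    · rw [← hz, nullMotion_translate, hp, one_smul] at hz'
      exact hz'
    · rw [← M.tangentMap_toForm_translate hp, hz]
      rfl
  · rintro ⟨z, hz, rfl⟩
    refine ⟨mfderiv (𝓡 10) formModel M.toForm (M.act f p)
      (mfderiv (𝓡 10) (𝓡 10) (fun q => M.act q p) f z), M.mem_planeAt.2 ⟨_, ?_, rfl⟩, ?_⟩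
    · have h := M.nullMotion_translate f p z
      rw [hp, one_smul] at h
      exact (congrFun h 4).trans hz
    · rw [← M.tangentMap_toForm_translate hp]
      rfl

theorem parabolicScale_inclusion (k : rotationGroup) :
    parabolicScale (Subgroup.inclusion rotationGroup_le_parabolicGroup k) = 1 :=
  parabolicScale_eq_of (by rw [one_smul]; exact (coe_inclusion_mulVec k).1)

/-- The plane depends on the `K`-orbit only, as `K` fixes `x - u` and maps spatial vectors to
spatial vectors. -/
theorem planeAt_actK (f : F) (k : rotationGroup) : M.planeAt (M.actK f k) = M.planeAt f := by
  refine plane_eq_of_forall_mem (M.toForm_act_of_scale (parabolicScale_inclusion k) f)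
    (M.finrank_planeAt _) (M.finrank_planeAt _) fun w hw => ?_
  obtain ⟨z, hz, he⟩ := (M.mem_planeAt_act (parabolicScale_inclusion k)).1 ⟨w, hw, rfl⟩
  refine ⟨mfderiv (𝓡 10) formModel M.toForm f z, M.mem_planeAt.2 ⟨z, ?_, rfl⟩, he.symm⟩
  have h1 : (((Subgroup.inclusion rotationGroup_le_parabolicGroup k : parabolicGroup)⁻¹ :
      GL (Fin 5) ℝ) : Mat5) = (((k⁻¹ : rotationGroup) : GL (Fin 5) ℝ) : Mat5) := rfl
  have h2 := (coe_inclusion_mulVec k⁻¹).1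
  change (((k⁻¹ : rotationGroup) : GL (Fin 5) ℝ) : Mat5) *ᵥ pastVector = pastVector at h2
  rw [h1, M.nullMotion_eq, Matrix.mulVec_add, Matrix.mulVec_smul, h2,
    rotation_mulVec_spatialVector, spatialVector_add_smul_four] at hz
  exact hz

theorem scaleForm_toForm_inj {f : F} {c : ℝ} (h : scaleForm c (M.toForm f) = M.toForm f) :
    c = 1 := by
  obtain ⟨U, μ, -, hU, -, hμ, hpos⟩ := M.exists_homogeneous_function (M.proj f)
  have h1 := hμ c (M.toForm f)
  rw [h] at h1
  have h2 := hpos f hU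
  have h3 : (c - 1) * μ (M.toForm f) = 0 := by linarith
  rcases mul_eq_zero.1 h3 with h | h
  · linarith
  · exact absurd h h2.ne'

theorem parabolicScale_slice_zero (b : Fin 3 → ℝ) : parabolicScale (parabolicSlice (0, b)) = 1 := by
  rw [parabolicScale_parabolicSlice]; simp

/-- Two points of `F` define the same plane only if they lie in one orbit of `K`. -/
theorem exists_actK_of_planeAt_eq {f f' : F} (h : M.planeAt f = M.planeAt f') :
    ∃ k : rotationGroup, f' = M.actK f k := by
  have hm : M.toForm f = M.toForm f' := congrArg Sigma.fst h
  have hproj : M.proj f = M.proj f' := by rw [← M.toForm_fst, hm, M.toForm_fst]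
  obtain ⟨p, rfl⟩ := M.exists_act_eq hproj
  have hp : parabolicScale p = 1 := by
    rw [M.toForm_act] at hm
    have h1 := M.scaleForm_toForm_inj hm.symm
    have h2 := parabolicScale_pos p
    nlinarith
  set c := parabolicCoord (entries p) with hc
  have hc1 : c.1 = 0 := by
    have : c.1 = -Real.log (parabolicScale p) := rfl
    rw [this, hp]; simp
  let k : rotationGroup := ⟨_, parabolicSlice_inv_mul_mem p⟩
  -- As `p` has scale one, it is the product of a null rotation and a rotation.
  have hpk : p =
      parabolicSlice (0, c.2) * Subgroup.inclusion rotationGroup_le_parabolicGroup k := by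
    have h1 : ((0 : ℝ), c.2) = c := Prod.ext hc1.symm rfl
    rw [h1]
    apply Subtype.ext
    change (p : GL (Fin 5) ℝ) = (parabolicSlice c : GL (Fin 5) ℝ) *
      ((parabolicSlice c : GL (Fin 5) ℝ)⁻¹ * p)
    rw [mul_inv_cancel_left]
  have hplane : M.planeAt (M.act f (parabolicSlice (0, c.2))) = M.planeAt f := by
    rw [h, hpk, M.act_mul]
    exact (M.planeAt_actK _ k).symm
  -- The image of a vector `z` at `f` with `A(z) (x - u) = b` lies in the plane of `f`, and it lies in
  -- the plane of `f · n(b)` only if `⟨b, b⟩ = 0`.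
  have hb : c.2 = 0 := by
    obtain ⟨z, hz⟩ := M.exists_conn_eq f (pastTranslation_mem ((-2 : ℝ)⁻¹ • c.2))
    have hnm : M.nullMotion ⟨f, z⟩ = spatialVector c.2 := by
      rw [M.nullMotion_of_conn_eq hz, smul_smul, mul_inv_cancel₀ (by norm_num), one_smul]
    have hmem : ∃ w ∈ (M.planeAt f).2, (tangentMap (𝓡 10) formModel M.toForm ⟨f, z⟩) =
        (⟨(M.planeAt f).1, w⟩ : TangentBundle formModel (FormBundle S)) :=
      ⟨_, M.mem_planeAt.2 ⟨z, by rw [hnm]; rfl, rfl⟩, rfl⟩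
    rw [← hplane] at hmem
    obtain ⟨z', hz', he⟩ := (M.mem_planeAt_act (parabolicScale_slice_zero c.2)).1 hmem
    have h1 := M.mfderiv_toForm_eq_of_nullMotion.1 (TotalSpace.mk_inj.1 he)
    rw [M.slice_inv_mulVec_nullMotion, h1, hnm, spatialPart_spatialVector] at hz'
    have h2 : spatialVector c.2 4 = 0 := rfl
    rw [h2, add_zero] at hz'
    exact dotProduct_self_eq_zero.1 hz'
  refine ⟨k, ?_⟩
  rw [actK]
  congr 1
  have h1 : parabolicSlice (0, (0 : Fin 3 → ℝ)) = 1 := by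
    apply Subtype.ext; apply Units.ext
    rw [coe_parabolicSlice, dilation_zero, Matrix.mul_one]
    ext i j
    fin_cases i <;> fin_cases j <;> simp [nullRotation]
  rw [hb, h1, one_mul] at hpk
  exact hpk

end CartanGeometry

/-! ### Reconstruction of the orbit from a transverse plane -/

/-- The parameter `b` of the null rotation for which the span of three vectors
`ξ_i + c_i (x - u)` is the image of the spatial vectors: the solution of `⟨b, ξ_i⟩ = -c_i` by
Cramer's rule. -/
noncomputable def planeCoord (y : Fin 3 → Fin 5 → ℝ) : Fin 3 → ℝ :=
  -((Matrix.of fun i => spatialPart (y i)).det)⁻¹ •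
    (Matrix.of fun i => spatialPart (y i)).cramer fun i => y i 4

theorem planeCoord_dotProduct {y : Fin 3 → Fin 5 → ℝ}
    (h : (Matrix.of fun i => spatialPart (y i)).det ≠ 0) (i : Fin 3) :
    planeCoord y ⬝ᵥ spatialPart (y i) + y i 4 = 0 := by
  have h1 := congrFun ((Matrix.of fun i => spatialPart (y i)).mulVec_cramer fun i => y i 4) i
  have h2 : spatialPart (y i) ⬝ᵥ ((Matrix.of fun i => spatialPart (y i)).cramer fun i => y i 4) =
      (Matrix.of fun i => spatialPart (y i)).det * y i 4 := h1
  rw [dotProduct_comm, planeCoord, dotProduct_smul, h2, smul_eq_mul]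
  field_simp
  ring

theorem contDiffAt_planeCoord {y : Fin 3 → Fin 5 → ℝ}
    (h : (Matrix.of fun i => spatialPart (y i)).det ≠ 0) : ContDiffAt ℝ ∞ planeCoord y := by
  have hij : ∀ i j, ContDiff ℝ ∞ fun y : Fin 3 → Fin 5 → ℝ => y i j := by
    intro i j; fun_prop
  have hdet : ContDiff ℝ ∞ fun y : Fin 3 → Fin 5 → ℝ =>
      (Matrix.of fun i => spatialPart (y i)).det := by
    simp only [Matrix.det_fin_three, Matrix.of_apply, spatialPart]
    simp
    fun_prop
  refine ContDiffAt.smul ((hdet.contDiffAt.inv h).neg) (ContDiff.contDiffAt ?_)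
  refine contDiff_pi.2 fun k => ?_
  simp only [Matrix.cramer_apply, Matrix.det_fin_three, Matrix.updateCol_apply, Matrix.of_apply,
    spatialPart]
  fin_cases k <;> simp <;> fun_prop

theorem Submodule.exists_eq_span_range_of_finrank_eq {V : Type*} [AddCommGroup V] [Module ℝ V]
    (W : Submodule ℝ V) {n : ℕ} [NeZero n] (h : Module.finrank ℝ W = n) :
    ∃ w : Fin n → V, (∀ i, w i ∈ W) ∧ W = Submodule.span ℝ (Set.range w) := by
  have hfin : Module.Finite ℝ W :=
    Module.finite_of_finrank_pos (by rw [h]; exact Nat.pos_of_ne_zero (NeZero.ne n))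
  let B := Module.finBasisOfFinrankEq ℝ W h
  refine ⟨fun i => B i, fun i => (B i).2, ?_⟩
  have h1 := congrArg (Submodule.map W.subtype) B.span_eq
  rw [Submodule.map_span, ← Set.range_comp, Submodule.map_top, Submodule.range_subtype] at h1
  exact h1.symm

namespace CartanGeometry

variable {F : Type*} [TopologicalSpace F] [ChartedSpace (E 10) F] [IsManifold (𝓡 10) ∞ F]
  {S : Type*} [TopologicalSpace S] [ChartedSpace (E 3) S] [IsManifold (𝓡 3) ∞ S]
  (M : MoebiusGeometry F S)

/-- The map `π' : F → T` has smooth local sections, which extend smoothly to open subsets of the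
bundle of bilinear forms. -/
theorem exists_lift {m₀ : FormBundle S} (hm₀ : m₀ ∈ tautologicalBundle M.inducedConformal) :
    ∃ (O : Set (FormBundle S)) (σ : FormBundle S → F), IsOpen O ∧ m₀ ∈ O ∧
      ContMDiffOn formModel (𝓡 10) ∞ σ O ∧
      ∀ m ∈ O, m ∈ tautologicalBundle M.inducedConformal → M.toForm (σ m) = m := by
  obtain ⟨U, hU, hm₀U, s, hs, hps, -⟩ := M.locally_trivial m₀.1
  obtain ⟨U', μ, hU', hm₀U', hμ, hμc, hμpos⟩ := M.exists_homogeneous_function m₀.1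
  have hcont : Continuous (TotalSpace.proj : FormBundle S → S) :=
    FiberBundle.continuous_proj _ (FormAt S)
  have hO' : IsOpen ((TotalSpace.proj : FormBundle S → S) ⁻¹' U') := hU'.preimage hcont
  have hO : IsOpen ((TotalSpace.proj : FormBundle S → S) ⁻¹' U' ∩ μ ⁻¹' Set.Ioi 0) :=
    hμ.continuousOn.isOpen_inter_preimage hO' isOpen_Ioi
  have hpos : ∀ m : FormBundle S, m.1 ∈ U' → m ∈ tautologicalBundle M.inducedConformal →
      0 < μ m := by
    intro m hm hmT
    obtain ⟨f, rfl⟩ := M.mem_tautologicalBundle.1 hmT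
    exact hμpos f (by rwa [M.toForm_fst] at hm)
  have hspos : ∀ m : FormBundle S, m.1 ∈ U → m.1 ∈ U' → 0 < μ (M.toForm (s m.1)) := by
    intro m hm hm'
    exact hμpos _ (by rwa [hps _ hm])
  -- The boost parameter that corrects the scale of the form at the section `s`.
  let τ : FormBundle S → ℝ := fun m => -(Real.log (μ m / μ (M.toForm (s m.1))) / 2)
  refine ⟨(TotalSpace.proj ⁻¹' U) ∩ (TotalSpace.proj ⁻¹' U' ∩ μ ⁻¹' Set.Ioi 0),
    fun m => M.act (s m.1) (parabolicSlice (τ m, 0)), (hU.preimage hcont).inter hO,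
    ⟨hm₀U, hm₀U', hpos _ hm₀U' hm₀⟩, ?_, ?_⟩
  · rintro m ⟨hmU, hmU', hmpos⟩
    refine ContMDiffAt.contMDiffWithinAt ?_
    have h1 : ContMDiffAt formModel (𝓡 3) ∞ (fun m : FormBundle S => m.1) m :=
      (contMDiff_proj (FormAt S)).contMDiffAt
    have h2 : ContMDiffAt formModel (𝓡 10) ∞ (fun m : FormBundle S => s m.1) m :=
      (hs.contMDiffAt (hU.mem_nhds hmU)).comp m h1
    have h3 : ContMDiffAt formModel 𝓘(ℝ, ℝ) ∞ μ m := hμ.contMDiffAt (hO'.mem_nhds hmU')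
    have h4 : ContMDiffAt formModel 𝓘(ℝ, ℝ) ∞ (fun m => μ (M.toForm (s m.1))) m := by
      have h5 : ContMDiffAt formModel 𝓘(ℝ, ℝ) ∞ μ (M.toForm (s m.1)) := by
        refine hμ.contMDiffAt (hO'.mem_nhds ?_)
        change (M.toForm (s m.1)).1 ∈ U'
        rwa [M.toForm_fst, hps _ hmU]
      exact h5.comp m (M.contMDiff_toForm.contMDiffAt.comp m h2)
    have h6 : ContMDiffAt formModel 𝓘(ℝ, ℝ) ∞ τ m := by
      have h7 : ContDiffAt ℝ ∞ (fun q : ℝ × ℝ => -(Real.log (q.1 / q.2) / 2))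
          (μ m, μ (M.toForm (s m.1))) := by
        have hn : μ (M.toForm (s m.1)) ≠ 0 := (hspos m hmU hmU').ne'
        have hn' : μ m / μ (M.toForm (s m.1)) ≠ 0 := div_ne_zero (ne_of_gt hmpos) hn
        exact (((contDiffAt_fst.div contDiffAt_snd hn).log hn').div_const _).neg
      exact ContMDiffAt.comp m (g := fun q : ℝ × ℝ => -(Real.log (q.1 / q.2) / 2)) h7.contMDiffAt
        (h3.prodMk_space h4)
    refine M.contMDiffAt_act h2 ?_
    exact contDiff_entries_parabolicSlice.contMDiff.contMDiffAt.comp m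
      (h6.prodMk_space contMDiffAt_const)
  · rintro m ⟨hmU, hmU', hmpos⟩ hmT
    obtain ⟨f, rfl⟩ := M.mem_tautologicalBundle.1 hmT
    have hproj : M.proj (s (M.toForm f).1) = M.proj f := by rw [hps _ hmU, M.toForm_fst]
    obtain ⟨p, hp⟩ := M.exists_act_eq hproj
    have h1 := hspos _ hmU hmU'
    have h2 : M.toForm f = scaleForm (parabolicScale p ^ 2) (M.toForm (s (M.toForm f).1)) := by
      rw [← M.toForm_act, hp]
    have h3 : μ (M.toForm f) = parabolicScale p ^ 2 * μ (M.toForm (s (M.toForm f).1)) := by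
      rw [← hμc, ← h2]
    have h4 : μ (M.toForm f) / μ (M.toForm (s (M.toForm f).1)) = parabolicScale p ^ 2 := by
      rw [h3]; field_simp
    have h5 : τ (M.toForm f) = -Real.log (parabolicScale p) := by
      change -(Real.log (μ (M.toForm f) / μ (M.toForm (s (M.toForm f).1))) / 2) = _
      rw [h4, Real.log_pow]
      push_cast
      ring
    rw [M.toForm_act, parabolicScale_parabolicSlice]
    change scaleForm (Real.exp (-τ (M.toForm f)) ^ 2) _ = _
    rw [h5, neg_neg, Real.exp_log (parabolicScale_pos p)]
    exact h2.symm

/-- A vector tangent to the tautological bundle is recovered from its image under a lift. -/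
theorem tangentMap_toForm_lift {O : Set (FormBundle S)} {σ : FormBundle S → F} (hO : IsOpen O)
    (hσ : ContMDiffOn formModel (𝓡 10) ∞ σ O)
    (h : ∀ m ∈ O, m ∈ tautologicalBundle M.inducedConformal → M.toForm (σ m) = m)
    {m : FormBundle S} (hm : m ∈ O) {w : TangentSpace formModel m}
    (hw : w ∈ tautologicalTangent M.inducedConformal m) :
    tangentMap (𝓡 10) formModel M.toForm (tangentMap formModel (𝓡 10) σ ⟨m, w⟩) = ⟨m, w⟩ := by
  obtain ⟨γ, hγ, hγT, hγw⟩ := hw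
  have hγ0 : γ 0 = m := congrArg TotalSpace.proj hγw
  have hOγ : γ 0 ∈ O := by rwa [hγ0]
  have hσd : MDifferentiableAt formModel (𝓡 10) σ (γ 0) :=
    (hσ.contMDiffAt (hO.mem_nhds hOγ)).mdifferentiableAt (by simp)
  have hγd : MDifferentiableAt 𝓘(ℝ, ℝ) formModel γ 0 := hγ.mdifferentiable (by simp) (0 : ℝ)
  have h1 := tangentMap_comp_at (I := 𝓘(ℝ, ℝ)) (I' := formModel) (I'' := 𝓡 10)
    (⟨0, (1 : ℝ)⟩ : TangentBundle 𝓘(ℝ, ℝ) ℝ) hσd hγd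
  have h2 := tangentMap_comp_at (I := 𝓘(ℝ, ℝ)) (I' := 𝓡 10) (I'' := formModel)
    (⟨0, (1 : ℝ)⟩ : TangentBundle 𝓘(ℝ, ℝ) ℝ) (M.mdifferentiable_toForm ((σ ∘ γ) 0))
    (hσd.comp (0 : ℝ) hγd)
  rw [← hγw, ← h1, ← h2]
  have h3 : M.toForm ∘ σ ∘ γ =ᶠ[𝓝 0] γ := by
    filter_upwards [hγ.continuous.continuousAt.preimage_mem_nhds (hO.mem_nhds hOγ)] with t ht
    exact h _ ht (hγT t)
  simp only [tangentMap]
  rw [h3.mfderiv_eq]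
  exact TotalSpace.ext h3.eq_of_nhds (by rfl)

/-- A transverse plane `W` at `π' f₀` is the plane of the point `f₀ · n(b)`, where `b` is computed
from lifts to `T_{f₀} F` of a basis of `W`. -/
theorem planeAt_act_planeCoord
    {W : Σ m : FormBundle S, Submodule ℝ (TangentSpace (formModel) m)}
    (hW : W ∈ transversePlanes M.inducedConformal) {f₀ : F} (hf₀ : M.toForm f₀ = W.1)
    {w : Fin 3 → TangentSpace formModel W.1}
    (hw : W.2 = Submodule.span ℝ (Set.range w)) {Z : Fin 3 → TangentBundle (𝓡 10) F}
    (hZ : ∀ i, (Z i).proj = f₀)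
    (hZw : ∀ i, tangentMap (𝓡 10) formModel M.toForm (Z i) = ⟨W.1, w i⟩) :
    (Matrix.of fun i => spatialPart (M.nullMotion (Z i))).det ≠ 0 ∧
      M.planeAt (M.act f₀ (parabolicSlice (0, planeCoord fun i => M.nullMotion (Z i)))) = W := by
  obtain ⟨m, W⟩ := W
  obtain rfl : M.toForm f₀ = m := hf₀
  simp only at w hw hZw
  have hex : ∀ i, ∃ z : TangentSpace (𝓡 10) f₀, Z i = ⟨f₀, z⟩ := by
    intro i
    have h1 := hZ i
    generalize Z i = V at *
    obtain ⟨f, z⟩ := V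
    obtain rfl : f = f₀ := h1
    exact ⟨z, rfl⟩
  choose z hz using hex
  obtain rfl : Z = fun i => ⟨f₀, z i⟩ := funext hz
  have hzw : ∀ i, mfderiv (𝓡 10) formModel M.toForm f₀ (z i) = w i := fun i =>
    TotalSpace.mk_inj.1 (hZw i)
  obtain ⟨-, -, hrank, htrans⟩ := hW
  simp only at hrank htrans
  have hli : LinearIndependent ℝ w := by
    rw [linearIndependent_iff_card_eq_finrank_span, Set.finrank, ← hw, hrank, Fintype.card_fin]
  -- A linear relation between the spatial parts is a vertical vector in the plane.
  have hdet : (Matrix.of fun i => spatialPart (M.nullMotion ⟨f₀, z i⟩)).det ≠ 0 := by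
    intro h0
    obtain ⟨a, ha, hav⟩ := Matrix.exists_vecMul_eq_zero_iff.2 h0
    apply ha
    have h1 : M.solder f₀ (∑ i, a i • z i) = 0 := by
      rw [map_sum, ← hav]
      ext j
      simp [Matrix.vecMul, dotProduct, solder_apply, nullMotion]
    have h2 := M.mfderiv_proj_eq_zero_iff.2 h1
    have h3 : mfderiv (𝓡 10) formModel M.toForm f₀ (∑ i, a i • z i) = ∑ i, a i • w i := by
      rw [← Finset.sum_congr rfl fun i _ => congrArg (a i • ·) (hzw i)]
      exact (map_sum (mfderiv (𝓡 10) formModel M.toForm f₀).toLinearMap _ _).trans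
        (Finset.sum_congr rfl fun i _ => map_smul
          (mfderiv (𝓡 10) formModel M.toForm f₀).toLinearMap _ _)
    have h4 : (⟨(M.toForm f₀).1, mfderiv formModel (𝓡 3) (TotalSpace.proj : FormBundle S → S)
        (M.toForm f₀) (mfderiv (𝓡 10) formModel M.toForm f₀ (∑ i, a i • z i))⟩ :
        TangentBundle (𝓡 3) S) = ⟨M.proj f₀, mfderiv (𝓡 10) (𝓡 3) M.proj f₀ (∑ i, a i • z i)⟩ :=
      M.tangentMap_formBundle_proj_toForm ⟨f₀, ∑ i, a i • z i⟩
    rw [h2, h3, ← M.toForm_fst] at h4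
    have h5 := htrans (∑ i, a i • w i) (hw ▸ Submodule.sum_mem _ fun i _ =>
      Submodule.smul_mem _ _ (Submodule.subset_span ⟨i, rfl⟩)) (TotalSpace.mk_inj.1 h4)
    funext i
    exact Fintype.linearIndependent_iff.1 hli a h5 i
  refine ⟨hdet, ?_⟩
  set b := planeCoord fun i => M.nullMotion ⟨f₀, z i⟩ with hb
  symm
  refine plane_eq_of_forall_mem ?_ hrank (M.finrank_planeAt _) ?_
  · exact (M.toForm_act_of_scale (parabolicScale_slice_zero b) f₀).symm
  · intro v hv
    simp only at hv
    rw [hw] at hv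
    obtain ⟨a, rfl⟩ := (Submodule.mem_span_range_iff_exists_fun ℝ).1 hv
    refine (M.mem_planeAt_act (parabolicScale_slice_zero b)).2 ⟨∑ i, a i • z i, ?_, ?_⟩
    · rw [M.slice_inv_mulVec_nullMotion]
      have h1 : M.nullMotion ⟨f₀, ∑ i, a i • z i⟩ = ∑ i, a i • M.nullMotion ⟨f₀, z i⟩ := by
        simp only [nullMotion]
        rw [map_sum, Submodule.coe_sum, Matrix.sum_mulVec]
        refine Finset.sum_congr rfl fun i _ => ?_
        rw [map_smul, Submodule.coe_smul, Matrix.smul_mulVec]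
      have h2 : ∀ i, b ⬝ᵥ spatialPart (M.nullMotion ⟨f₀, z i⟩) + M.nullMotion ⟨f₀, z i⟩ 4 = 0 :=
        fun i => planeCoord_dotProduct hdet i
      rw [h1]
      have e0 := h2 0
      have e1 := h2 1
      have e2 := h2 2
      simp only [Fin.sum_univ_three, spatialPart_add, spatialPart_smul, dotProduct_add,
        dotProduct_smul, Pi.add_apply, Pi.smul_apply, smul_eq_mul]
      linear_combination a 0 * e0 + a 1 * e1 + a 2 * e2
    · refine congrArg (TotalSpace.mk (M.toForm f₀)) ?_
      change (mfderiv (𝓡 10) formModel M.toForm f₀).toLinearMap _ = _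
      rw [map_sum]
      exact Finset.sum_congr rfl fun i _ => (map_smul
        (mfderiv (𝓡 10) formModel M.toForm f₀).toLinearMap _ _).trans
          (congrArg (a i • ·) (hzw i))

/-- Every transverse plane is the plane of a point of `F`. -/
theorem exists_planeAt_eq {W : Σ m : FormBundle S, Submodule ℝ (TangentSpace (formModel) m)}
    (hW : W ∈ transversePlanes M.inducedConformal) : ∃ f, M.planeAt f = W := by
  obtain ⟨O, σ, hO, hmO, hσ, hlift⟩ := M.exists_lift hW.1
  obtain ⟨w, hwW, hspan⟩ := W.2.exists_eq_span_range_of_finrank_eq hW.2.2.1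
  exact ⟨_, (M.planeAt_act_planeCoord hW (hlift _ hmO hW.1) hspan
    (Z := fun i => tangentMap formModel (𝓡 10) σ ⟨W.1, w i⟩) (fun _ => rfl)
    fun i => M.tangentMap_toForm_lift hO hσ hlift hmO (hW.2.1 (hwW i))).2⟩

end CartanGeometry

/-! ### The orbit space -/

namespace CartanGeometry

variable {F : Type*} [TopologicalSpace F] [ChartedSpace (E 10) F] [IsManifold (𝓡 10) ∞ F]
  {S : Type*} [TopologicalSpace S] [ChartedSpace (E 3) S]
  (M : MoebiusGeometry F S)

theorem toOrbit_eq_iff {f f' : F} : M.toOrbit f = M.toOrbit f' ↔ ∃ k, f' = M.actK f k :=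
  Quotient.eq (r := M.orbitSetoid)

theorem contMDiff_actK_right (k : rotationGroup) :
    ContMDiff (𝓡 10) (𝓡 10) ∞ (fun f => M.actK f k) :=
  M.contMDiff_act_right _

theorem isOpenQuotientMap_toOrbit : IsOpenQuotientMap M.toOrbit where
  surjective := Quotient.mk_surjective
  continuous := continuous_quotient_mk'
  isOpenMap := by
    intro V hV
    have h : M.toOrbit ⁻¹' (M.toOrbit '' V) = ⋃ k, (fun f => M.actK f k) ⁻¹' V := by
      ext f
      simp only [Set.mem_preimage, Set.mem_image, Set.mem_iUnion]
      constructor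
      · rintro ⟨f', hf', he⟩
        obtain ⟨k, rfl⟩ := M.toOrbit_eq_iff.1 he.symm
        exact ⟨k, hf'⟩
      · rintro ⟨k, hk⟩
        exact ⟨_, hk, (M.toOrbit_eq_iff.2 ⟨k, rfl⟩).symm⟩
    refine isOpen_coinduced.2 ?_
    change IsOpen (M.toOrbit ⁻¹' (M.toOrbit '' V))
    rw [h]
    exact isOpen_iUnion fun k => hV.preimage (M.contMDiff_actK_right k).continuous

theorem proj_actK (f : F) (k : rotationGroup) : M.proj (M.actK f k) = M.proj f := M.proj_act _ _

/-- In a trivialization `F|_U ≅ U × P`, an element of `P` differs from the representative of its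
coset by a rotation. -/
theorem exists_actK_slice {s : S → F} {τ : F → parabolicGroup} {f : F}
    (h : M.act (s (M.proj f)) (τ f) = f) :
    ∃ k : rotationGroup, (k : GL (Fin 5) ℝ) =
        (parabolicSlice (parabolicCoord (entries (τ f))) : GL (Fin 5) ℝ)⁻¹ * τ f ∧
      f = M.actK (M.act (s (M.proj f)) (parabolicSlice (parabolicCoord (entries (τ f))))) k := by
  refine ⟨⟨_, parabolicSlice_inv_mul_mem (τ f)⟩, rfl, ?_⟩
  rw [actK, ← M.act_mul]
  conv_lhs => rw [← h]
  congr 1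
  apply Subtype.ext
  exact (mul_inv_cancel_left (parabolicSlice (parabolicCoord (entries (τ f))) :
    GL (Fin 5) ℝ) (τ f : GL (Fin 5) ℝ)).symm

/-- `ℝ⁷` as the product of the coordinates on `S` and on `P/K`. -/
noncomputable def sliceEquiv : E 7 ≃L[ℝ] E 3 × (ℝ × (Fin 3 → ℝ)) :=
  ContinuousLinearEquiv.ofFinrankEq (by simp)

/-- Every point of `F` has a slice for the action of `K`: the product of a chart of `S` and of the
global slice of `P → P/K`. -/
theorem exists_localSlice [IsManifold (𝓡 3) ∞ S] (f₀ : F) :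
    ∃ s : LocalSlice 10 7 M.toOrbit, s.V ∈ 𝓝 f₀ ∧
      ∀ f, M.proj f = M.proj f₀ → f ∈ s.V := by
  obtain ⟨U, hU, hf₀, s, hs, hps, τ, hτ, hsτ⟩ := M.locally_trivial (M.proj f₀)
  set φ := extChartAt (𝓡 3) (M.proj f₀) with hφ
  have hφsource : IsOpen φ.source := isOpen_extChartAt_source _
  have hφtarget : IsOpen φ.target := isOpen_extChartAt_target _
  have hφsmooth : ContMDiffOn (𝓡 3) 𝓘(ℝ, E 3) ∞ φ φ.source := by
    have := contMDiffOn_extChartAt (I := 𝓡 3) (n := ∞) (x := M.proj f₀)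
    rwa [← extChartAt_source (𝓡 3)] at this
  have hφsymm : ContMDiffOn 𝓘(ℝ, E 3) (𝓡 3) ∞ φ.symm φ.target := contMDiffOn_extChartAt_symm _
  have hτ' : ContMDiffOn (𝓡 10) 𝓘(ℝ, ℝ × (Fin 3 → ℝ)) ∞
      (fun f => parabolicCoord (entries (τ f))) (M.proj ⁻¹' U) := fun f hf =>
    (contDiffAt_parabolicCoord (τ f)).contMDiffAt.comp_contMDiffWithinAt f (hτ f hf)
  have hτk : ∀ f, M.proj f ∈ U → ∀ k : rotationGroup, τ (M.actK f k) =
      τ f * Subgroup.inclusion rotationGroup_le_parabolicGroup k := by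
    intro f hf k
    have hf' : M.proj (M.actK f k) ∈ U := by rwa [M.proj_actK]
    have h1 := hsτ _ hf'
    rw [M.proj_actK] at h1
    refine M.act_injective (h1.trans ?_)
    rw [M.act_mul, hsτ f hf]
    rfl
  have hτs : ∀ y ∈ U, ∀ c, τ (M.act (s y) (parabolicSlice c)) = parabolicSlice c := by
    intro y hy c
    have hy' : M.proj (M.act (s y) (parabolicSlice c)) = y := by rw [M.proj_act, hps y hy]
    have h1 := hsτ (M.act (s y) (parabolicSlice c)) (by rw [Set.mem_preimage, hy']; exact hy)
    rw [hy'] at h1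
    exact M.act_injective h1
  refine ⟨{ V := M.proj ⁻¹' (U ∩ φ.source)
            coord := fun f => sliceEquiv.symm (φ (M.proj f), parabolicCoord (entries (τ f)))
            target := {w | (sliceEquiv w).1 ∈ φ.target ∩ φ.symm ⁻¹' U}
            slice := fun w => M.act (s (φ.symm (sliceEquiv w).1)) (parabolicSlice (sliceEquiv w).2)
            isOpen_V := (hU.inter hφsource).preimage M.proj_smooth.continuous
            isOpen_target := (hφsymm.continuousOn.isOpen_inter_preimage hφtarget hU).preimage
              (continuous_fst.comp sliceEquiv.continuous)
            coord_smooth := ?_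
            slice_smooth := ?_
            saturated := ?_
            coord_eq := ?_
            coord_mem := ?_
            slice_mem := ?_
            coord_slice := ?_
            apply_slice_coord := ?_ }, ?_, ?_⟩
  · have h1 : ContMDiffOn (𝓡 10) 𝓘(ℝ, E 3) ∞ (φ ∘ M.proj) (M.proj ⁻¹' (U ∩ φ.source)) :=
      hφsmooth.comp M.proj_smooth.contMDiffOn fun f hf => hf.2
    have h2 := h1.prodMk_space (hτ'.mono fun f hf => hf.1)
    exact sliceEquiv.symm.contDiff.contMDiff.comp_contMDiffOn h2
  · rintro w ⟨hw1, hw2⟩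
    refine ContMDiffAt.contMDiffWithinAt ?_
    have h0 : ContMDiff (𝓡 7) 𝓘(ℝ, E 3 × (ℝ × (Fin 3 → ℝ))) ∞ (sliceEquiv : E 7 → _) :=
      sliceEquiv.contDiff.contMDiff
    have h1 : ContMDiff (𝓡 7) 𝓘(ℝ, E 3) ∞ (fun w : E 7 => (sliceEquiv w).1) :=
      contDiff_fst.contMDiff.comp h0
    have h2 : ContMDiff (𝓡 7) 𝓘(ℝ, ℝ × (Fin 3 → ℝ)) ∞ (fun w : E 7 => (sliceEquiv w).2) :=
      contDiff_snd.contMDiff.comp h0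
    have h3 : ContMDiffAt (𝓡 7) (𝓡 3) ∞ (fun w : E 7 => φ.symm (sliceEquiv w).1) w :=
      (hφsymm.contMDiffAt (hφtarget.mem_nhds hw1)).comp w h1.contMDiffAt
    refine M.contMDiffAt_act ((hs.contMDiffAt (hU.mem_nhds hw2)).comp w h3) ?_
    exact contDiff_entries_parabolicSlice.contMDiff.contMDiffAt.comp w h2.contMDiffAt
  · intro f hf f' he
    obtain ⟨k, rfl⟩ := M.toOrbit_eq_iff.1 he
    rw [Set.mem_preimage, M.proj_actK]
    exact hf
  · intro f hf f' he
    obtain ⟨k, rfl⟩ := M.toOrbit_eq_iff.1 he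
    rw [M.proj_actK, hτk f hf.1, parabolicCoord_entries_mul_rotation]
  · intro f hf
    simp only [Set.mem_ofPred_eq, ContinuousLinearEquiv.apply_symm_apply]
    exact ⟨φ.map_source hf.2, by rw [Set.mem_preimage, φ.left_inv hf.2]; exact hf.1⟩
  · rintro w ⟨hw1, hw2⟩
    rw [Set.mem_preimage, M.proj_act, hps _ hw2]
    exact ⟨hw2, φ.map_target hw1⟩
  · rintro w ⟨hw1, hw2⟩
    rw [M.proj_act, hps _ hw2, φ.right_inv hw1, hτs _ hw2, parabolicCoord_entries_slice]
    exact sliceEquiv.symm_apply_apply w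
  · intro f hf
    simp only [ContinuousLinearEquiv.apply_symm_apply]
    rw [φ.left_inv hf.2, M.toOrbit_eq_iff]
    obtain ⟨k, -, hk⟩ := M.exists_actK_slice (hsτ f hf.1)
    exact ⟨k, hk⟩
  · exact ((hU.inter hφsource).preimage M.proj_smooth.continuous).mem_nhds
      ⟨hf₀, mem_extChartAt_source _⟩
  · intro f hf
    rw [Set.mem_preimage, hf]
    exact ⟨hf₀, mem_extChartAt_source _⟩

/-- Points over distinct points of `S` are separated in `S`, points of one fibre in a common
slice. -/
theorem t2Space_orbitSpace [IsManifold (𝓡 3) ∞ S] [T2Space S] : T2Space M.OrbitSpace := by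
  refine ⟨fun x y hxy => ?_⟩
  obtain ⟨f, rfl⟩ := M.isOpenQuotientMap_toOrbit.surjective x
  obtain ⟨f', rfl⟩ := M.isOpenQuotientMap_toOrbit.surjective y
  by_cases h : M.proj f' = M.proj f
  · obtain ⟨s, hf, hsat⟩ := M.exists_localSlice f
    exact s.separated M.isOpenQuotientMap_toOrbit (mem_of_mem_nhds hf) (hsat f' h) hxy
  · let p : M.OrbitSpace → S := Quotient.lift M.proj (by
      rintro a b ⟨k, rfl⟩
      exact (M.proj_actK a k).symm)
    have hp : Continuous p := M.proj_smooth.continuous.quotient_lift _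
    exact separated_by_continuous hp (x := M.toOrbit f) (y := M.toOrbit f') (Ne.symm h)

theorem secondCountableTopology_orbitSpace [SecondCountableTopology F] :
    SecondCountableTopology M.OrbitSpace :=
  M.isOpenQuotientMap_toOrbit.isQuotientMap.secondCountableTopology
    M.isOpenQuotientMap_toOrbit.isOpenMap

/-- `F → F/K` is a principal `K`-bundle for every smooth structure on `F/K` such that the quotient
map is smooth and has smooth local sections. -/
def observerGeometry [ChartedSpace (E 7) M.OrbitSpace]
    (hsmooth : ContMDiff (𝓡 10) (𝓡 7) ∞ M.toOrbit) (hsec : HasLocalSections 10 7 M.toOrbit) :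
    ObserverSpaceGeometry F M.OrbitSpace where
  proj := M.toOrbit
  act := M.actK
  act_one q := by rw [actK, map_one, M.act_one]
  act_mul q a b := by rw [actK, actK, actK, map_mul, M.act_mul]
  act_free q h hq := by
    have := M.act_free q _ hq
    exact Subgroup.inclusion_injective rotationGroup_le_parabolicGroup (this.trans (map_one _).symm)
  proj_act q h := (M.toOrbit_eq_iff.2 ⟨h, rfl⟩).symm
  proj_smooth := hsmooth
  act_smooth q h := by
    obtain ⟨ψ, hψ, he⟩ := M.act_smooth q (Subgroup.inclusion rotationGroup_le_parabolicGroup h)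
    refine ⟨ψ, hψ, ?_⟩
    filter_upwards [he] with z hz h' hh'
    exact hz _ hh'
  locally_trivial x := by
    obtain ⟨f₀, rfl⟩ := M.isOpenQuotientMap_toOrbit.surjective x
    obtain ⟨U, hU, hx, s, hs, hqs⟩ := hsec (M.toOrbit f₀)
    obtain ⟨U', hU', hf₀, s', hs', hps', τ', hτ', hsτ'⟩ := M.locally_trivial (M.proj f₀)
    -- The trivialization over the points of `U` whose section lies over `U'`.
    have hopen : IsOpen (U ∩ (M.proj ∘ s) ⁻¹' U') :=
      (M.proj_smooth.continuous.comp_continuousOn hs.continuousOn).isOpen_inter_preimage hU hU'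
    have hproj : ∀ f, M.toOrbit f ∈ U → M.proj (s (M.toOrbit f)) = M.proj f := by
      intro f hf
      obtain ⟨k, hk⟩ := M.toOrbit_eq_iff.1 (hqs _ hf)
      have h := congrArg M.proj hk
      rw [M.proj_actK] at h
      exact h.symm
    have hex : ∀ f, ∃ k : rotationGroup, M.toOrbit f ∈ U ∩ (M.proj ∘ s) ⁻¹' U' →
        M.actK (s (M.toOrbit f)) k = f ∧
        (k : GL (Fin 5) ℝ) = (τ' (s (M.toOrbit f)) : GL (Fin 5) ℝ)⁻¹ * τ' f := by
      intro f
      by_cases hf : M.toOrbit f ∈ U ∩ (M.proj ∘ s) ⁻¹' U'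
      · obtain ⟨k, hk⟩ := M.toOrbit_eq_iff.1 (hqs _ hf.1)
        refine ⟨k, fun _ => ⟨hk.symm, ?_⟩⟩
        have h1 := hsτ' _ (show M.proj (s (M.toOrbit f)) ∈ U' from hf.2)
        have h2 := hsτ' f (show M.proj f ∈ U' from hproj f hf.1 ▸ hf.2)
        have h3 : τ' (s (M.toOrbit f)) * Subgroup.inclusion rotationGroup_le_parabolicGroup k =
            τ' f := by
          apply M.act_injective (q := s' (M.proj f))
          rw [M.act_mul, h2, ← hproj f hf.1, h1]
          exact hk.symm
        rw [← h3, Subgroup.coe_mul, inv_mul_cancel_left]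
        rfl
      · exact ⟨1, fun h => (hf h).elim⟩
    choose τ hτ using hex
    refine ⟨_, hopen, ⟨hx, ?_⟩, s, hs.mono Set.inter_subset_left, fun y hy => hqs y hy.1, τ, ?_,
      fun f hf => (hτ f hf).1⟩
    · rw [Set.mem_preimage, Function.comp_apply, hproj _ hx]
      exact hf₀
    · intro f hf
      have hf' : M.proj f ∈ U' := hproj f hf.1 ▸ hf.2
      have h1 : ContMDiffAt (𝓡 10) 𝓘(ℝ, MatSpace) ∞ (fun f => entries (τ' f)) f :=
        hτ'.contMDiffAt ((hU'.preimage M.proj_smooth.continuous).mem_nhds hf')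
      have h2 : ContMDiffAt (𝓡 10) (𝓡 10) ∞ (fun f => s (M.toOrbit f)) f :=
        (hs.contMDiffAt (hU.mem_nhds hf.1)).comp f hsmooth.contMDiffAt
      have h3 : ContMDiffAt (𝓡 10) 𝓘(ℝ, MatSpace) ∞ (fun f => entries (τ' (s (M.toOrbit f)))) f :=
        (hτ'.contMDiffAt ((hU'.preimage M.proj_smooth.continuous).mem_nhds hf.2)).comp f h2
      have h4 : ContDiff ℝ ∞ fun A : MatSpace × MatSpace => (fun i j => ∑ l,
          (∑ k, (∑ l, minkowski i l * A.1 k l) * minkowski k l) * A.2 l j : MatSpace) := by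
        fun_prop
      have h5 := h4.contMDiff.contMDiffAt.comp f (h3.prodMk_space h1)
      refine (h5.contMDiffWithinAt).congr_of_mem (fun f' hf' => ?_) hf
      funext i j
      have h6 := congrFun (entries_inv (τ' (s (M.toOrbit f'))).2.1) i
      simp only [Function.comp_apply]
      rw [(hτ f' hf').2]
      change (((_ : GL (Fin 5) ℝ) * _ : GL (Fin 5) ℝ) : Mat5) i j = _
      rw [Units.val_mul, Matrix.mul_apply]
      exact Finset.sum_congr rfl fun l _ => congrArg (· * entries (τ' f') l j) (congrFun h6 l)
  conn := M.conn
  conn_smooth := M.conn_smooth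
  conn_bijective := M.conn_bijective
  conn_equivariant h q v := M.conn_equivariant _ q v
  conn_vertical q γ hγ t :=
    M.conn_vertical q (fun t => Subgroup.inclusion rotationGroup_le_parabolicGroup (γ t)) hγ t

end CartanGeometry

/-! ### Vector fields that are constant for the connection -/

namespace CartanGeometry

variable {F : Type*} [TopologicalSpace F] [ChartedSpace (E 10) F] [IsManifold (𝓡 10) ∞ F]
  {S : Type*} [TopologicalSpace S] [ChartedSpace (E 3) S]
  (M : MoebiusGeometry F S)

/-- The vector field on which the connection is constantly equal to `X` is smooth: in
a trivialization of `TF` it is obtained by inverting a smooth family of matrices. -/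
theorem contMDiff_of_conn_eq {X : Mat5} {Z : F → TangentBundle (𝓡 10) F}
    (hZ : ∀ f, (Z f).proj = f) (hX : ∀ f, (M.conn (Z f).proj (Z f).2 : Mat5) = X) :
    ContMDiff (𝓡 10) (𝓡 10).tangent ∞ Z := by
  intro f₀
  set e := trivializationAt (E 10) (TangentSpace (𝓡 10)) f₀ with he
  have hf₀ : f₀ ∈ e.baseSet := FiberBundle.mem_baseSet_trivializationAt' _
  -- A linear map that is injective on `𝔤`.
  let L : TangentSpace (𝓡 10) f₀ ≃ₗ[ℝ] deSitterAlgebra :=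
    LinearEquiv.ofBijective (M.conn f₀) (M.conn_bijective f₀)
  obtain ⟨R, hR⟩ : ∃ R : Mat5 →ₗ[ℝ] E 10, ∀ Y : deSitterAlgebra, R Y = L.symm Y := by
    obtain ⟨R, hR⟩ := LinearMap.exists_extend (p := deSitterAlgebra) L.symm.toLinearMap
    exact ⟨R, fun Y => LinearMap.congr_fun hR Y⟩
  have hRinj : ∀ Y Y' : deSitterAlgebra, R Y = R Y' → Y = Y' := fun Y Y' h =>
    L.symm.injective ((hR Y).symm.trans (h.trans (hR Y')))
  let B : F → E 10 →L[ℝ] E 10 := fun f =>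
    (R ∘ₗ deSitterAlgebra.subtype ∘ₗ M.conn f ∘ₗ (e.symmL ℝ f).toLinearMap).toContinuousLinearMap
  have hB : ∀ f ∈ e.baseSet, ∀ u, B f u = R (M.conn f (e.symm f u)) := by
    intro f hf u
    change R (M.conn f (e.symmL ℝ f u)) = _
    rw [e.symmL_apply hf]
  have hBsmooth : ContMDiffAt (𝓡 10) 𝓘(ℝ, E 10 →L[ℝ] E 10) ∞ B f₀ := by
    refine contMDiffAt_clm fun u => ?_
    have h1 := contMDiffAt_trivialization_symm f₀ (I' := 𝓡 10) (w := fun _ : F => u) (b := id)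
      contMDiffAt_id contMDiffAt_const hf₀
    have h2 := M.conn_smooth.contMDiffAt.comp f₀ h1
    have h3 := (R ∘ₗ (Matrix.ofLinearEquiv ℝ : MatSpace ≃ₗ[ℝ] Mat5).toLinearMap
      ).toContinuousLinearMap.contMDiff.contMDiffAt.comp f₀ h2
    refine h3.congr_of_eventuallyEq ?_
    filter_upwards [e.open_baseSet.mem_nhds hf₀] with f hf
    exact hB f hf u
  have hBbij : ∀ f ∈ e.baseSet, Function.Bijective (B f) := by
    intro f hf
    have hinj : Function.Injective (B f) := by
      intro u u' h
      rw [hB f hf, hB f hf] at h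
      have h1 := (M.conn_bijective f).1 (hRinj _ _ h)
      rw [← e.symmL_apply (R := ℝ) hf, ← e.symmL_apply (R := ℝ) hf] at h1
      have h2 : (e.continuousLinearEquivAt ℝ f hf).symm u =
          (e.continuousLinearEquivAt ℝ f hf).symm u' := by
        rwa [e.symm_continuousLinearEquivAt_eq hf]
      exact (e.continuousLinearEquivAt ℝ f hf).symm.injective h2
    exact ⟨hinj, LinearMap.injective_iff_surjective (f := (B f).toLinearMap).1 hinj⟩
  have hBinv : ∀ f ∈ e.baseSet, ∃ B' : E 10 ≃L[ℝ] E 10, (B' : E 10 →L[ℝ] E 10) = B f := by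
    intro f hf
    refine ⟨(LinearEquiv.ofBijective (B f).toLinearMap (hBbij f hf)).toContinuousLinearEquiv, ?_⟩
    ext u
    rfl
  obtain ⟨B₀, hB₀⟩ := hBinv f₀ hf₀
  have h1 : ContMDiffAt (𝓡 10) 𝓘(ℝ, E 10 →L[ℝ] E 10) ∞
      (fun f => ContinuousLinearMap.inverse (B f)) f₀ := by
    have h2 : ContDiffAt ℝ ∞ (ContinuousLinearMap.inverse : (E 10 →L[ℝ] E 10) → _) (B f₀) :=
      hB₀ ▸ contDiffAt_map_inverse B₀
    exact h2.contMDiffAt.comp f₀ hBsmooth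
  have h2 : ContMDiffAt (𝓡 10) 𝓘(ℝ, E 10) ∞
      (fun f => ContinuousLinearMap.inverse (B f) (R X)) f₀ := h1.clm_apply contMDiffAt_const
  refine (contMDiffAt_trivialization_symm f₀ contMDiffAt_id h2 hf₀).congr_of_eventuallyEq ?_
  filter_upwards [e.open_baseSet.mem_nhds hf₀] with f hf
  refine M.tangent_ext (hZ f) ?_
  rw [hX f]
  obtain ⟨B', hB'⟩ := hBinv f hf
  have h3 : R (M.conn f (e.symm f (ContinuousLinearMap.inverse (B f) (R X)))) = R X := by
    rw [← hB f hf, ← hB', ContinuousLinearMap.inverse_equiv]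
    exact B'.apply_symm_apply _
  have hXmem : X ∈ deSitterAlgebra := hX f ▸ (M.conn _ (Z f).2).2
  exact (congrArg Subtype.val (hRinj _ ⟨X, hXmem⟩ h3)).symm

end CartanGeometry

/-! ### The manifold of transverse planes -/

namespace CartanGeometry

variable {F : Type*} [TopologicalSpace F] [ChartedSpace (E 10) F] [IsManifold (𝓡 10) ∞ F]
  {S : Type*} [TopologicalSpace S] [ChartedSpace (E 3) S] [IsManifold (𝓡 3) ∞ S]
  (M : MoebiusGeometry F S)

/-- The map `f ↦ dπ'_f (A_f⁻¹(𝔤₋))` from `F` to the transverse planes. Its fibres are the orbits of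
`K`. -/
noncomputable def toPlane (f : F) : transversePlanes M.inducedConformal :=
  ⟨M.planeAt f, M.planeAt_mem f⟩

/-- The bijection from `F/K` to the transverse planes that `toPlane` induces. -/
noncomputable def planeEquiv : M.OrbitSpace ≃ transversePlanes M.inducedConformal :=
  Equiv.ofBijective (Quotient.lift M.toPlane (by
    rintro f _ ⟨k, rfl⟩
    exact Subtype.ext (M.planeAt_actK f k).symm)) (by
    constructor
    · intro x y h
      obtain ⟨f, rfl⟩ := M.isOpenQuotientMap_toOrbit.surjective x
      obtain ⟨f', rfl⟩ := M.isOpenQuotientMap_toOrbit.surjective y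
      exact M.toOrbit_eq_iff.2 (M.exists_actK_of_planeAt_eq (congrArg Subtype.val h))
    · rintro ⟨W, hW⟩
      obtain ⟨f, rfl⟩ := M.exists_planeAt_eq hW
      exact ⟨M.toOrbit f, rfl⟩)

theorem contMDiff_tangentMap_toForm :
    ContMDiff (𝓡 10).tangent formModel.tangent ∞ (tangentMap (𝓡 10) formModel M.toForm) :=
  M.contMDiff_toForm.contMDiff_tangentMap (by simp)

/-- The planes of the points of `F` are spanned by the images of the vector fields that are
constant for the connection, so they depend smoothly on the point. -/
theorem exists_smooth_frame {k : ℕ} {U : Set (E k)}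
    {σ : E k → F} (hσ : ContMDiffOn (𝓡 k) (𝓡 10) ∞ σ U)
    {h : E k → Σ m : FormBundle S, Submodule ℝ (TangentSpace formModel m)}
    (hh : ∀ p ∈ U, M.planeAt (σ p) = h p) :
    ∃ w : Fin 3 → ∀ p : E k, TangentSpace formModel (h p).1,
      (∀ i, ContMDiffOn (𝓡 k) formModel.tangent ∞
        (fun p => (⟨(h p).1, w i p⟩ : TangentBundle formModel (FormBundle S))) U) ∧
      ∀ p ∈ U, (h p).2 = Submodule.span ℝ (Set.range fun i => w i p) := by
  choose z hz hspan hli using M.exists_planeAt_frame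
  have hsmooth : ∀ i, ContMDiff (𝓡 10) (𝓡 10).tangent ∞
      (fun f => (⟨f, z f i⟩ : TangentBundle (𝓡 10) F)) := fun i =>
    M.contMDiff_of_conn_eq (fun _ => rfl) fun f => hz f i
  have hex : ∀ p, ∃ w : Fin 3 → TangentSpace formModel (h p).1, p ∈ U →
      (∀ i, (⟨(h p).1, w i⟩ : TangentBundle formModel (FormBundle S)) =
        tangentMap (𝓡 10) formModel M.toForm ⟨σ p, z (σ p) i⟩) ∧
      (h p).2 = Submodule.span ℝ (Set.range w) := by
    intro p
    by_cases hp : p ∈ U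
    · rw [← hh p hp]
      exact ⟨fun i => mfderiv (𝓡 10) formModel M.toForm (σ p) (z (σ p) i),
        fun _ => ⟨fun _ => rfl, hspan _⟩⟩
    · exact ⟨0, fun h => (hp h).elim⟩
  choose w hw using hex
  refine ⟨fun i p => w p i, fun i => ?_, fun p hp => (hw p hp).2⟩
  have h1 := (M.contMDiff_tangentMap_toForm.comp (hsmooth i)).comp_contMDiffOn hσ
  exact h1.congr fun p hp => (hw p hp).1 i

/-- A smooth family of transverse planes is locally the family of planes of a smooth family of
points of `F`. -/
theorem exists_lift_planeFamily {k : ℕ} {h : E k → transversePlanes M.inducedConformal}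
    (hh : IsSmoothPlaneFamily M.inducedConformal h) (p₀ : E k) :
    ∃ σ : E k → F, ContMDiffAt (𝓡 k) (𝓡 10) ∞ σ p₀ ∧ ∀ᶠ p in 𝓝 p₀, M.toPlane (σ p) = h p := by
  obtain ⟨hbase, hfam⟩ := hh
  obtain ⟨U, hU, hp₀, w, hw, hspan⟩ := hfam p₀
  obtain ⟨O, σ, hO, hmO, hσ, hlift⟩ := M.exists_lift (h p₀).2.1
  have hO' : ∀ᶠ p in 𝓝 p₀, (h p).1.1 ∈ O :=
    hbase.continuous.continuousAt.eventually (hO.mem_nhds hmO)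
  let Z : E k → Fin 3 → TangentBundle (𝓡 10) F := fun p i =>
    tangentMap formModel (𝓡 10) σ ⟨(h p).1.1, w i p⟩
  have hplane : ∀ p ∈ U, (h p).1.1 ∈ O →
      (Matrix.of fun i => spatialPart (M.nullMotion (Z p i))).det ≠ 0 ∧
      M.planeAt (M.act (σ (h p).1.1)
        (parabolicSlice (0, planeCoord fun i => M.nullMotion (Z p i)))) = (h p).1 := by
    intro p hpU hpO
    refine M.planeAt_act_planeCoord (h p).2 (hlift _ hpO (h p).2.1) (hspan p hpU)
      (fun i => rfl) fun i => M.tangentMap_toForm_lift hO hσ hlift hpO ((h p).2.2.1 ?_)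
    rw [SetLike.mem_coe, hspan p hpU]
    exact Submodule.subset_span ⟨i, rfl⟩
  refine ⟨fun p => M.act (σ (h p).1.1)
    (parabolicSlice (0, planeCoord fun i => M.nullMotion (Z p i))), ?_, ?_⟩
  · have h1 : ContMDiffAt (𝓡 k) (𝓡 10) ∞ (fun p => σ (h p).1.1) p₀ :=
      (hσ.contMDiffAt (hO.mem_nhds hmO)).comp p₀ hbase.contMDiffAt
    have h2 : ∀ i, ContMDiffAt (𝓡 k) (𝓡 10).tangent ∞ (fun p => Z p i) p₀ := by
      intro i
      exact (hσ.contMDiffAt_tangentMap hO (V := ⟨(h p₀).1.1, w i p₀⟩) hmO).comp p₀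
        ((hw i).contMDiffAt (hU.mem_nhds hp₀))
    have h3 : ContMDiffAt (𝓡 k) 𝓘(ℝ, Fin 3 → Fin 5 → ℝ) ∞
        (fun p i => M.nullMotion (Z p i)) p₀ :=
      contMDiffAt_pi_space.2 fun i => M.contMDiff_nullMotion.contMDiffAt.comp p₀ (h2 i)
    have h4 : ContMDiffAt (𝓡 k) 𝓘(ℝ, Fin 3 → ℝ) ∞
        (fun p => planeCoord fun i => M.nullMotion (Z p i)) p₀ :=
      ContMDiffAt.comp p₀ (g := planeCoord)
        (contDiffAt_planeCoord (hplane p₀ hp₀ hmO).1).contMDiffAt h3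
    refine M.contMDiffAt_act h1 ?_
    exact contDiff_entries_parabolicSlice.contMDiff.contMDiffAt.comp p₀
      (contMDiffAt_const.prodMk_space h4)
  · filter_upwards [hU.mem_nhds hp₀, hO'] with p hpU hpO
    exact Subtype.ext (hplane p hpU hpO).2

/-- A manifold structure for which `F` maps to the transverse planes smoothly and with smooth local
sections is the standard one. -/
theorem isStandardPlaneManifold [TopologicalSpace (transversePlanes M.inducedConformal)]
    [ChartedSpace (E 7) (transversePlanes M.inducedConformal)]
    [IsManifold (𝓡 7) ∞ (transversePlanes M.inducedConformal)]
    (hsmooth : ContMDiff (𝓡 10) (𝓡 7) ∞ M.toPlane) (hsec : HasLocalSections 10 7 M.toPlane) :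
    IsStandardPlaneManifold M.inducedConformal := by
  refine ⟨inferInstance, fun k h => ⟨fun hh => ?_, fun hh p₀ => ?_⟩⟩
  · have hloc : ∀ p₀ : E k, ∃ U : Set (E k), IsOpen U ∧ p₀ ∈ U ∧ ∃ σ : E k → F,
        ContMDiffOn (𝓡 k) (𝓡 10) ∞ σ U ∧ ∀ p ∈ U, M.toPlane (σ p) = h p := by
      intro p₀
      obtain ⟨U, hU, hp₀, s, hs, hqs⟩ := hsec (h p₀)
      exact ⟨h ⁻¹' U, hU.preimage hh.continuous, hp₀, s ∘ h,
        hs.comp hh.contMDiffOn fun p hp => hp, fun p hp => hqs _ hp⟩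
    refine ⟨fun p₀ => ?_, fun p₀ => ?_⟩
    · obtain ⟨U, hU, hp₀, σ, hσ, hσh⟩ := hloc p₀
      have h1 := M.contMDiff_toForm.comp_contMDiffOn hσ
      refine (h1.congr fun p hp => ?_).contMDiffAt (hU.mem_nhds hp₀)
      rw [← hσh p hp]
      rfl
    · obtain ⟨U, hU, hp₀, σ, hσ, hσh⟩ := hloc p₀
      exact ⟨U, hU, hp₀, M.exists_smooth_frame (h := fun p => (h p).1) hσ
        fun p hp => congrArg Subtype.val (hσh p hp)⟩
  · obtain ⟨σ, hσ, hσh⟩ := M.exists_lift_planeFamily hh p₀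
    refine (hsmooth.contMDiffAt.comp p₀ hσ).congr_of_eventuallyEq ?_
    filter_upwards [hσh] with p hp
    exact hp.symm

end CartanGeometry

theorem mainTheorem1
    {S : Type*} [TopologicalSpace S] [T2Space S] [SecondCountableTopology S]
    [ChartedSpace (E 3) S] [IsManifold (𝓡 3) ∞ S]
    {F : Type*} [TopologicalSpace F] [T2Space F] [SecondCountableTopology F]
    [ChartedSpace (E 10) F] [IsManifold (𝓡 10) ∞ F]
    (M : MoebiusGeometry F S) :
    T2Space M.OrbitSpace ∧ SecondCountableTopology M.OrbitSpace ∧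
    ∃ (chartsFK : ChartedSpace (E 7) M.OrbitSpace),
      IsManifold (𝓡 7) ∞ M.OrbitSpace ∧
      -- `F → F/K` with the given form `A` is an observer space geometry
      (∃ O : ObserverSpaceGeometry F M.OrbitSpace,
        O.proj = M.toOrbit ∧ O.act = M.actK ∧ O.conn = M.conn) ∧
      -- the smooth structure on `F/K` is the only one for which `F → F/K` is a principal `K`-bundle
      (∀ charts' : ChartedSpace (E 7) M.OrbitSpace,
        @IsManifold ℝ _ (E 7) _ _ (E 7) _ (𝓡 7) ∞ M.OrbitSpace _ charts' →
        (∃ B : @PrincipalBundle rotationGroup 10 7 F _ _ M.OrbitSpace _ charts',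
          B.proj = M.toOrbit ∧ B.act = M.actK) →
        @ContMDiff ℝ _ (E 7) _ _ (E 7) _ (𝓡 7) M.OrbitSpace _ chartsFK
          (E 7) _ _ (E 7) _ (𝓡 7) M.OrbitSpace _ charts' ∞ id ∧
        @ContMDiff ℝ _ (E 7) _ _ (E 7) _ (𝓡 7) M.OrbitSpace _ charts'
          (E 7) _ _ (E 7) _ (𝓡 7) M.OrbitSpace _ chartsFK ∞ id) ∧
      -- identification with the transverse 3-planes in the tautological bundle
      IsConformalMetric M.inducedConformal ∧
      ∃ pi' : F → FormBundle S,
        ContMDiff (𝓡 10) formModel ∞ pi' ∧ (∀ f, M.IsCoframePullback f (pi' f)) ∧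
        ∃ (_ : TopologicalSpace (transversePlanes M.inducedConformal))
          (_ : ChartedSpace (E 7) (transversePlanes M.inducedConformal)),
          IsStandardPlaneManifold M.inducedConformal ∧
          ∃ Φ : Diffeomorph (𝓡 7) (𝓡 7) M.OrbitSpace
              (transversePlanes M.inducedConformal) ∞,
            ∀ f : F, (Φ (M.toOrbit f)).1 =
              ⟨pi' f, (M.minusSpace f).map (mfderiv (𝓡 10) formModel pi' f).toLinearMap⟩ := by
  have hslice : ∀ f, ∃ s : LocalSlice 10 7 M.toOrbit, f ∈ s.V := fun f => by
    obtain ⟨s, hs, -⟩ := M.exists_localSlice f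
    exact ⟨s, mem_of_mem_nhds hs⟩
  obtain ⟨chartsFK, hmanifold, hsmooth, hsec⟩ :=
    LocalSlice.exists_manifold M.isOpenQuotientMap_toOrbit hslice
  -- The topology on the transverse planes for which `planeEquiv` is a homeomorphism.
  let _ : TopologicalSpace (transversePlanes M.inducedConformal) :=
    TopologicalSpace.coinduced M.planeEquiv inferInstance
  let Ψ : M.OrbitSpace ≃ₜ transversePlanes M.inducedConformal :=
    M.planeEquiv.toHomeomorph fun _ => isOpen_coinduced.symm
  have hquot : IsOpenQuotientMap M.toPlane :=
    Ψ.isOpenQuotientMap.comp M.isOpenQuotientMap_toOrbit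
  have hslice' : ∀ f, ∃ s : LocalSlice 10 7 M.toPlane, f ∈ s.V := fun f => by
    obtain ⟨s, hs⟩ := hslice f
    exact ⟨s.compEquiv M.planeEquiv, hs⟩
  obtain ⟨chartsT, hmanifoldT, hsmoothT, hsecT⟩ := LocalSlice.exists_manifold hquot hslice'
  refine ⟨M.t2Space_orbitSpace, M.secondCountableTopology_orbitSpace, chartsFK, hmanifold,
    ⟨M.observerGeometry hsmooth hsec, rfl, rfl, rfl⟩, ?_, M.isConformalMetric_inducedConformal,
    M.toForm, M.contMDiff_toForm, M.isCoframePullback_toForm, inferInstance, chartsT,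
    M.isStandardPlaneManifold hsmoothT hsecT,
    { toEquiv := M.planeEquiv
      contMDiff_toFun := hsec.contMDiff_of_comp hsmoothT
      contMDiff_invFun := hsecT.contMDiff_of_comp (hsmooth.congr fun f =>
        M.planeEquiv.symm_apply_apply (M.toOrbit f)) }, fun f => rfl⟩
  rintro charts' - ⟨B, hB, -⟩
  have hsec' : @HasLocalSections 10 7 F _ _ M.OrbitSpace _ charts' M.toOrbit :=
    hB ▸ @PrincipalBundle.hasLocalSections 10 7 F _ _ M.OrbitSpace _ charts' rotationGroup B
  have hsmooth' : @ContMDiff ℝ _ (E 10) _ _ (E 10) _ (𝓡 10) F _ _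
      (E 7) _ _ (E 7) _ (𝓡 7) M.OrbitSpace _ charts' ∞ M.toOrbit :=
    hB ▸ @PrincipalBundle.proj_smooth _ _ _ _ _ _ _ _ charts' B
  exact ⟨@HasLocalSections.contMDiff_of_comp 10 7 F _ _ M.OrbitSpace _ chartsFK M.toOrbit hsec
      (E 7) _ _ (E 7) _ (𝓡 7) M.OrbitSpace _ charts' id hsmooth',
    @HasLocalSections.contMDiff_of_comp 10 7 F _ _ M.OrbitSpace _ charts' M.toOrbit hsec'
      (E 7) _ _ (E 7) _ (𝓡 7) M.OrbitSpace _ chartsFK id hsmooth⟩
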